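/- Let $p$ be a prime, $m\ge 0$ an integer, and let $F$ be a $C_m$ field of characteristic $p$; that is, every homogeneous polynomial of degree $d\ge 1$ over $F$ in $n>d^m$ variables has a nontrivial zero in $F^n$. Two finite-dimensional central simple $F$-algebras $A,B$ are similar, $A\sim B$, if $M_k(A)\cong M_l(B)$ for some $k,l\ge 1$; the classes form the Brauer group $\mathrm{Br}(F)$ under $\otimes_F$, and the exponent $\exp(A)$ is the order of $[A]$ in $\mathrm{Br}(F)$. The index $\mathrm{ind}(A)$ is the degree $\sqrt{\dim_F D}$ of the central division algebra $D$ with $A\cong M_k(D)$. A cyclic algebra of degree $n$ is a central simple $F$-algebra of dimension $n^2$ of the form $(L/F,\sigma,b)=\bigoplus_{i=0}^{n-1}Ly^i$, $y^n=b\in F^\times$, $yl=\sigma(l)y$ for $l \in L$, where $L/F$ is a cyclic Galois field extension of degree $n$ with group generated by $\sigma$. Then: 1. For every $e\ge 0$, every finite-dimensional central simple $F$-algebra $A$ of exponent $p^e$ is similar to a tensor product of at most $m$ cyclic algebras of degree $p^e$ (the empty product being $F$). 2. For every $e\ge 0$, $\mathrm{len}(p^e,F)\le m$, where $\mathrm{len}(p^e,F)$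 is the supremum, over all central simple $F$-algebras $A$ of exponent $p^e$, of the minimal number of cyclic algebras of degree $p^e$ whose tensor product is similar to $A$. 3. $\mathrm{Brdim}_p(F)\le m$, where $\mathrm{Brdim}_p(F)$ is the smallest integer $d$ such that $\mathrm{ind}(A)$ divides $\exp(A)^d$ for all $n$ and all central simple $F$-algebras $A$ with $[A]^{p^n}=1$ in $\mathrm{Br}(F)$ (and $\infty$ if there is no such $d$). -/

import Mathlib

open scoped TensorProduct

universe u

/-- A field `F` is a `C_m` field if every homogeneous polynomial of degree `d ≥ 1` in `n > d ^ m`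
variables over `F` has a nontrivial zero. -/
def IsCmField (m : ℕ) (F : Type u) [Field F] : Prop :=
  ∀ (d n : ℕ), 1 ≤ d → d ^ m < n → ∀ f : MvPolynomial (Fin n) F, f.IsHomogeneous d →
    ∃ x : Fin n → F, x ≠ 0 ∧ MvPolynomial.eval x f = 0

section TensorProductOfCSA

variable {K : Type u} [Field K] {A B : Type u} [Ring A] [Ring B] [Algebra K A] [Algebra K B]

/-- In `A ⊗ B` with `A` central, the centralizer of `A ⊗ 1` is `1 ⊗ B`. -/
theorem exists_eq_one_tmul_of_commute [Algebra.IsCentral K A] (x : A ⊗[K] B)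
    (hx : ∀ a : A, (a ⊗ₜ[K] (1 : B)) * x = x * (a ⊗ₜ[K] (1 : B))) :
    ∃ b : B, x = (1 : A) ⊗ₜ[K] b := by
  have h1 : x ∈ Subalgebra.centralizer K
      (Algebra.TensorProduct.includeLeft : A →ₐ[K] A ⊗[K] B).range := by
    rw [Subalgebra.mem_centralizer_iff]
    rintro _ ⟨a, rfl⟩
    exact hx a
  rw [Subalgebra.centralizer_coe_range_includeLeft_eq_center_tensorProduct] at h1
  obtain ⟨y, rfl⟩ := h1
  clear hx
  change ∃ b : B, (Algebra.TensorProduct.map (Subalgebra.center K A).val (AlgHom.id K B)) y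
    = (1 : A) ⊗ₜ[K] b
  induction y using TensorProduct.induction_on with
  | zero => exact ⟨0, by simp⟩
  | tmul c b =>
    obtain ⟨k, hk⟩ := Algebra.mem_bot.1 (Algebra.IsCentral.out c.2)
    refine ⟨k • b, ?_⟩
    simp [← hk, Algebra.algebraMap_eq_smul_one, TensorProduct.smul_tmul]
  | add y z hy hz =>
    obtain ⟨b, hb⟩ := hy
    obtain ⟨c, hc⟩ := hz
    exact ⟨b + c, by rw [map_add, hb, hc, TensorProduct.tmul_add]⟩

theorem isCentral_tensorProduct [Algebra.IsCentral K A] [Algebra.IsCentral K B] :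
    Algebra.IsCentral K (A ⊗[K] B) where
  out := by
    intro x hx
    rw [Subalgebra.mem_center_iff] at hx
    obtain ⟨b, rfl⟩ := exists_eq_one_tmul_of_commute x fun a => hx _
    by_cases hA : Nontrivial A
    · have hb : b ∈ Subalgebra.center K B := by
        rw [Subalgebra.mem_center_iff]
        intro c
        have h := hx ((1 : A) ⊗ₜ[K] c)
        simp only [Algebra.TensorProduct.tmul_mul_tmul, mul_one] at h
        exact Algebra.TensorProduct.includeRight_injective (R := K) (A := A) (B := B)
          (FaithfulSMul.algebraMap_injective K A) h
      obtain ⟨k, hk⟩ := Algebra.mem_bot.1 (Algebra.IsCentral.out hb)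
      exact Algebra.mem_bot.2 ⟨k, by
        rw [← hk, Algebra.algebraMap_eq_smul_one, Algebra.algebraMap_eq_smul_one,
          TensorProduct.tmul_smul]; rfl⟩
    · rw [not_nontrivial_iff_subsingleton] at hA
      rw [Subsingleton.elim (1 : A) 0, TensorProduct.zero_tmul]
      exact zero_mem _

theorem isSimpleRing_tensorProduct [Algebra.IsCentral K A] [IsSimpleRing A] [IsSimpleRing B] :
    IsSimpleRing (A ⊗[K] B) := by
  classical
  refine IsSimpleRing.of_eq_bot_or_eq_top fun I => ?_
  by_cases hI : I = ⊥
  · exact Or.inl hI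
  right
  let bs := Module.Free.chooseBasis K B
  let φ := TensorProduct.equivFinsuppOfBasisRight (M := A) bs
  have hφ : ∀ (a a' : A) (x : A ⊗[K] B) i,
      φ ((a ⊗ₜ[K] (1 : B)) * x * (a' ⊗ₜ[K] (1 : B))) i = a * φ x i * a' := by
    intro a a' x i
    induction x using TensorProduct.induction_on with
    | zero => simp
    | tmul c b => simp [φ]
    | add y z hy hz => simp only [mul_add, add_mul, map_add, Finsupp.add_apply, hy, hz]
  obtain ⟨x₀, hx₀I, hx₀⟩ : ∃ x ∈ I, x ≠ 0 := by
    by_contra! h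
    exact hI (le_antisymm (fun x hx => by rw [h x hx]; exact zero_mem _) bot_le)
  have hex : ∃ n, ∃ x ∈ I, x ≠ 0 ∧ (φ x).support.card = n := ⟨_, x₀, hx₀I, hx₀, rfl⟩
  obtain ⟨x, hxI, hx0, hxn⟩ := Nat.find_spec hex
  have hmin : ∀ y ∈ I, (φ y).support.card < (φ x).support.card → y = 0 := by
    intro y hy hlt
    by_contra hy0
    rw [hxn] at hlt
    exact Nat.find_min hex hlt ⟨y, hy, hy0, rfl⟩
  obtain ⟨j, hj⟩ : (φ x).support.Nonempty := by
    rw [Finsupp.support_nonempty_iff]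
    simpa using hx0
  -- the two-sided ideal of `j`-th coefficients
  let J : TwoSidedIdeal A := TwoSidedIdeal.mk'
    {a | ∃ y ∈ I, (φ y).support ⊆ (φ x).support ∧ φ y j = a}
    ⟨0, zero_mem _, by simp, by simp⟩
    (by
      rintro _ _ ⟨y, hy, hys, rfl⟩ ⟨z, hz, hzs, rfl⟩
      refine ⟨y + z, add_mem hy hz, ?_, by simp⟩
      rw [map_add]
      exact Finsupp.support_add.trans (Finset.union_subset hys hzs))
    (by
      rintro _ ⟨y, hy, hys, rfl⟩
      exact ⟨-y, neg_mem hy, by simpa using hys, by simp⟩)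
    (by
      rintro a _ ⟨y, hy, hys, rfl⟩
      refine ⟨(a ⊗ₜ[K] (1 : B)) * y * ((1 : A) ⊗ₜ[K] (1 : B)),
        I.mul_mem_right _ _ (I.mul_mem_left _ _ hy), ?_, by rw [hφ, mul_one]⟩
      refine subset_trans ?_ hys
      intro i hi
      rw [Finsupp.mem_support_iff, hφ] at hi
      rw [Finsupp.mem_support_iff]
      rintro h
      simp [h] at hi)
    (by
      rintro _ a ⟨y, hy, hys, rfl⟩
      refine ⟨((1 : A) ⊗ₜ[K] (1 : B)) * y * (a ⊗ₜ[K] (1 : B)),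
        I.mul_mem_right _ _ (I.mul_mem_left _ _ hy), ?_, by rw [hφ, one_mul]⟩
      refine subset_trans ?_ hys
      intro i hi
      rw [Finsupp.mem_support_iff, hφ] at hi
      rw [Finsupp.mem_support_iff]
      rintro h
      simp [h] at hi)
  have hJ : (1 : A) ∈ J := by
    refine IsSimpleRing.one_mem_of_ne_zero_mem J (x := φ x j) (Finsupp.mem_support_iff.1 hj) ?_
    rw [TwoSidedIdeal.mem_mk']
    exact ⟨x, hxI, subset_rfl, rfl⟩
  rw [TwoSidedIdeal.mem_mk'] at hJ
  obtain ⟨y, hyI, hys, hy1⟩ := hJ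
  have hcomm : ∀ a : A, (a ⊗ₜ[K] (1 : B)) * y = y * (a ⊗ₜ[K] (1 : B)) := by
    intro a
    rw [← sub_eq_zero]
    have e1 : ∀ i, φ ((a ⊗ₜ[K] (1 : B)) * y) i = a * φ y i := fun i => by
      have := hφ a 1 y i
      rwa [← Algebra.TensorProduct.one_def, mul_one, mul_one] at this
    have e2 : ∀ i, φ (y * (a ⊗ₜ[K] (1 : B))) i = φ y i * a := fun i => by
      have := hφ 1 a y i
      rwa [← Algebra.TensorProduct.one_def, one_mul, one_mul] at this
    refine hmin _ (sub_mem (I.mul_mem_left _ _ hyI) (I.mul_mem_right _ _ hyI)) ?_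
    refine Finset.card_lt_card ⟨?_, fun h => ?_⟩
    · intro i hi
      apply hys
      rw [Finsupp.mem_support_iff, map_sub, Finsupp.sub_apply, e1, e2] at hi
      rw [Finsupp.mem_support_iff]
      rintro h
      simp [h] at hi
    · have := h hj
      rw [Finsupp.mem_support_iff, map_sub, Finsupp.sub_apply, e1, e2, hy1] at this
      simp at this
  obtain ⟨b, rfl⟩ := exists_eq_one_tmul_of_commute y hcomm
  have hb : b ≠ 0 := by
    rintro rfl
    simp at hy1
  let J' : TwoSidedIdeal B := TwoSidedIdeal.mk' {c | (1 : A) ⊗ₜ[K] c ∈ I}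
    (by simp [zero_mem])
    (fun {c d} hc hd => by
      simpa [TensorProduct.tmul_add] using add_mem hc hd)
    (fun {c} hc => by
      simpa [TensorProduct.tmul_neg] using neg_mem (S := TwoSidedIdeal (A ⊗[K] B)) (show (1 : A) ⊗ₜ[K] c ∈ I from hc))
    (fun {c d} hd => by
      simpa using I.mul_mem_left ((1 : A) ⊗ₜ[K] c) _ hd)
    (fun {c d} hc => by
      simpa using I.mul_mem_right _ ((1 : A) ⊗ₜ[K] d) hc)
  have hJ' : (1 : B) ∈ J' := by
    refine IsSimpleRing.one_mem_of_ne_zero_mem J' hb ?_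
    rw [TwoSidedIdeal.mem_mk']
    exact hyI
  rw [TwoSidedIdeal.mem_mk'] at hJ'
  exact (I.one_mem_iff).1 hJ'

end TensorProductOfCSA

namespace CSA

variable {F : Type u} [Field F]

/-- The central simple algebra `F` over `F`. -/
def base (F : Type u) [Field F] : CSA.{u, u} F :=
  { AlgCat.of F F with
    isCentral := inferInstanceAs (Algebra.IsCentral F F)
    isSimple := inferInstanceAs (IsSimpleRing F)
    fin_dim := inferInstanceAs (FiniteDimensional F F) }

/-- The tensor product `A ⊗[F] B` of two central simple algebras. -/
noncomputable def tensor (A B : CSA.{u, u} F) : CSA.{u, u} F :=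
  { AlgCat.of F (A ⊗[F] B) with
    isCentral := isCentral_tensorProduct (K := F) (A := A) (B := B)
    isSimple := isSimpleRing_tensorProduct (K := F) (A := A) (B := B)
    fin_dim := inferInstanceAs (FiniteDimensional F (A ⊗[F] B)) }

theorem isBrauerEquivalent_of_algEquiv {A B : CSA.{u, u} F} (e : A ≃ₐ[F] B) :
    IsBrauerEquivalent A B :=
  ⟨1, 1, one_ne_zero, one_ne_zero, ⟨e.mapMatrix⟩⟩

theorem isBrauerEquivalent_tensor {A A' B B' : CSA.{u, u} F} (hA : IsBrauerEquivalent A A')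
    (hB : IsBrauerEquivalent B B') : IsBrauerEquivalent (A.tensor B) (A'.tensor B') := by
  obtain ⟨n, m, hn, hm, ⟨e⟩⟩ := hA
  obtain ⟨k, l, hk, hl, ⟨f⟩⟩ := hB
  have key : ∀ (a b : ℕ) (X Y : CSA.{u, u} F), Nonempty
      (Matrix (Fin (a * b)) (Fin (a * b)) (X.tensor Y) ≃ₐ[F]
        Matrix (Fin a) (Fin a) X ⊗[F] Matrix (Fin b) (Fin b) Y) := fun a b X Y =>
    ⟨(Matrix.reindexAlgEquiv F (X.tensor Y) finProdFinEquiv).symm.trans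
      (Matrix.kroneckerTMulAlgEquiv (Fin a) (Fin b) F F X Y).symm⟩
  obtain ⟨g⟩ := key n k A B
  obtain ⟨h⟩ := key m l A' B'
  exact ⟨n * k, m * l, mul_ne_zero hn hk, mul_ne_zero hm hl,
    ⟨(g.trans (Algebra.TensorProduct.congr e f)).trans h.symm⟩⟩

/-- The class of a central simple algebra in the Brauer group. -/
def brauerClass (A : CSA.{u, u} F) : BrauerGroup.{u, u} F := Quotient.mk _ A

end CSA

/-- The multiplication of the Brauer group, `[A] * [B] = [A ⊗ B]`, with unit `[F]`. (The existence
of inverses is not needed to speak of products and of orders of elements.) -/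
noncomputable instance BrauerGroup.instCommMonoid (F : Type u) [Field F] :
    CommMonoid (BrauerGroup.{u, u} F) where
  mul := Quotient.map₂ CSA.tensor fun _ _ hA _ _ hB => CSA.isBrauerEquivalent_tensor hA hB
  one := (CSA.base F).brauerClass
  mul_assoc := by
    rintro ⟨A⟩ ⟨B⟩ ⟨C⟩
    exact Quotient.sound
      (CSA.isBrauerEquivalent_of_algEquiv (Algebra.TensorProduct.assoc F F F A B C))
  one_mul := by
    rintro ⟨A⟩
    exact Quotient.sound (CSA.isBrauerEquivalent_of_algEquiv (Algebra.TensorProduct.lid F A))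
  mul_one := by
    rintro ⟨A⟩
    exact Quotient.sound (CSA.isBrauerEquivalent_of_algEquiv (Algebra.TensorProduct.rid F F A))
  mul_comm := by
    rintro ⟨A⟩ ⟨B⟩
    exact Quotient.sound (CSA.isBrauerEquivalent_of_algEquiv (Algebra.TensorProduct.comm F A B))

namespace CSA

variable {F : Type u} [Field F]

/-- The exponent of `A`: the order of `[A]` in the Brauer group. -/
noncomputable def exponent (A : CSA.{u, u} F) : ℕ := orderOf A.brauerClass

/-- The degree of `A`: the square root of `dim_F A` (which is a perfect square). -/
noncomputable def degree (A : CSA.{u, u} F) : ℕ := Nat.sqrt (Module.finrank F A)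

/-- Every central simple algebra is a matrix algebra over a central division algebra. -/
theorem exists_division (A : CSA.{u, u} F) :
    ∃ D : CSA.{u, u} F, (∀ x : D, x ≠ 0 → IsUnit x) ∧
      ∃ n : ℕ, n ≠ 0 ∧ Nonempty (A ≃ₐ[F] Matrix (Fin n) (Fin n) D) := by
  have : IsArtinianRing A := IsArtinianRing.of_finite F A
  obtain ⟨n, hn, D, hD, hD', hfin, ⟨e⟩⟩ :=
    IsSimpleRing.exists_algEquiv_matrix_divisionRing_finite F A
  have h1 : Algebra.IsCentral F (D ⊗[F] Matrix (Fin n) (Fin n) F) :=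
    Algebra.IsCentral.of_algEquiv F _ _ (e.trans (matrixEquivTensor (Fin n) F D))
  have h2 : Algebra.IsCentral F D :=
    Algebra.IsCentral.left_of_tensor_of_field F D (Matrix (Fin n) (Fin n) F)
  exact ⟨{ AlgCat.of F D with
      isCentral := h2
      isSimple := inferInstanceAs (IsSimpleRing D)
      fin_dim := hfin },
    fun x hx => IsUnit.mk0 (G₀ := D) x hx, n, NeZero.ne n, ⟨e⟩⟩

/-- The underlying division algebra `D` of `A`, so that `A ≅ M_n(D)`; it is unique up to
isomorphism. -/
noncomputable def underlyingDivision (A : CSA.{u, u} F) : CSA.{u, u} F :=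
  A.exists_division.choose

/-- The index of `A`: the degree of its underlying division algebra. -/
noncomputable def index (A : CSA.{u, u} F) : ℕ := A.underlyingDivision.degree

/-- `A` is a cyclic algebra `(L/F, σ, b)` of degree `n`: `L/F` is a cyclic Galois field extension
of degree `n` whose Galois group is generated by `σ`, `b` is a nonzero element of `F`, and `A` has
dimension `n ^ 2` and contains `L` and an element `y` with `y ^ n = b` and `y l = σ(l) y` for all
`l ∈ L`. (Then `A = L ⊕ L y ⊕ ⋯ ⊕ L y ^ (n - 1)`.) -/
def IsCyclicAlgebra (n : ℕ) (A : CSA.{u, u} F) : Prop :=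
  Module.finrank F A = n ^ 2 ∧
  ∃ (L : Type u) (_ : Field L) (_ : Algebra F L) (σ : L ≃ₐ[F] L) (b : F) (i : L →ₐ[F] A) (y : A),
    IsGalois F L ∧ Module.finrank F L = n ∧ (∀ τ : L ≃ₐ[F] L, τ ∈ Subgroup.zpowers σ) ∧
    b ≠ 0 ∧ y ^ n = algebraMap F A b ∧ ∀ l : L, y * i l = i (σ l) * y

/-- `A` is similar to a tensor product of `r` cyclic algebras of degree `n`
(for `r = 0` the product is `F`). -/
def IsSimilarToProductOfCyclic (n r : ℕ) (A : CSA.{u, u} F) : Prop :=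
  ∃ C : Fin r → CSA.{u, u} F, (∀ i, (C i).IsCyclicAlgebra n) ∧
    A.brauerClass = ∏ i, (C i).brauerClass

/-- The symbol length `len(n, A)`: the minimal number of cyclic algebras of degree `n` whose
tensor product is similar to `A` (and `∞` if there is no such product). -/
noncomputable def symbolLength (n : ℕ) (A : CSA.{u, u} F) : ℕ∞ :=
  sInf {x : ℕ∞ | ∃ r : ℕ, x = r ∧ A.IsSimilarToProductOfCyclic n r}

end CSA

/-- The symbol length `len(n, F)`: the supremum of `len(n, A)` over all central simple
`F`-algebras `A` of exponent `n`. -/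
noncomputable def symbolLengthField (n : ℕ) (F : Type u) [Field F] : ℕ∞ :=
  ⨆ (A : CSA.{u, u} F) (_ : A.exponent = n), A.symbolLength n

/-- The Brauer dimension `Brdim_p(F)` at `p`: the smallest integer `d` such that `ind(A)` divides
`exp(A) ^ d` for all `n` and all `A` with `[A]` in the `p ^ n`-torsion of the Brauer group
(and `∞` if there is no such integer). -/
noncomputable def brauerDimAt (p : ℕ) (F : Type u) [Field F] : ℕ∞ :=
  sInf {x : ℕ∞ | ∃ d : ℕ, x = d ∧ ∀ (n : ℕ) (A : CSA.{u, u} F),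
    A.brauerClass ^ (p ^ n) = 1 → A.index ∣ A.exponent ^ d}

/-! The hypothesis on $F$ enters only once. Applied to diagonal forms $\sum y_i X_i^p$, it gives
$[F^{1/p}:F]\le p^m$ (`IsCmField.rank_frobeniusRoot_le`), so $F^{1/p}$ is generated by $m$ elements
$x_i$ with $x_i^p=a_i\in F^\times$. The $a_i$ do not depend on the algebra to be decomposed.

The $p$-torsion. A class killed by $p$ is split by $F^{1/p}$ (`CSA.isSplitOver_frobeniusRoot`): if
$c$ is the factor system of a Galois splitting, $c^p$ is a coboundary, so the Frobenius image of the
splitting carries a true semilinear Galois action, and its fixed space is a representation over $F$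
along Frobenius. The generators are then removed one at a time. If $K=E(x)$ splits $A$ and $x^p=a$,
the derivation $\delta=x\,d/dx$ lifts to an operator $D$ on $K^n$ commuting with $A$
(`exists_connection`). Since $\delta^p=\delta$, the operator $D^p-D$ is a scalar of $E$, and
$w=-D^p$ satisfies $w^p-w=f\in F$ and $xw=(w+1)x$. So the Artin–Schreier symbol $[f,a)$ acts next to
$A$, and $A\otimes[f,a)$ is split by $E$ (`CSA.exists_artinSchreierClass_isSplitOver`). Hence every
$p$-torsion class is a product of $m$ symbols with second entries $a_1,\dots,a_m$.

Higher exponents. The fixed second entries let the induction run without new factors. If $x^p=\prod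
c_i$ with $c_i=(L'/F,\sigma',a_i)$, then $L'$ lies in a cyclic extension $L=L'(u)$, $u^p-u=z$, of
$p$ times the degree (Albert), and $c_i'=(L/F,\sigma,a_i)$ has $c_i'^p=c_i$. The quotient $x/\prod
c_i'$ is $p$-torsion, hence a product of symbols $[f_i,a_i)$, and $c_i'[f_i,a_i)$ is again cyclic
with second entry $a_i$: replace $z$ by $z+f_i$ (`CSA.brauerClass_cyclic_mul_artinSchreier`).
Finally all degrees are raised to $p^e$ by $(L/F,\sigma,b^p)\sim(L'/F,\sigma',b)$
(`CSA.brauerClass_cyclic_tower`). The bounds on symbol length and Brauer dimension follow, as a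
product of $r$ cyclic algebras of degree $p^e$ has degree $(p^e)^r$.

Identities between cyclic classes are proved with modules. A central simple algebra acting on a
nonzero space whose squared dimension is at most that of the algebra is split. So
$[A]\,[(L/F,\sigma,a)]=1$ exactly when $A$ acts on a small $L$-space with a commuting
$\sigma$-semilinear map $x$, $x^n=a$ (`CSA.hasSemilinearRep_iff`). Each identity becomes the
construction of such a space as the kernel of an operator: it is nonzero because commuting operators
with equal $p$-th powers differ by a nilpotent, and small because vectors fixed by semilinear maps
stay independent over the larger field. -/

/-- `A` is split by the extension `K` of `F`: it embeds into the matrix algebra over `K` of the same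
degree. -/
def IsSplitOver (F K A : Type*) [Field F] [Field K] [Algebra F K] [Ring A] [Algebra F A] : Prop :=
  ∃ n : ℕ, n ≠ 0 ∧ n ^ 2 = Module.finrank F A ∧ Nonempty (A →ₐ[F] Matrix (Fin n) (Fin n) K)

/-! ### Splitting of central simple algebras by small representations -/

section Splitting

variable {F K A : Type u} [Field F] [Field K] [Algebra F K] [Ring A] [Algebra F A]

/-- The map `A ⊗ K → End_K V` attached to an action of `A` on `V`. -/
noncomputable def tensorToEnd {V : Type*} [AddCommGroup V] [Module F V] [Module K V]
    [IsScalarTower F K V] (ρ : A →ₐ[F] Module.End K V) : A ⊗[F] K →ₐ[F] Module.End K V :=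
  Algebra.TensorProduct.lift ρ (IsScalarTower.toAlgHom F K (Module.End K V))
    fun a k => by
      ext v
      simp [Module.End.mul_apply]

/-- Since $A\otimes K$ is simple, it embeds in $\mathrm{End}_K V$; compare dimensions over $F$. Thus
a representation meeting the reverse inequality is automatically of the exact size. -/
theorem finrank_le_of_algHom_end [Algebra.IsCentral F A] [IsSimpleRing A] [FiniteDimensional F A]
    [FiniteDimensional F K]
    {V : Type*} [AddCommGroup V] [Module F V] [Module K V] [IsScalarTower F K V]
    [FiniteDimensional K V] [Nontrivial V] (ρ : A →ₐ[F] Module.End K V) :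
    Module.finrank F A ≤ Module.finrank K V ^ 2 := by
  have hs : IsSimpleRing (A ⊗[F] K) := isSimpleRing_tensorProduct
  have hi : Function.Injective (tensorToEnd ρ) := (tensorToEnd ρ).toRingHom.injective
  have : FiniteDimensional F (Module.End K V) := FiniteDimensional.trans F K _
  have h := LinearMap.finrank_le_finrank_of_injective (f := (tensorToEnd ρ).toLinearMap) hi
  rw [Module.finrank_tensorProduct, ← Module.finrank_mul_finrank F K (Module.End K V), mul_comm,
    Module.finrank_linearMap] at h
  rw [sq]
  exact Nat.le_of_mul_le_mul_left h Module.finrank_pos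

/-- A central simple algebra acting on a space of small dimension is split. -/
theorem isSplitOver_of_algHom_end [Algebra.IsCentral F A] [IsSimpleRing A] [FiniteDimensional F A]
    [FiniteDimensional F K]
    {V : Type*} [AddCommGroup V] [Module F V] [Module K V] [IsScalarTower F K V]
    [FiniteDimensional K V] [Nontrivial V] (ρ : A →ₐ[F] Module.End K V)
    (h : Module.finrank K V ^ 2 ≤ Module.finrank F A) : IsSplitOver F K A :=
  ⟨Module.finrank K V, Module.finrank_pos.ne', h.antisymm (finrank_le_of_algHom_end ρ),
    ⟨((LinearMap.toMatrixAlgEquiv (Module.finBasis K V)).toAlgHom.restrictScalars F).comp ρ⟩⟩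

theorem IsSplitOver.nonempty_algEquiv [Algebra.IsCentral F A] [IsSimpleRing A]
    [FiniteDimensional F A] (h : IsSplitOver F F A) :
    ∃ n : ℕ, n ≠ 0 ∧ Nonempty (A ≃ₐ[F] Matrix (Fin n) (Fin n) F) := by
  obtain ⟨n, hn, hd, ⟨ρ⟩⟩ := h
  have : Nonempty (Fin n) := ⟨⟨0, Nat.pos_of_ne_zero hn⟩⟩
  have hi : Function.Injective ρ := ρ.toRingHom.injective
  have hb : Function.Bijective ρ := by
    refine ⟨hi, (LinearMap.injective_iff_surjective_of_finrank_eq_finrank (f := ρ.toLinearMap) ?_).1 hi⟩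
    rw [← hd, Module.finrank_matrix]
    simp [sq]
  exact ⟨n, hn, ⟨AlgEquiv.ofBijective ρ hb⟩⟩

/-- The restriction of an action to a stable subspace. -/
def restrictAlgHom {V : Type*} [AddCommGroup V] [Module F V] [Module K V] [IsScalarTower F K V]
    (ρ : A →ₐ[F] Module.End K V) (W : Submodule K V) (h : ∀ a, ∀ v ∈ W, ρ a v ∈ W) :
    A →ₐ[F] Module.End K W where
  toFun a := (ρ a).restrict (h a)
  map_one' := by ext v; simp [LinearMap.restrict_apply]
  map_mul' a b := by ext v; simp [LinearMap.restrict_apply]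
  map_zero' := by ext v; simp [LinearMap.restrict_apply]
  map_add' a b := by ext v; simp [LinearMap.restrict_apply]
  commutes' c := by ext v; simp [LinearMap.restrict_apply]

/-- If a matrix algebra over `A` is split, so is `A`. -/
theorem isSplitOver_of_matrix [Algebra.IsCentral F A] [IsSimpleRing A] [FiniteDimensional F A]
    {k l : ℕ} (hk : k ≠ 0) (hl : l ≠ 0)
    (e : Matrix (Fin k) (Fin k) A ≃ₐ[F] Matrix (Fin l) (Fin l) F) : IsSplitOver F F A := by
  let V := Fin l → F
  let ψ : Matrix (Fin k) (Fin k) A →ₐ[F] Module.End F V :=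
    (Matrix.toLinAlgEquiv'.toAlgHom).comp e.toAlgHom
  have hdim : k ^ 2 * Module.finrank F A = l ^ 2 := by
    have := e.toLinearEquiv.finrank_eq
    rw [Module.finrank_matrix, Module.finrank_matrix] at this
    simpa [sq, mul_assoc] using this
  -- The diagonal idempotents commute with the scalar matrices from $A$, so they cut $F^l$ into $k$
  -- nonzero $A$-stable pieces; the smallest has dimension at most $l/k$, which is small enough for
  -- the criterion.
  let E : Fin k → Module.End F V := fun i => ψ (Matrix.single i i 1)
  have hE : ∀ i j, i ≠ j → E i * E j = 0 := fun i j hij => by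
    simp [E, ← map_mul, hij]
  have hEE : ∀ i, E i * E i = E i := fun i => by
    simp [E, ← map_mul]
  have hsum : ∑ i, E i = 1 := by
    simp only [E, ← map_sum]
    rw [show (∑ i : Fin k, Matrix.single i i (1 : A)) = 1 by
      ext s t
      simp only [Matrix.sum_apply, Matrix.single_apply, Matrix.one_apply, ite_and]
      rw [Finset.sum_ite_eq']
      simp, map_one]
  let W : Fin k → Submodule F V := fun i => LinearMap.range (E i)
  have hne : ∀ i, W i ≠ ⊥ := by
    intro i hi
    have h0 : E i = 0 := LinearMap.range_eq_bot.1 hi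
    have : Nonempty (Fin l) := ⟨⟨0, Nat.pos_of_ne_zero hl⟩⟩
    have : Nonempty (Fin k) := ⟨i⟩
    have hi : Function.Injective ψ := ψ.toRingHom.injective
    have h1 : Matrix.single i i (1 : A) = 0 := hi (by rw [map_zero]; exact h0)
    have := congrFun (congrFun h1 i) i
    simp at this
  have hsumle : ∑ i, Module.finrank F (W i) ≤ l := by
    have hinj : Function.Injective
        (LinearMap.lsum F (fun i => W i) F (fun i => (W i).subtype)) := by
      rw [← LinearMap.ker_eq_bot, LinearMap.ker_eq_bot']
      intro w hw
      ext1 i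
      have h1 : E i (∑ j, (w j : V)) = w i := by
        rw [map_sum, Finset.sum_eq_single i]
        · obtain ⟨v, hv⟩ := (w i).2
          rw [← hv, ← Module.End.mul_apply, hEE]
        · intro j _ hj
          obtain ⟨v, hv⟩ := (w j).2
          rw [← hv, ← Module.End.mul_apply, hE i j (Ne.symm hj), LinearMap.zero_apply]
        · simp
      have h2 : ∑ j, (w j : V) = 0 := by simpa [LinearMap.lsum_apply] using hw
      rw [h2, map_zero] at h1
      exact Subtype.ext h1.symm
    have := LinearMap.finrank_le_finrank_of_injective hinj
    rw [Module.finrank_pi_fintype] at this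
    simpa [V] using this
  obtain ⟨i, hi⟩ : ∃ i, k * Module.finrank F (W i) ≤ l := by
    by_contra! hcon
    have h1 : k * l < k * l := calc
      k * l = ∑ i : Fin k, l := by simp
      _ < ∑ i : Fin k, k * Module.finrank F (W i) :=
        Finset.sum_lt_sum_of_nonempty ⟨⟨0, Nat.pos_of_ne_zero hk⟩, Finset.mem_univ _⟩
          fun i _ => hcon i
      _ = k * ∑ i, Module.finrank F (W i) := by rw [Finset.mul_sum]
      _ ≤ k * l := Nat.mul_le_mul_left _ hsumle
    exact lt_irrefl _ h1
  have : Nontrivial (W i) := Submodule.nontrivial_iff_ne_bot.2 (hne i)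
  let χ : A →ₐ[F] Module.End F V := ψ.comp (Matrix.scalarAlgHom (Fin k) F)
  have hcomm : ∀ a : A, χ a * E i = E i * χ a := by
    intro a
    simp only [χ, E, AlgHom.comp_apply, ← map_mul]
    congr 1
    ext s t
    simp [Matrix.single_apply]
  have hmem : ∀ (a : A), ∀ v ∈ W i, χ a v ∈ W i := by
    rintro a _ ⟨v, rfl⟩
    exact ⟨χ a v, by
      rw [← Module.End.mul_apply, ← hcomm, Module.End.mul_apply]⟩
  refine isSplitOver_of_algHom_end (restrictAlgHom χ (W i) hmem) ?_
  refine Nat.le_of_mul_le_mul_left (c := k ^ 2) ?_ (by positivity)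
  rw [hdim, ← mul_pow]
  exact Nat.pow_le_pow_left hi 2

end Splitting

/-! ### Brauer classes: triviality, inverses, index -/

namespace CSA

variable {F : Type u} [Field F]

theorem brauerClass_tensor (A B : CSA.{u, u} F) :
    (A.tensor B).brauerClass = A.brauerClass * B.brauerClass := rfl

theorem brauerClass_base : (base F).brauerClass = 1 := rfl

theorem finrank_tensor (A B : CSA.{u, u} F) :
    Module.finrank F (A.tensor B) = Module.finrank F A * Module.finrank F B :=
  Module.finrank_tensorProduct

theorem brauerClass_eq_of_algEquiv_matrix {A B : CSA.{u, u} F} {n : ℕ} (hn : n ≠ 0)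
    (e : A ≃ₐ[F] Matrix (Fin n) (Fin n) B) : A.brauerClass = B.brauerClass :=
  Quotient.sound ⟨1, 1 * n, one_ne_zero, mul_ne_zero one_ne_zero hn,
    ⟨(e.mapMatrix.trans (Matrix.compAlgEquiv _ _ _ _)).trans
      (Matrix.reindexAlgEquiv F B finProdFinEquiv)⟩⟩

/-- This turns Brauer group identities into existence of small modules. The forward direction
cancels the matrix size through `isSplitOver_of_matrix`. -/
theorem brauerClass_eq_one_iff {A : CSA.{u, u} F} : A.brauerClass = 1 ↔ IsSplitOver F F A := by
  constructor
  · intro h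
    obtain ⟨k, l, hk, hl, ⟨e⟩⟩ : IsBrauerEquivalent A (base F) := Quotient.exact h
    exact isSplitOver_of_matrix hk hl e
  · intro h
    obtain ⟨n, hn, ⟨e⟩⟩ := h.nonempty_algEquiv
    exact brauerClass_eq_of_algEquiv_matrix (B := base F) hn e

/-- The opposite algebra. -/
def op (A : CSA.{u, u} F) : CSA.{u, u} F :=
  { AlgCat.of F Aᵐᵒᵖ with
    isCentral := inferInstanceAs (Algebra.IsCentral F Aᵐᵒᵖ)
    isSimple := inferInstanceAs (IsSimpleRing Aᵐᵒᵖ)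
    fin_dim := inferInstanceAs (FiniteDimensional F Aᵐᵒᵖ) }

theorem finrank_op (A : CSA.{u, u} F) : Module.finrank F A.op = Module.finrank F A :=
  (MulOpposite.opLinearEquiv F : A ≃ₗ[F] Aᵐᵒᵖ).finrank_eq.symm

/-- $A\otimes A^{\mathrm{op}}$ acts on $A$ by left and right multiplication, and the dimension bound
is an equality. -/
theorem brauerClass_mul_op (A : CSA.{u, u} F) : A.brauerClass * A.op.brauerClass = 1 := by
  rw [← brauerClass_tensor, brauerClass_eq_one_iff]
  refine isSplitOver_of_algHom_end (A := A.tensor A.op) (V := A) (AlgHom.mulLeftRight F A) ?_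
  rw [finrank_tensor, finrank_op, sq]

theorem isUnit_brauerClass (x : BrauerGroup.{u, u} F) : IsUnit x := by
  induction x using Quotient.inductionOn with
  | h A => exact IsUnit.of_mul_eq_one _ (brauerClass_mul_op A)

theorem exists_brauerClass (x : BrauerGroup.{u, u} F) : ∃ A : CSA.{u, u} F, A.brauerClass = x :=
  Quotient.exists_rep x

/-- The dimension of a space over a division algebra divides its dimension over the centre. -/
theorem finrank_dvd_of_division (D : CSA.{u, u} F) (hD : ∀ x : D, x ≠ 0 → IsUnit x)
    {V : Type*} [AddCommGroup V] [Module F V] [FiniteDimensional F V]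
    (ρ : D →ₐ[F] Module.End F V) : Module.finrank F D ∣ Module.finrank F V := by
  classical
  let _ : DivisionRing D := DivisionRing.ofIsUnitOrEqZero fun x => by
    by_cases hx : x = 0
    · exact Or.inr hx
    · exact Or.inl (hD x hx)
  let _ : Module D V := Module.compHom V (ρ : D →+* Module.End F V)
  have : IsScalarTower F D V := ⟨fun c d v => by
    change ρ (c • d) v = c • ρ d v
    simp⟩
  have := Module.Finite.of_restrictScalars_finite F D V
  exact ⟨_, (Module.finrank_mul_finrank F D V).symm⟩

/-- $D\otimes E^{\mathrm{op}}$ is split of degree $n$ with $n^2=\dim D\cdot\dim E$. Then $D$ acts on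
$F^n$, so $\dim D\mid n$, and cancelling one factor $\dim D$ in $n^2$ gives the claim. -/
theorem finrank_dvd_finrank_of_brauerClass_eq {D E : CSA.{u, u} F}
    (hD : ∀ x : D, x ≠ 0 → IsUnit x) (h : D.brauerClass = E.brauerClass) :
    Module.finrank F D ∣ Module.finrank F E := by
  have h1 : (D.tensor E.op).brauerClass = 1 := by
    rw [brauerClass_tensor, h, brauerClass_mul_op]
  obtain ⟨n, hn, hd, ⟨ρ⟩⟩ := brauerClass_eq_one_iff.1 h1
  rw [finrank_tensor, finrank_op] at hd
  have h2 := finrank_dvd_of_division D hD (V := Fin n → F)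
    ((Matrix.toLinAlgEquiv'.toAlgHom.comp ρ).comp
      (Algebra.TensorProduct.includeLeft : D →ₐ[F] D ⊗[F] (E.op)))
  rw [Module.finrank_fin_fun] at h2
  obtain ⟨k, rfl⟩ := h2
  have hpos : 0 < Module.finrank F D := Module.finrank_pos
  refine ⟨k ^ 2, ?_⟩
  have : Module.finrank F D * (Module.finrank F D * k ^ 2) = Module.finrank F D * Module.finrank F E := by
    rw [← hd]; ring
  exact (Nat.eq_of_mul_eq_mul_left hpos this).symm

theorem brauerClass_underlyingDivision (A : CSA.{u, u} F) :
    A.underlyingDivision.brauerClass = A.brauerClass := by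
  obtain ⟨n, hn, ⟨e⟩⟩ := A.exists_division.choose_spec.2
  exact (brauerClass_eq_of_algEquiv_matrix hn e).symm

/-- The index divides the degree of every algebra in the same Brauer class. -/
theorem index_dvd_of_brauerClass_eq {A B : CSA.{u, u} F} (h : A.brauerClass = B.brauerClass)
    {d : ℕ} (hd : Module.finrank F B = d ^ 2) : A.index ∣ d := by
  obtain ⟨D, hD, n, hn, ⟨e⟩⟩ := B.exists_division
  have hdim : d ^ 2 = n ^ 2 * Module.finrank F D := by
    rw [← hd, e.toLinearEquiv.finrank_eq, Module.finrank_matrix]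
    simp [sq]
  have hDB : B.brauerClass = D.brauerClass :=
    brauerClass_eq_of_algEquiv_matrix hn e
  have hcl : A.underlyingDivision.brauerClass = D.brauerClass := by
    rw [brauerClass_underlyingDivision, h, hDB]
  have hfin : Module.finrank F A.underlyingDivision = Module.finrank F D :=
    Nat.dvd_antisymm
      (finrank_dvd_finrank_of_brauerClass_eq A.exists_division.choose_spec.1 hcl)
      (finrank_dvd_finrank_of_brauerClass_eq hD hcl.symm)
  have hnd : n ∣ d := (Nat.pow_dvd_pow_iff two_ne_zero).1 ⟨_, hdim⟩
  obtain ⟨s, rfl⟩ := hnd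
  have hs : Module.finrank F D = s ^ 2 := by
    rw [mul_pow] at hdim
    exact (Nat.eq_of_mul_eq_mul_left (by positivity) hdim).symm
  rw [index, degree, hfin, hs, Nat.sqrt_eq']
  exact dvd_mul_left _ _

end CSA

/-! ### Cyclic extensions and the relations of a cyclic algebra -/

section CyclicPair

variable {F L : Type u} [Field F] [Field L] [Algebra F L]

/-- `L/F` is a finite Galois extension with cyclic Galois group generated by `σ`. -/
structure IsCyclicGenerator (σ : L ≃ₐ[F] L) : Prop where
  isGalois : IsGalois F L
  finiteDimensional : FiniteDimensional F L
  mem_zpowers : ∀ τ : L ≃ₐ[F] L, τ ∈ Subgroup.zpowers σ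

namespace IsCyclicGenerator

variable {σ : L ≃ₐ[F] L} (hσ : IsCyclicGenerator σ)
include hσ

theorem orderOf_eq : orderOf σ = Module.finrank F L := by
  have := hσ.isGalois
  have := hσ.finiteDimensional
  rw [← IsGalois.card_aut_eq_finrank F L]
  exact orderOf_eq_card_of_forall_mem_zpowers hσ.mem_zpowers

theorem mem_range_of_fixed {l : L} (h : σ l = l) : ∃ c : F, algebraMap F L c = l := by
  have := hσ.isGalois
  have := hσ.finiteDimensional
  have h1 : l ∈ (⊥ : IntermediateField F L) := by
    rw [IsGalois.mem_bot_iff_fixed]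
    intro τ
    have h2 : Subgroup.zpowers σ ≤ MulAction.stabilizer (L ≃ₐ[F] L) l := by
      rw [Subgroup.zpowers_le]
      exact h
    exact h2 (hσ.mem_zpowers τ)
  exact IntermediateField.mem_bot.1 h1

theorem finrank_pos : 0 < Module.finrank F L := by
  have := hσ.finiteDimensional
  exact Module.finrank_pos

theorem pow_finrank : σ ^ Module.finrank F L = 1 := by
  rw [← hσ.orderOf_eq, pow_orderOf_eq_one]

theorem pow_injective :
    Function.Injective fun k : Fin (Module.finrank F L) => σ ^ (k : ℕ) := by
  intro k k' h
  exact Fin.ext (pow_injOn_Iio_orderOf (by simp [hσ.orderOf_eq]) (by simp [hσ.orderOf_eq]) h)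

/-- By Dedekind's independence of characters, the powers of `σ` can be separated. -/
theorem exists_separating (k₀ : Fin (Module.finrank F L)) :
    ∃ c : L →₀ L, ∀ k : Fin (Module.finrank F L),
      (c.sum fun t r => r * (σ ^ (k : ℕ)) t) = if k = k₀ then 1 else 0 := by
  classical
  let w : L → Fin (Module.finrank F L) → L := fun t k => (σ ^ (k : ℕ)) t
  -- A linear form vanishing on all rows $(\sigma^k t)_k$ would be a linear relation between the
  -- distinct characters $\sigma^k$.
  have htop : Submodule.span L (Set.range w) = ⊤ := by
    by_contra hne
    obtain ⟨f, hf, hle⟩ := Submodule.exists_le_ker_of_lt_top _ (lt_top_iff_ne_top.2 hne)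
    have hli : LinearIndependent L
        fun k : Fin (Module.finrank F L) => ((σ ^ (k : ℕ) : L ≃ₐ[F] L) : L → L) := by
      have h1 := (linearIndependent_monoidHom L L).comp
        (fun k : Fin (Module.finrank F L) => ((σ ^ (k : ℕ) : L ≃ₐ[F] L) : L →* L))
        (fun k k' h => hσ.pow_injective (AlgEquiv.ext fun t => DFunLike.congr_fun h t))
      exact h1
    have hz := Fintype.linearIndependent_iff.1 hli (fun k => f (Pi.single k 1)) (by
      ext t
      have h2 : f (w t) = 0 := hle (Submodule.subset_span ⟨t, rfl⟩)
      rw [← Finset.univ_sum_single (w t), map_sum] at h2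
      simp only [Finset.sum_apply, Pi.smul_apply, smul_eq_mul, Pi.zero_apply]
      rw [← h2]
      refine Finset.sum_congr rfl fun k _ => ?_
      rw [show (Pi.single k (w t k) : Fin (Module.finrank F L) → L) = w t k • Pi.single k 1 by
        rw [← Pi.single_smul, smul_eq_mul, mul_one], map_smul, smul_eq_mul, mul_comm])
    apply hf
    refine LinearMap.pi_ext' fun k => LinearMap.ext_ring ?_
    simpa using hz k
  have hmem : (Pi.single k₀ 1 : Fin (Module.finrank F L) → L) ∈ Submodule.span L (Set.range w) := by
    rw [htop]; trivial
  obtain ⟨c, hc⟩ := Finsupp.mem_span_range_iff_exists_finsupp.1 hmem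
  refine ⟨c, fun k => ?_⟩
  have := congrFun hc k
  rw [Finsupp.sum, Finset.sum_apply] at this
  rw [Finsupp.sum]
  simpa [Pi.single_apply, w] using this

end IsCyclicGenerator

/-- The defining relations of the cyclic algebra `(L/F, σ, a)`. -/
structure IsCyclicPair (σ : L ≃ₐ[F] L) (a : F) {R : Type*} [Ring R] [Algebra F R] (j : L →ₐ[F] R)
    (y : R) : Prop where
  pow_eq : y ^ Module.finrank F L = algebraMap F R a
  mul_eq : ∀ l, y * j l = j (σ l) * y

namespace IsCyclicPair

variable {σ : L ≃ₐ[F] L} {a : F} {R : Type*} [Ring R] [Algebra F R] {j : L →ₐ[F] R} {y : R}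
  (h : IsCyclicPair σ a j y)

include h

theorem pow_mul_eq (k : ℕ) (l : L) : y ^ k * j l = j ((σ ^ k) l) * y ^ k := by
  induction k with
  | zero => simp
  | succ k ih =>
    rw [pow_succ', mul_assoc, ih, ← mul_assoc, h.mul_eq, mul_assoc, pow_succ', AlgEquiv.mul_apply]

theorem isUnit_of_ne_zero (hσ : IsCyclicGenerator σ) (ha : a ≠ 0) : IsUnit y := by
  have h1 : IsUnit (y ^ Module.finrank F L) := by
    rw [h.pow_eq]
    exact (IsUnit.mk0 a ha).map (algebraMap F R)
  exact (isUnit_pow_iff hσ.finrank_pos.ne').1 h1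

omit h in
/-- The combinations `∑ j (l k) * y ^ k`. -/
noncomputable def comb (j : L →ₐ[F] R) (y : R) : (Fin (Module.finrank F L) → L) →ₗ[F] R :=
  ∑ k : Fin (Module.finrank F L), (LinearMap.mulRight F (y ^ (k : ℕ))) ∘ₗ j.toLinearMap ∘ₗ LinearMap.proj k

omit h in
theorem comb_apply (l : Fin (Module.finrank F L) → L) : comb j y l = ∑ k, j (l k) * y ^ (k : ℕ) := by
  simp [comb]

theorem sum_mul_comb_mul (c : L →₀ L) (l : Fin (Module.finrank F L) → L) :
    (c.sum fun t r => j r * comb j y l * j t) =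
      comb j y fun k => l k * c.sum fun t r => r * (σ ^ (k : ℕ)) t := by
  simp only [comb_apply, Finsupp.sum, Finset.mul_sum, Finset.sum_mul, map_sum]
  rw [Finset.sum_comm]
  refine Finset.sum_congr rfl fun k _ => Finset.sum_congr rfl fun t _ => ?_
  rw [mul_assoc, mul_assoc, h.pow_mul_eq, ← mul_assoc, ← mul_assoc, ← map_mul, ← map_mul]
  congr 2
  ring

/-- Multiplication by elements of $L$ from both sides sees the term at $y^k$ through $\sigma^k$, so
the separating combination isolates a single term. Independence, simplicity and centrality all rest
on such operations. -/
theorem exists_sum_mul_comb_mul (hσ : IsCyclicGenerator σ) (k₀ : Fin (Module.finrank F L)) :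
    ∃ c : L →₀ L, ∀ l : Fin (Module.finrank F L) → L,
      (c.sum fun t r => j r * comb j y l * j t) = j (l k₀) * y ^ (k₀ : ℕ) := by
  obtain ⟨c, hc⟩ := hσ.exists_separating k₀
  refine ⟨c, fun l => ?_⟩
  rw [h.sum_mul_comb_mul, comb_apply, Finset.sum_eq_single k₀]
  · rw [hc, if_pos rfl, mul_one]
  · intro k _ hk
    rw [hc, if_neg hk, mul_zero, map_zero, zero_mul]
  · simp

/-- Each coefficient can be isolated, and $y$ is a unit. Only the relations and $R\ne0$ matter, so
any realization of them generates an algebra of dimension $n^2$. -/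
theorem comb_injective [Nontrivial R] (hσ : IsCyclicGenerator σ) (ha : a ≠ 0) :
    Function.Injective (comb j y) := by
  rw [← LinearMap.ker_eq_bot, LinearMap.ker_eq_bot']
  intro l hl
  ext k
  obtain ⟨c, hc⟩ := h.exists_sum_mul_comb_mul hσ k
  have h1 := hc l
  rw [hl] at h1
  simp only [mul_zero, zero_mul, Finsupp.sum_fun_zero] at h1
  have h2 : j (l k) = 0 := ((h.isUnit_of_ne_zero hσ ha).pow k).mul_left_eq_zero.1 h1.symm
  exact (map_eq_zero_iff j j.toRingHom.injective).1 h2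

theorem mul_pow_mem_range_comb (hσ : IsCyclicGenerator σ) (l : L) (k : ℕ) :
    j l * y ^ k ∈ LinearMap.range (comb j y) := by
  -- High powers of $y$ are reduced by $y^n=a$: the quotient of $k$ by $n$ becomes a power of $a$.
  refine ⟨Pi.single ⟨k % Module.finrank F L, Nat.mod_lt _ hσ.finrank_pos⟩
    (a ^ (k / Module.finrank F L) • l), ?_⟩
  rw [comb_apply, Finset.sum_eq_single ⟨k % Module.finrank F L, Nat.mod_lt _ hσ.finrank_pos⟩]
  · rw [Pi.single_eq_same]
    conv_rhs => rw [← Nat.div_add_mod k (Module.finrank F L), pow_add, pow_mul, h.pow_eq, ← map_pow,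
      ← Algebra.smul_def, mul_smul_comm]
    rw [map_smul, smul_mul_assoc]
  · intro k' _ hk'
    rw [Pi.single_eq_of_ne hk', map_zero, zero_mul]
  · simp

/-- The subalgebra generated by a cyclic pair. -/
noncomputable def subalgebra (hσ : IsCyclicGenerator σ) : Subalgebra F R :=
  (LinearMap.range (comb j y)).toSubalgebra
    (by simpa using h.mul_pow_mem_range_comb hσ 1 0)
    (by
      rintro _ _ ⟨l, rfl⟩ ⟨l', rfl⟩
      rw [comb_apply, comb_apply, Finset.sum_mul_sum]
      refine sum_mem fun k _ => sum_mem fun k' _ => ?_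
      rw [mul_assoc, ← mul_assoc (y ^ (k : ℕ)), h.pow_mul_eq, mul_assoc, ← pow_add, ← mul_assoc,
        ← map_mul]
      exact h.mul_pow_mem_range_comb hσ _ _)

theorem mem_subalgebra_iff (hσ : IsCyclicGenerator σ) {r : R} :
    r ∈ h.subalgebra hσ ↔ ∃ l, comb j y l = r := Iff.rfl

theorem map_mem_subalgebra (hσ : IsCyclicGenerator σ) (l : L) : j l ∈ h.subalgebra hσ := by
  have := h.mul_pow_mem_range_comb hσ l 0
  rwa [pow_zero, mul_one] at this

theorem mem_subalgebra (hσ : IsCyclicGenerator σ) : y ∈ h.subalgebra hσ := by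
  have := h.mul_pow_mem_range_comb hσ 1 1
  rwa [map_one, one_mul, pow_one] at this

theorem finrank_subalgebra [Nontrivial R] (hσ : IsCyclicGenerator σ) (ha : a ≠ 0) :
    Module.finrank F (h.subalgebra hσ) = Module.finrank F L ^ 2 := by
  have := hσ.finiteDimensional
  have h1 := LinearMap.finrank_range_of_inj (h.comb_injective hσ ha)
  rw [Module.finrank_pi_fintype] at h1
  rw [Finset.sum_const, Finset.card_univ, Fintype.card_fin, smul_eq_mul, ← sq] at h1
  exact h1

theorem finiteDimensional_subalgebra (hσ : IsCyclicGenerator σ) :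
    FiniteDimensional F (h.subalgebra hσ) := by
  have := hσ.finiteDimensional
  exact inferInstanceAs (FiniteDimensional F (LinearMap.range (comb j y)))

/-- Isolating one term of a nonzero element puts some $j(l)y^k$ with $l\ne0$ into the ideal, and
this is a unit. -/
theorem isSimpleRing_subalgebra [Nontrivial R] (hσ : IsCyclicGenerator σ) (ha : a ≠ 0) :
    IsSimpleRing (h.subalgebra hσ) := by
  refine IsSimpleRing.of_eq_bot_or_eq_top fun I => ?_
  by_cases hI : I = ⊥
  · exact Or.inl hI
  right
  obtain ⟨x, hxI, hx⟩ : ∃ x ∈ I, x ≠ 0 := by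
    by_contra! hcon
    exact hI (le_antisymm (fun x hx => by rw [hcon x hx]; exact zero_mem _) bot_le)
  obtain ⟨l, hl⟩ := (h.mem_subalgebra_iff hσ).1 x.2
  obtain ⟨k, hk⟩ : ∃ k, l k ≠ 0 := by
    by_contra! hcon
    apply hx
    ext
    rw [← hl, show l = 0 from funext hcon]
    simp
  obtain ⟨c, hc⟩ := h.exists_sum_mul_comb_mul hσ k
  let jj : L → h.subalgebra hσ := fun l => ⟨j l, h.map_mem_subalgebra hσ l⟩
  let yy : h.subalgebra hσ := ⟨y, h.mem_subalgebra hσ⟩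
  have hmem : jj (l k) * yy ^ (k : ℕ) ∈ I := by
    have : jj (l k) * yy ^ (k : ℕ) = c.sum fun t r => jj r * x * jj t := by
      ext
      simp only [Finsupp.sum, AddSubmonoidClass.coe_finsetSum, MulMemClass.coe_mul, jj, ← hl]
      exact (hc l).symm
    rw [this, Finsupp.sum]
    exact sum_mem fun t _ => I.mul_mem_right _ _ (I.mul_mem_left _ _ hxI)
  have hjj : jj (l k)⁻¹ * jj (l k) = 1 := by
    ext
    simp [jj, ← map_mul, inv_mul_cancel₀ hk]
  have hy : yy ^ (k : ℕ) * (yy ^ (Module.finrank F L - k)) = algebraMap F _ a := by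
    rw [← pow_add, Nat.add_sub_cancel' k.2.le]
    ext
    simpa [yy] using h.pow_eq
  have h1 : (1 : h.subalgebra hσ) ∈ I := by
    have h2 := I.mul_mem_right _ (yy ^ (Module.finrank F L - k) * algebraMap F _ a⁻¹)
      (I.mul_mem_left (jj (l k)⁻¹) _ hmem)
    have h3 : jj (l k)⁻¹ * (jj (l k) * yy ^ (k : ℕ)) *
        (yy ^ (Module.finrank F L - k) * algebraMap F _ a⁻¹) = 1 := by
      rw [← mul_assoc (jj _), hjj, one_mul, ← mul_assoc, hy, ← map_mul, mul_inv_cancel₀ ha, map_one]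
    rwa [h3] at h2
  exact I.one_mem_iff.1 h1

/-- Commuting with $L$ kills the coefficients of $y^k$ for $0<k<n$, as $\sigma^k\neq1$; commuting
with $y$ makes the remaining coefficient $\sigma$-invariant, hence in $F$. -/
theorem isCentral_subalgebra [Nontrivial R] (hσ : IsCyclicGenerator σ) (ha : a ≠ 0) :
    Algebra.IsCentral F (h.subalgebra hσ) where
  out := by
    intro z hz
    rw [Subalgebra.mem_center_iff] at hz
    obtain ⟨l, hl⟩ := (h.mem_subalgebra_iff hσ).1 z.2
    have hjinj : Function.Injective j := j.toRingHom.injective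
    have hzero : ∀ k : Fin (Module.finrank F L), (k : ℕ) ≠ 0 → l k = 0 := by
      intro k hk
      by_contra hlk
      apply hk
      have hfix : ∀ t, (σ ^ (k : ℕ)) t = t := by
        intro t
        have h1 := congrArg Subtype.val (hz ⟨j t, h.map_mem_subalgebra hσ t⟩)
        simp only [MulMemClass.coe_mul, ← hl] at h1
        have h2 : comb j y (fun k => l k * ((σ ^ (k : ℕ)) t - t)) = 0 := by
          simp only [mul_sub, comb_apply, map_sub, sub_mul, Finset.sum_sub_distrib, map_mul]
          rw [sub_eq_zero]
          rw [comb_apply, Finset.mul_sum, Finset.sum_mul] at h1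
          calc _ = ∑ k, j (l k) * y ^ (k : ℕ) * j t :=
                Finset.sum_congr rfl fun k _ => by rw [mul_assoc, mul_assoc, h.pow_mul_eq]
            _ = _ := h1.symm
            _ = _ := Finset.sum_congr rfl fun k _ => by
                rw [← mul_assoc, ← map_mul, ← map_mul, mul_comm]
        have h3 := congrFun (h.comb_injective hσ ha (h2.trans (map_zero _).symm)) k
        exact sub_eq_zero.1 ((mul_eq_zero.1 h3).resolve_left hlk)
      have h4 : σ ^ (k : ℕ) = 1 := AlgEquiv.ext hfix
      have h5 := orderOf_dvd_of_pow_eq_one h4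
      rw [hσ.orderOf_eq] at h5
      exact Nat.eq_zero_of_dvd_of_lt h5 k.2
    have hz0 : (z : R) = j (l ⟨0, hσ.finrank_pos⟩) := by
      rw [← hl, comb_apply, Finset.sum_eq_single ⟨0, hσ.finrank_pos⟩]
      · simp
      · intro k _ hk
        rw [hzero k (fun h0 => hk (Fin.ext h0)), map_zero, zero_mul]
      · simp
    have hfix : σ (l ⟨0, hσ.finrank_pos⟩) = l ⟨0, hσ.finrank_pos⟩ := by
      have h1 := congrArg Subtype.val (hz ⟨y, h.mem_subalgebra hσ⟩)
      simp only [MulMemClass.coe_mul, hz0] at h1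
      rw [h.mul_eq] at h1
      exact hjinj ((h.isUnit_of_ne_zero hσ ha).mul_right_cancel h1)
    obtain ⟨c, hc⟩ := hσ.mem_range_of_fixed hfix
    refine Algebra.mem_bot.2 ⟨c, ?_⟩
    ext
    rw [hz0, ← hc, AlgHom.commutes]
    rfl

end IsCyclicPair

end CyclicPair

/-! ### Construction and universal property of cyclic algebras -/

section CyclicAlgebra

variable {F L : Type u} [Field F] [Field L] [Algebra F L]

/-- The commutative algebra `F[x] / (x ^ n - a)`. -/
abbrev RadicalAlgebra (n : ℕ) (a : F) : Type u :=
  AdjoinRoot (Polynomial.X ^ n - Polynomial.C a)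

/-- The algebra in which the cyclic algebra `(L/F, σ, a)` is realized. -/
abbrev CyclicAmbient (L : Type u) [Field L] [Algebra F L] (a : F) : Type u :=
  RadicalAlgebra (Module.finrank F L) a ⊗[F] Module.End F L

theorem nontrivial_cyclicAmbient [FiniteDimensional F L] (a : F) :
    Nontrivial (CyclicAmbient L a) := by
  have : Nontrivial (RadicalAlgebra (Module.finrank F L) a) := by
    apply AdjoinRoot.nontrivial
    rw [Polynomial.degree_X_pow_sub_C Module.finrank_pos]
    exact_mod_cast Module.finrank_pos.ne'
  exact (Algebra.TensorProduct.includeRight_injective (R := F)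
    (A := RadicalAlgebra (Module.finrank F L) a) (B := Module.End F L)
    (FaithfulSMul.algebraMap_injective _ _)).nontrivial

/-- The operator $\sigma$ on $L$ already has the right commutation rule but $\sigma^n=1$; tensoring
it with an $n$-th root of $a$ corrects the power. This realizes the relations without defining a
multiplication by hand. -/
theorem isCyclicPair_ambient {σ : L ≃ₐ[F] L} (hσ : IsCyclicGenerator σ) (a : F) :
    IsCyclicPair σ a (R := CyclicAmbient L a)
      (Algebra.TensorProduct.includeRight.comp (Algebra.lmul F L))
      (AdjoinRoot.root _ ⊗ₜ σ.toLinearMap) where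
  pow_eq := by
    rw [Algebra.TensorProduct.tmul_pow]
    have h1 : (σ.toLinearMap : Module.End F L) ^ Module.finrank F L = 1 := by
      have : ∀ k : ℕ, (σ.toLinearMap : Module.End F L) ^ k = (σ ^ k).toLinearMap := by
        intro k
        induction k with
        | zero => rfl
        | succ k ih => rw [pow_succ, ih, pow_succ]; rfl
      rw [this, hσ.pow_finrank]
      rfl
    have h2 : (AdjoinRoot.root (Polynomial.X ^ Module.finrank F L - Polynomial.C a)) ^
        Module.finrank F L = algebraMap F _ a := by
      have := AdjoinRoot.eval₂_root (Polynomial.X ^ Module.finrank F L - Polynomial.C a)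
      rw [Polynomial.eval₂_sub, Polynomial.eval₂_pow, Polynomial.eval₂_X, Polynomial.eval₂_C,
        sub_eq_zero] at this
      exact this
    rw [h1, h2]
    rfl
  mul_eq l := by
    simp only [AlgHom.comp_apply, Algebra.TensorProduct.includeRight_apply,
      Algebra.TensorProduct.tmul_mul_tmul, mul_one, one_mul]
    congr 1
    ext t
    simp [Module.End.mul_apply]

namespace CSA

/-- The cyclic algebra `(L/F, σ, a)`. -/
noncomputable def cyclic {σ : L ≃ₐ[F] L} (hσ : IsCyclicGenerator σ) {a : F} (ha : a ≠ 0) :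
    CSA.{u, u} F :=
  have : Nontrivial (CyclicAmbient L a) :=
    have := hσ.finiteDimensional
    nontrivial_cyclicAmbient a
  { AlgCat.of F ((isCyclicPair_ambient hσ a).subalgebra hσ) with
    isCentral := (isCyclicPair_ambient hσ a).isCentral_subalgebra hσ ha
    isSimple := (isCyclicPair_ambient hσ a).isSimpleRing_subalgebra hσ ha
    fin_dim := (isCyclicPair_ambient hσ a).finiteDimensional_subalgebra hσ }

variable {σ : L ≃ₐ[F] L} (hσ : IsCyclicGenerator σ) {a : F} (ha : a ≠ 0)

theorem finrank_cyclic : Module.finrank F (cyclic hσ ha) = Module.finrank F L ^ 2 :=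
  have : Nontrivial (CyclicAmbient L a) :=
    have := hσ.finiteDimensional
    nontrivial_cyclicAmbient a
  (isCyclicPair_ambient hσ a).finrank_subalgebra hσ ha

/-- The embedding of `L` into the cyclic algebra. -/
noncomputable def cyclicIncl : L →ₐ[F] cyclic hσ ha :=
  (Algebra.TensorProduct.includeRight.comp (Algebra.lmul F L)).codRestrict
    ((isCyclicPair_ambient hσ a).subalgebra hσ)
    ((isCyclicPair_ambient hσ a).map_mem_subalgebra hσ)

/-- The generator `y` of the cyclic algebra. -/
noncomputable def cyclicGen : cyclic hσ ha :=
  (⟨_, (isCyclicPair_ambient hσ a).mem_subalgebra hσ⟩ :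
    (isCyclicPair_ambient hσ a).subalgebra hσ)

theorem isCyclicPair_cyclic : IsCyclicPair σ a (cyclicIncl hσ ha) (cyclicGen hσ ha) where
  pow_eq := Subtype.ext (isCyclicPair_ambient hσ a).pow_eq
  mul_eq l := Subtype.ext ((isCyclicPair_ambient hσ a).mul_eq l)

theorem isCyclicAlgebra_cyclic : (cyclic hσ ha).IsCyclicAlgebra (Module.finrank F L) :=
  ⟨finrank_cyclic hσ ha, L, _, _, σ, a, cyclicIncl hσ ha, cyclicGen hσ ha, hσ.isGalois, rfl,
    hσ.mem_zpowers, ha, (isCyclicPair_cyclic hσ ha).pow_eq, (isCyclicPair_cyclic hσ ha).mul_eq⟩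

theorem exists_comb_cyclic (c : cyclic hσ ha) :
    ∃ l, IsCyclicPair.comb (cyclicIncl hσ ha) (cyclicGen hσ ha) l = c := by
  obtain ⟨l, hl⟩ := ((isCyclicPair_ambient hσ a).mem_subalgebra_iff hσ).1 c.2
  refine ⟨l, Subtype.ext ?_⟩
  refine Eq.trans ?_ hl
  rw [IsCyclicPair.comb_apply, IsCyclicPair.comb_apply]
  exact map_sum ((isCyclicPair_ambient hσ a).subalgebra hσ).val _ _

variable {hσ ha} in
/-- The universal property of the cyclic algebra. -/
theorem exists_cyclic_algHom {R : Type*} [Ring R] [Algebra F R] {j : L →ₐ[F] R} {y : R}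
    (h : IsCyclicPair σ a j y) :
    ∃ φ : cyclic hσ ha →ₐ[F] R, (∀ l, φ (cyclicIncl hσ ha l) = j l) ∧
      φ (cyclicGen hσ ha) = y := by
  -- The map is built through its graph: the paired generators generate a simple subalgebra of the
  -- product. Its first projection is injective by simplicity and surjective on the generators, and
  -- the second projection composed with the inverse is the desired map.
  let j' : L →ₐ[F] (cyclic hσ ha × R) := (cyclicIncl hσ ha).prod j
  have h' : IsCyclicPair σ a j' (cyclicGen hσ ha, y) :=
    { pow_eq := Prod.ext (isCyclicPair_cyclic hσ ha).pow_eq h.pow_eq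
      mul_eq := fun l => Prod.ext ((isCyclicPair_cyclic hσ ha).mul_eq l) (h.mul_eq l) }
  let S := h'.subalgebra hσ
  have hS : IsSimpleRing S := h'.isSimpleRing_subalgebra hσ ha
  let f : S →ₐ[F] cyclic hσ ha := (AlgHom.fst F _ R).comp S.val
  have hf : Function.Bijective f := by
    refine ⟨f.toRingHom.injective, fun c => ?_⟩
    obtain ⟨l, rfl⟩ := exists_comb_cyclic hσ ha c
    refine ⟨⟨IsCyclicPair.comb j' (cyclicGen hσ ha, y) l, ⟨l, rfl⟩⟩, ?_⟩
    change (AlgHom.fst F (cyclic hσ ha) R) (IsCyclicPair.comb j' (cyclicGen hσ ha, y) l) = _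
    rw [IsCyclicPair.comb_apply, IsCyclicPair.comb_apply, map_sum]
    rfl
  let e := AlgEquiv.ofBijective f hf
  refine ⟨((AlgHom.snd F (cyclic hσ ha) R).comp S.val).comp e.symm.toAlgHom, fun l => ?_, ?_⟩
  · have : e.symm (cyclicIncl hσ ha l) = ⟨j' l, h'.map_mem_subalgebra hσ l⟩ :=
      (AlgEquiv.symm_apply_eq e).2 rfl
    change (AlgHom.snd F (cyclic hσ ha) R) (e.symm (cyclicIncl hσ ha l) : S) = _
    rw [this]
    rfl
  · have : e.symm (cyclicGen hσ ha) = ⟨(cyclicGen hσ ha, y), h'.mem_subalgebra hσ⟩ :=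
      (AlgEquiv.symm_apply_eq e).2 rfl
    change (AlgHom.snd F (cyclic hσ ha) R) (e.symm (cyclicGen hσ ha) : S) = _
    rw [this]
    rfl

end CSA

/-! ### Semilinear representations and inverses of cyclic classes -/

/-- `A` acts on an `L`-space `V` of small dimension, together with a commuting `σ`-semilinear map
whose `n`-th power is `a`, where `n = [L : F]`. -/
def HasSemilinearRep (σ : L ≃ₐ[F] L) (a : F) (A : Type u) [Ring A] [Algebra F A] : Prop :=
  ∃ (V : Type u) (_ : AddCommGroup V) (_ : Module F V) (_ : Module L V) (_ : IsScalarTower F L V)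
    (_ : FiniteDimensional L V) (_ : Nontrivial V) (ρ : A →ₐ[F] Module.End L V)
    (x : Module.End F V),
    (∀ (l : L) v, x (l • v) = σ l • x v) ∧ (∀ b v, x (ρ b v) = ρ b (x v)) ∧
    x ^ Module.finrank F L = algebraMap F _ a ∧
    Module.finrank L V ^ 2 ≤ Module.finrank F A

/-- Forgetting linearity over the larger field. -/
def restrictScalarsEnd (F L V : Type*) [Field F] [Field L] [Algebra F L] [AddCommGroup V]
    [Module F V] [Module L V] [IsScalarTower F L V] : Module.End L V →ₐ[F] Module.End F V where
  toFun f := f.restrictScalars F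
  map_one' := rfl
  map_mul' _ _ := rfl
  map_zero' := rfl
  map_add' _ _ := rfl
  commutes' c := by ext v; simp [Module.algebraMap_end_apply]

@[simp]
theorem restrictScalarsEnd_apply {F L V : Type*} [Field F] [Field L] [Algebra F L] [AddCommGroup V]
    [Module F V] [Module L V] [IsScalarTower F L V] (f : Module.End L V) (v : V) :
    restrictScalarsEnd F L V f v = f v := rfl

namespace CSA

variable {σ : L ≃ₐ[F] L} (hσ : IsCyclicGenerator σ) {a : F} (ha : a ≠ 0) {A : CSA.{u, u} F}

/-- A cyclic algebra acts as soon as its generators do, and the action commutes with any action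
with which the generators commute. -/
theorem exists_tensor_cyclic_algHom {R : Type*} [Ring R] [Algebra F R] {j : L →ₐ[F] R} {y : R}
    (h : IsCyclicPair σ a j y) (ρ : A →ₐ[F] R) (hj : ∀ b l, Commute (ρ b) (j l))
    (hy : ∀ b, Commute (ρ b) y) : Nonempty (A.tensor (cyclic hσ ha) →ₐ[F] R) := by
  -- Applying the universal property inside the centralizer of the image of $A$ makes the two
  -- actions commute on all of both algebras, not only on generators.
  let Z := Subalgebra.centralizer F (ρ.range : Set R)
  have hZj : ∀ l, j l ∈ Z := by
    intro l
    rw [Subalgebra.mem_centralizer_iff]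
    rintro _ ⟨b, rfl⟩
    exact hj b l
  have hZy : y ∈ Z := by
    rw [Subalgebra.mem_centralizer_iff]
    rintro _ ⟨b, rfl⟩
    exact hy b
  obtain ⟨φ, -, -⟩ := exists_cyclic_algHom (hσ := hσ) (ha := ha)
    (j := j.codRestrict Z hZj) (y := (⟨y, hZy⟩ : Z))
    { pow_eq := Subtype.ext h.pow_eq
      mul_eq := fun l => Subtype.ext (h.mul_eq l) }
  exact ⟨Algebra.TensorProduct.lift ρ (Z.val.comp φ) fun b c =>
    (Subalgebra.mem_centralizer_iff F).1 (φ c).2 (ρ b) ⟨b, rfl⟩⟩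

/-- A splitting module of $A\otimes(L/F,\sigma,a)$ has $F$-dimension $n\deg A$. The subfield $L$
makes it an $L$-space of dimension $\deg A$ on which $y$ acts as the semilinear map; conversely $L$
and the semilinear map generate an action of the cyclic algebra. -/
theorem hasSemilinearRep_iff :
    HasSemilinearRep σ a A ↔ A.brauerClass * (cyclic hσ ha).brauerClass = 1 := by
  have := hσ.finiteDimensional
  rw [← brauerClass_tensor, brauerClass_eq_one_iff]
  constructor
  · rintro ⟨V, _, _, _, _, _, _, ρ, x, hx, hxρ, hxn, hdim⟩
    have : FiniteDimensional F V := FiniteDimensional.trans F L V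
    obtain ⟨φ⟩ := exists_tensor_cyclic_algHom hσ ha (A := A) (R := Module.End F V)
      (j := Algebra.lsmul F F V) (y := x)
      { pow_eq := hxn
        mul_eq := fun l => by ext v; simp [Module.End.mul_apply, hx] }
      ((restrictScalarsEnd F L V).comp ρ)
      (fun b l => by ext v; simp [Module.End.mul_apply])
      (fun b => by ext v; simp [Module.End.mul_apply, hxρ])
    refine isSplitOver_of_algHom_end (A := A.tensor (cyclic hσ ha)) φ ?_
    rw [finrank_tensor, finrank_cyclic, ← Module.finrank_mul_finrank F L V, mul_pow, mul_comm]
    exact Nat.mul_le_mul_right _ hdim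
  · rintro ⟨d, hd, hdim, ⟨φ⟩⟩
    -- The lift only places the space in universe `u`, as `HasSemilinearRep` demands.
    let V := ULift.{u} (Fin d) → F
    have : Nonempty (ULift.{u} (Fin d)) := ⟨⟨⟨0, Nat.pos_of_ne_zero hd⟩⟩⟩
    let Ψ : A ⊗[F] cyclic hσ ha →ₐ[F] Module.End F V :=
      ((LinearEquiv.funCongrLeft F F (Equiv.ulift.{u} (α := Fin d))).conjAlgEquiv F).toAlgHom.comp
        (Matrix.toLinAlgEquiv'.toAlgHom.comp φ)
    let jL : L →ₐ[F] Module.End F V :=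
      Ψ.comp (Algebra.TensorProduct.includeRight.comp (cyclicIncl hσ ha))
    let _ : Module L V := Module.compHom V (jL : L →+* Module.End F V)
    have hsm : ∀ (l : L) (v : V), l • v = jL l v := fun _ _ => rfl
    have : IsScalarTower F L V := ⟨fun c l v => by
      rw [hsm, hsm, map_smul, LinearMap.smul_apply]⟩
    have : FiniteDimensional L V := Module.Finite.of_restrictScalars_finite F L V
    let y : A ⊗[F] cyclic hσ ha := 1 ⊗ₜ cyclicGen hσ ha
    have hcomm : ∀ (b : A) (c : cyclic hσ ha),
        Ψ (b ⊗ₜ 1) * Ψ (1 ⊗ₜ c) = Ψ (1 ⊗ₜ c) * Ψ (b ⊗ₜ 1) := by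
      intro b c
      rw [← map_mul, ← map_mul]
      simp
    let ρ : A →ₐ[F] Module.End L V :=
      { toFun := fun b =>
          { toFun := fun v => Ψ (b ⊗ₜ 1) v
            map_add' := fun v w => map_add _ _ _
            map_smul' := fun l v => LinearMap.congr_fun (hcomm b (cyclicIncl hσ ha l)) v }
        map_one' := by
          refine LinearMap.ext fun v => ?_
          change Ψ 1 v = v
          rw [map_one, Module.End.one_apply]
        map_mul' := fun b b' => by
          refine LinearMap.ext fun v => ?_
          change Ψ ((b * b') ⊗ₜ 1) v = Ψ (b ⊗ₜ 1) (Ψ (b' ⊗ₜ 1) v)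
          rw [← Module.End.mul_apply, ← map_mul, Algebra.TensorProduct.tmul_mul_tmul, mul_one]
        map_zero' := by
          refine LinearMap.ext fun v => ?_
          change Ψ ((0 : A) ⊗ₜ 1) v = 0
          rw [TensorProduct.zero_tmul, map_zero, LinearMap.zero_apply]
        map_add' := fun b b' => by
          refine LinearMap.ext fun v => ?_
          change Ψ ((b + b') ⊗ₜ 1) v = Ψ (b ⊗ₜ 1) v + Ψ (b' ⊗ₜ 1) v
          rw [TensorProduct.add_tmul, map_add, LinearMap.add_apply]
        commutes' := fun c => by
          refine LinearMap.ext fun v => ?_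
          change Ψ (algebraMap F (A ⊗[F] cyclic hσ ha) c) v = c • v
          rw [AlgHom.commutes, Module.algebraMap_end_apply] }
    refine ⟨V, inferInstance, inferInstance, inferInstance, inferInstance, inferInstance,
      inferInstance, ρ, Ψ y, fun l v => ?_, fun b v => ?_, ?_, ?_⟩
    · rw [hsm, hsm, ← Module.End.mul_apply, ← Module.End.mul_apply]
      congr 1
      change Ψ y * Ψ (1 ⊗ₜ cyclicIncl hσ ha l) = Ψ (1 ⊗ₜ cyclicIncl hσ ha (σ l)) * Ψ y
      rw [← map_mul, ← map_mul, Algebra.TensorProduct.tmul_mul_tmul,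
        Algebra.TensorProduct.tmul_mul_tmul, (isCyclicPair_cyclic hσ ha).mul_eq]
    · exact (LinearMap.congr_fun (hcomm b (cyclicGen hσ ha)) v).symm
    · rw [← map_pow, Algebra.TensorProduct.tmul_pow, (isCyclicPair_cyclic hσ ha).pow_eq, one_pow,
        ← AlgHom.commutes Ψ, Algebra.algebraMap_eq_smul_one, Algebra.algebraMap_eq_smul_one,
        TensorProduct.tmul_smul]
      rfl
    · rw [finrank_tensor, finrank_cyclic] at hdim
      have h1 := Module.finrank_mul_finrank F L V
      have h2 : Module.finrank F V = d := by simp [V]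
      rw [h2] at h1
      rw [← h1, mul_pow, mul_comm] at hdim
      exact (Nat.eq_of_mul_eq_mul_right (pow_pos hσ.finrank_pos 2) hdim).le

/-- To identify a Brauer class with that of a cyclic algebra, look at modules. -/
theorem brauerClass_cyclic_eq_of_rep {x : BrauerGroup.{u, u} F}
    (h : ∀ A : CSA.{u, u} F, A.brauerClass * x = 1 → HasSemilinearRep σ a A) :
    x = (cyclic hσ ha).brauerClass := by
  obtain ⟨B, rfl⟩ := exists_brauerClass x
  have h1 := B.brauerClass_mul_op
  have h2 := (hasSemilinearRep_iff hσ ha).1 (h B.op (by rw [mul_comm, h1]))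
  calc B.brauerClass = B.brauerClass * (B.op.brauerClass * (cyclic hσ ha).brauerClass) := by
        rw [h2, mul_one]
    _ = (cyclic hσ ha).brauerClass := by rw [← mul_assoc, h1, one_mul]

end CSA

end CyclicAlgebra

/-! ### Nilpotent differences and fixed points of semilinear maps -/

theorem exists_ne_zero_of_pow_eq_zero {F V : Type*} [Field F] [AddCommGroup V] [Module F V]
    [Nontrivial V] {f : Module.End F V} {n : ℕ} (h : f ^ n = 0) : ∃ v, v ≠ 0 ∧ f v = 0 := by
  by_contra! hcon
  have hinj : Function.Injective f := by
    rw [← LinearMap.ker_eq_bot, LinearMap.ker_eq_bot']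
    intro v hv
    by_contra hv0
    exact hcon v hv0 hv
  obtain ⟨v, hv⟩ := exists_ne (0 : V)
  have h1 : Function.Injective (f ^ n) := by
    rw [Module.End.coe_pow]
    exact hinj.iterate n
  exact hv (h1 (by rw [h]; simp))

/-- In characteristic `p`, commuting operators with equal `p`-th powers agree somewhere. -/
theorem exists_apply_eq_of_pow_eq {F V : Type*} [Field F] (p : ℕ) [Fact p.Prime] [CharP F p]
    [AddCommGroup V] [Module F V] [Nontrivial V] {f g : Module.End F V} (hfg : Commute f g)
    (h : f ^ p = g ^ p) : ∃ v, v ≠ 0 ∧ f v = g v := by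
  have : CharP (Module.End F V) p := charP_of_injective_algebraMap
    (FaithfulSMul.algebraMap_injective F (Module.End F V)) p
  obtain ⟨v, hv, hv'⟩ := exists_ne_zero_of_pow_eq_zero (f := f - g) (n := p) (by
    rw [sub_pow_char_of_commute (p := p) hfg, h, sub_self])
  exact ⟨v, hv, sub_eq_zero.1 (by simpa using hv')⟩

section SemilinearFixedPoints

universe v

variable {E L : Type*} {V : Type v} [Field E] [Field L] [Algebra E L] [AddCommGroup V] [Module L V]
  [Module E V] [IsScalarTower E L V]

/-- Vectors independent over `E` are independent over `L` if every relation between them is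
preserved by maps whose common fixed points are `E`. -/
theorem linearIndependent_of_forall_relation {G : Type*} {τ : G → L → L} (hτ1 : ∀ g, τ g 1 = 1)
    (hτ : ∀ l, (∀ g, τ g l = l) → ∃ e, algebraMap E L e = l) {ι : Type*} {w : ι → V}
    (hw : ∀ x (s : Finset ι) (g : ι → L), ∑ k ∈ s, g k • w k = 0 → ∑ k ∈ s, τ x (g k) • w k = 0)
    (hli : LinearIndependent E w) : LinearIndependent L w := by
  classical
  rw [linearIndependent_iff']
  intro s
  induction s using Finset.induction_on with
  | empty => simp
  | insert i s his ih =>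
    intro g hg
    have hgi : g i = 0 := by
      by_contra hgi
      -- Artin's argument: normalize one coefficient to $1$, subtract the transformed relation to
      -- obtain a shorter one, and conclude by induction that all coefficients are fixed, hence in
      -- $E$.
      let g' : ι → L := fun k => (g i)⁻¹ * g k
      have hg'i : g' i = 1 := inv_mul_cancel₀ hgi
      have hg' : ∑ k ∈ insert i s, g' k • w k = 0 := by
        simp only [g', mul_smul, ← Finset.smul_sum, hg, smul_zero]
      have h2 : ∀ x, ∑ k ∈ s, (τ x (g' k) - g' k) • w k = 0 := by
        intro x
        have h1 := hw x _ _ hg'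
        rw [Finset.sum_insert his, hg'i, hτ1] at h1
        rw [Finset.sum_insert his, hg'i] at hg'
        simp only [sub_smul, Finset.sum_sub_distrib]
        rw [sub_eq_zero]
        exact add_left_cancel (h1.trans hg'.symm)
      have h3 := fun x => ih _ (h2 x)
      have h4 : ∀ k, ∃ e, k ∈ insert i s → algebraMap E L e = g' k := by
        intro k
        by_cases hk : k ∈ s
        · obtain ⟨e, he⟩ := hτ (g' k) fun x => sub_eq_zero.1 (h3 x k hk)
          exact ⟨e, fun _ => he⟩
        · refine ⟨1, fun hk' => ?_⟩
          rw [(Finset.mem_insert.1 hk').resolve_right hk, hg'i, map_one]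
      choose e he using h4
      have h5 : ∑ k ∈ insert i s, e k • w k = 0 := by
        refine Eq.trans (Finset.sum_congr rfl fun k hk => ?_) hg'
        rw [← he k hk, algebraMap_smul]
      have h6 := linearIndependent_iff'.1 hli _ e h5 i (Finset.mem_insert_self i s)
      have h7 := he i (Finset.mem_insert_self i s)
      rw [h6, map_zero, hg'i] at h7
      exact zero_ne_one h7
    rw [Finset.sum_insert his, hgi, zero_smul, zero_add] at hg
    intro k hk
    rcases Finset.mem_insert.1 hk with rfl | hk
    · exact hgi
    · exact ih g hg k hk

/-- The maps `τ` need not be automorphisms: besides Galois conjugations, the map $k\mapsto k+\delta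
k$ of a derivation $\delta$ is also used. -/
theorem finrank_le_of_forall_relation [FiniteDimensional L V] {G : Type*} {τ : G → L → L}
    (hτ1 : ∀ g, τ g 1 = 1) (hτ : ∀ l, (∀ g, τ g l = l) → ∃ e, algebraMap E L e = l)
    {W : Submodule E V} (hW : ∀ {ι : Type v} (w : ι → W) x (s : Finset ι) (g : ι → L),
      ∑ k ∈ s, g k • (w k : V) = 0 → ∑ k ∈ s, τ x (g k) • (w k : V) = 0) :
    Module.finrank E W ≤ Module.finrank L V := by
  have h1 := linearIndependent_of_forall_relation hτ1 hτ
    (w := fun i => (Module.Free.chooseBasis E W i : V)) (hW _)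
    ((Module.Free.chooseBasis E W).linearIndependent.map' W.subtype W.ker_subtype)
  have : Finite (Module.Free.ChooseBasisIndex E W) := h1.finite
  have := Fintype.ofFinite (Module.Free.ChooseBasisIndex E W)
  rw [Module.finrank_eq_card_basis (Module.Free.chooseBasis E W)]
  exact h1.fintype_card_le_finrank

theorem finrank_le_of_semilinear_fixed [FiniteDimensional L V] {G : Type*} {τ : G → L →+* L}
    (hτ : ∀ l, (∀ g, τ g l = l) → ∃ e, algebraMap E L e = l) {T : G → V →+ V}
    (hT : ∀ g (l : L) v, T g (l • v) = τ g l • T g v) {W : Submodule E V}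
    (hW : ∀ g, ∀ w ∈ W, T g w = w) :
    Module.finrank E W ≤ Module.finrank L V := by
  refine finrank_le_of_forall_relation (τ := fun g l => τ g l) (fun g => map_one _) hτ
    fun w x s g hg => ?_
  have h1 := congrArg (T x) hg
  simpa only [map_sum, hT, hW x _ (Subtype.property _), map_zero] using h1

end SemilinearFixedPoints

/-! ### Relations between cyclic classes: second entry and towers -/

section CyclicClasses

variable {F L : Type u} [Field F] [Field L] [Algebra F L]

/-- There are at most $[L:F]$ automorphisms, so one of this order generates the whole group and the
extension is Galois. -/
theorem IsCyclicGenerator.of_orderOf_eq [FiniteDimensional F L] {σ : L ≃ₐ[F] L}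
    (h : orderOf σ = Module.finrank F L) : IsCyclicGenerator σ := by
  have h1 : Fintype.card (Subgroup.zpowers σ) = Module.finrank F L := by
    rw [Fintype.card_zpowers, h]
  have h2 : Fintype.card (L ≃ₐ[F] L) ≤ Module.finrank F L := AlgEquiv.card_le
  have h3 : Subgroup.zpowers σ = ⊤ := by
    apply Subgroup.eq_top_of_le_card
    rw [Nat.card_eq_fintype_card, Nat.card_eq_fintype_card, h1]
    exact h2
  refine ⟨IsGalois.of_card_aut_eq_finrank F L ?_, inferInstance, fun τ => h3 ▸ Subgroup.mem_top τ⟩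
  rw [Nat.card_eq_fintype_card]
  refine h2.antisymm ?_
  rw [← h1]
  exact Fintype.card_subtype_le _

/-- In a cyclic tower `F ⊆ L' ⊆ L` with `[L : L']` prime, the appropriate power of the generator
generates the Galois group of `L/L'`. -/
theorem IsCyclicGenerator.exists_pow_tower {L' : Type u} [Field L'] [Algebra F L'] [Algebra L' L]
    [IsScalarTower F L' L] {p : ℕ} [Fact p.Prime]
    {σ : L ≃ₐ[F] L} (hσ : IsCyclicGenerator σ) {σ' : L' ≃ₐ[F] L'} (hσ' : IsCyclicGenerator σ')
    (hcompat : ∀ l, σ (algebraMap L' L l) = algebraMap L' L (σ' l))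
    (hdeg : Module.finrank L' L = p) :
    ∃ τ : L ≃ₐ[L'] L, (∀ l, τ l = (σ ^ Module.finrank F L') l) ∧ IsCyclicGenerator τ := by
  have := hσ.finiteDimensional
  have := hσ'.finiteDimensional
  have : FiniteDimensional L' L := Module.Finite.of_restrictScalars_finite F L' L
  have hcompat' : ∀ (k : ℕ) l, (σ ^ k) (algebraMap L' L l) = algebraMap L' L ((σ' ^ k) l) := by
    intro k l
    induction k with
    | zero => rfl
    | succ k ih => rw [pow_succ', AlgEquiv.mul_apply, ih, hcompat, pow_succ', AlgEquiv.mul_apply]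
  have hn : Module.finrank F L = Module.finrank F L' * p := by
    rw [← hdeg, Module.finrank_mul_finrank]
  let q := Module.finrank F L'
  let τ : L ≃ₐ[L'] L := AlgEquiv.ofRingEquiv (f := (σ ^ q).toRingEquiv) fun l => by
    change (σ ^ q) (algebraMap L' L l) = _
    rw [hcompat', hσ'.pow_finrank]
    rfl
  have hτpow : ∀ (k : ℕ) l, (τ ^ k) l = (σ ^ (q * k)) l := by
    intro k l
    induction k with
    | zero => rfl
    | succ k ih =>
      rw [pow_succ', AlgEquiv.mul_apply, ih, mul_add, mul_one, add_comm, pow_add,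
        AlgEquiv.mul_apply]
      rfl
  have hτ : IsCyclicGenerator τ := by
    refine IsCyclicGenerator.of_orderOf_eq ?_
    rw [hdeg]
    refine orderOf_eq_prime ?_ fun h1 => ?_
    · ext l
      rw [hτpow, ← hn, hσ.pow_finrank]
      rfl
    · have h2 : σ ^ q = 1 := by
        ext l
        exact DFunLike.congr_fun h1 l
      have h3 := orderOf_dvd_of_pow_eq_one h2
      rw [hσ.orderOf_eq, hn] at h3
      have h4 := Nat.le_of_dvd hσ'.finrank_pos h3
      have h5 := (Fact.out : p.Prime).two_le
      have h6 : 0 < q := hσ'.finrank_pos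
      change q * p ≤ q at h4
      nlinarith
  exact ⟨τ, fun _ => rfl, hτ⟩

/-- With `x` and `y` the classes of opposite algebras, a product formula becomes the triviality of a
single class, which can be tested on modules. -/
theorem mul_eq_of_mul_eq_one {M : Type*} [CommMonoid M] {x y a b c : M} (h1 : x * a = 1)
    (h2 : y * b = 1) (h3 : x * y * c = 1) : a * b = c := by
  calc a * b = a * b * (x * y * c) := by rw [h3, mul_one]
    _ = (x * a) * (y * b) * c := by simp only [mul_assoc, mul_left_comm]
    _ = c := by rw [h1, h2, one_mul, one_mul]

/-- The space is $V\otimes_L W$ with the map $x\otimes y$, well defined because both factors are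
semilinear for the same $\sigma$. -/
theorem HasSemilinearRep.tensor {σ : L ≃ₐ[F] L} {a b : F} {A B : Type u} [Ring A] [Algebra F A]
    [Ring B] [Algebra F B] (hA : HasSemilinearRep σ a A) (hB : HasSemilinearRep σ b B) :
    HasSemilinearRep σ (a * b) (A ⊗[F] B) := by
  obtain ⟨V, _, _, _, _, _, _, ρ, x, hx, hxρ, hxn, hV⟩ := hA
  obtain ⟨W, _, _, _, _, _, _, θ, y, hy, hyθ, hyn, hW⟩ := hB
  let xs : V →ₛₗ[(σ : L →+* L)] V := { toFun := x, map_add' := map_add x, map_smul' := hx }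
  let ys : W →ₛₗ[(σ : L →+* L)] W := { toFun := y, map_add' := map_add y, map_smul' := hy }
  let zs := TensorProduct.map xs ys
  let z : Module.End F (V ⊗[L] W) :=
    { toFun := zs
      map_add' := map_add zs
      map_smul' := fun c v => by
        rw [← algebraMap_smul L c v, map_smulₛₗ]
        simp }
  have hz : ∀ v w, z (v ⊗ₜ w) = x v ⊗ₜ y w := fun _ _ => rfl
  let ρ' : A →ₐ[F] Module.End L (V ⊗[L] W) :=
    ((Module.End.rTensorAlgHom L V W).restrictScalars F).comp ρ
  let θ' : B →ₐ[F] Module.End L (V ⊗[L] W) :=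
    ((Module.End.lTensorAlgHom L W V).restrictScalars F).comp θ
  have hρ' : ∀ b v w, ρ' b (v ⊗ₜ w) = ρ b v ⊗ₜ w := fun _ _ _ => rfl
  have hθ' : ∀ b v w, θ' b (v ⊗ₜ w) = v ⊗ₜ θ b w := fun _ _ _ => rfl
  let φ : A ⊗[F] B →ₐ[F] Module.End L (V ⊗[L] W) :=
    Algebra.TensorProduct.lift ρ' θ' fun b c => TensorProduct.ext' fun v w => by
      simp [Module.End.mul_apply, hρ', hθ']
  have hφ : ∀ b c v w, φ (b ⊗ₜ c) (v ⊗ₜ w) = ρ b v ⊗ₜ θ c w := fun b c v w => by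
    refine (LinearMap.congr_fun (Algebra.TensorProduct.lift_tmul ρ' θ' _ b c) _).trans ?_
    rw [Module.End.mul_apply, hθ', hρ']
  refine ⟨V ⊗[L] W, inferInstance, inferInstance, inferInstance, inferInstance, inferInstance,
    inferInstance, φ, z, fun l v => map_smulₛₗ zs l v, fun b v => ?_, ?_, ?_⟩
  · induction b using TensorProduct.induction_on with
    | zero => simp
    | add b c hb hc => simp only [map_add, LinearMap.add_apply, hb, hc]
    | tmul b c =>
      induction v using TensorProduct.induction_on with
      | zero => simp
      | add v w hv hw => simp only [map_add, hv, hw]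
      | tmul v w => rw [hφ, hz, hz, hφ, hxρ, hyθ]
  · have hpow : ∀ (k : ℕ) v w, (z ^ k) (v ⊗ₜ w) = (x ^ k) v ⊗ₜ (y ^ k) w := by
      intro k v w
      induction k with
      | zero => simp
      | succ k ih =>
        rw [pow_succ', Module.End.mul_apply, ih, hz, pow_succ', pow_succ', Module.End.mul_apply,
          Module.End.mul_apply]
    refine LinearMap.ext fun v => ?_
    induction v using TensorProduct.induction_on with
    | zero => simp
    | add v w hv hw => simp only [map_add, hv, hw]
    | tmul v w =>
      rw [hpow, hxn, hyn]
      simp only [Module.algebraMap_end_apply]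
      rw [← algebraMap_smul L a v, ← algebraMap_smul L b w, TensorProduct.smul_tmul_smul, ← map_mul,
        algebraMap_smul]
  · rw [Module.finrank_tensorProduct, Module.finrank_tensorProduct, mul_pow]
    exact Nat.mul_le_mul hV hW

namespace CSA

theorem brauerClass_cyclic_mul {σ : L ≃ₐ[F] L} (hσ : IsCyclicGenerator σ) {a b : F} (ha : a ≠ 0)
    (hb : b ≠ 0) : (cyclic hσ ha).brauerClass * (cyclic hσ hb).brauerClass =
      (cyclic hσ (mul_ne_zero ha hb)).brauerClass := by
  have h1 : (cyclic hσ ha).op.brauerClass * (cyclic hσ ha).brauerClass = 1 := by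
    rw [mul_comm, brauerClass_mul_op]
  have h2 : (cyclic hσ hb).op.brauerClass * (cyclic hσ hb).brauerClass = 1 := by
    rw [mul_comm, brauerClass_mul_op]
  refine mul_eq_of_mul_eq_one h1 h2 ?_
  rw [← brauerClass_tensor, ← hasSemilinearRep_iff]
  exact ((hasSemilinearRep_iff hσ ha).2 h1).tensor ((hasSemilinearRep_iff hσ hb).2 h2)

theorem brauerClass_cyclic_pow {σ : L ≃ₐ[F] L} (hσ : IsCyclicGenerator σ) {a : F} (ha : a ≠ 0)
    {n : ℕ} (hn : n ≠ 0) :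
    (cyclic hσ (pow_ne_zero n ha)).brauerClass = (cyclic hσ ha).brauerClass ^ n := by
  -- Starting at exponent one avoids the need to know that $(L/F,\sigma,1)$ is trivial.
  have key : ∀ n : ℕ, ∀ h : a ^ (n + 1) ≠ 0,
      (cyclic hσ h).brauerClass = (cyclic hσ ha).brauerClass ^ (n + 1) := by
    intro n
    induction n with
    | zero =>
      intro h
      simp only [zero_add, pow_one]
    | succ n ih =>
      intro h
      rw [pow_succ (cyclic hσ ha).brauerClass, ← ih (pow_ne_zero _ ha), brauerClass_cyclic_mul]
      simp only [pow_succ]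
  obtain ⟨k, rfl⟩ := Nat.exists_eq_succ_of_ne_zero hn
  exact key k _

variable {L' : Type u} [Field L'] [Algebra F L'] [Algebra L' L] [IsScalarTower F L' L]

/-- Going up a cyclic tower of relative degree `p`. -/
theorem brauerClass_cyclic_tower (p : ℕ) [Fact p.Prime] [CharP F p]
    {σ : L ≃ₐ[F] L} (hσ : IsCyclicGenerator σ) {σ' : L' ≃ₐ[F] L'} (hσ' : IsCyclicGenerator σ')
    (hcompat : ∀ l, σ (algebraMap L' L l) = algebraMap L' L (σ' l))
    (hdeg : Module.finrank L' L = p) {b : F} (hb : b ≠ 0) :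
    (cyclic hσ (pow_ne_zero p hb)).brauerClass = (cyclic hσ' hb).brauerClass := by
  have := hσ.finiteDimensional
  have := hσ'.finiteDimensional
  have : FiniteDimensional L' L := Module.Finite.of_restrictScalars_finite F L' L
  have hn : Module.finrank F L = Module.finrank F L' * p := by
    rw [← hdeg, Module.finrank_mul_finrank]
  let q := Module.finrank F L'
  obtain ⟨τ, hτpow, hτ⟩ := hσ.exists_pow_tower hσ' hcompat hdeg
  refine brauerClass_cyclic_eq_of_rep hσ' hb fun A hA => ?_
  obtain ⟨V, _, _, _, _, _, _, ρ, x, hx, hxρ, hxn, hV⟩ := (hasSemilinearRep_iff hσ _).2 hA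
  let _ : Module L' V := Module.compHom V (algebraMap L' L)
  have hsm : ∀ (l : L') (v : V), l • v = algebraMap L' L l • v := fun _ _ => rfl
  have : IsScalarTower L' L V := ⟨fun l k v => by rw [hsm, ← mul_smul, Algebra.smul_def]⟩
  have : IsScalarTower F L' V := ⟨fun c l v => by
    rw [hsm, hsm, Algebra.smul_def, map_mul, ← IsScalarTower.algebraMap_apply, mul_smul,
      algebraMap_smul]⟩
  have : FiniteDimensional L' V := FiniteDimensional.trans L' L V
  have hxpow : ∀ (k : ℕ) (l : L) v, (x ^ k) (l • v) = (σ ^ k) l • (x ^ k) v := by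
    intro k l v
    induction k with
    | zero => rfl
    | succ k ih =>
      rw [pow_succ', pow_succ', Module.End.mul_apply, ih, hx, AlgEquiv.mul_apply,
        Module.End.mul_apply]
  have hτx : ∀ (l : L) v, (x ^ q) (l • v) = τ l • (x ^ q) v := fun l v => by
    rw [hτpow, hxpow]
  -- The eigenspace of $x^q$ for $b$, where $q=[L':F]$. It is nonzero because $(x^q)^p=b^p$, and an
  -- $L'$-space because $\sigma^q$ fixes $L'$. Its dimension is controlled because it consists of
  -- fixed vectors of the semilinear map $b^{-1}x^q$ over $L$.
  let W : Submodule L' V :=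
    { carrier := {v | (x ^ q) v = b • v}
      add_mem' := fun {v w} (hv : _ = _) (hw : _ = _) => by
        change _ = _
        rw [map_add, hv, hw, smul_add]
      zero_mem' := by simp
      smul_mem' := fun l v (hv : _ = _) => by
        change _ = _
        rw [hsm, hτx, hv, AlgEquiv.commutes, smul_comm] }
  have hWmem : ∀ v, v ∈ W ↔ (x ^ q) v = b • v := fun _ => Iff.rfl
  have hρW : ∀ c, ∀ v ∈ W, ((ρ c).restrictScalars L') v ∈ W := by
    intro c v hv
    rw [hWmem] at hv ⊢
    have : ∀ (k : ℕ) v, (x ^ k) (ρ c v) = ρ c ((x ^ k) v) := by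
      intro k v
      induction k with
      | zero => rfl
      | succ k ih => rw [pow_succ', Module.End.mul_apply, ih, hxρ, Module.End.mul_apply]
    rw [LinearMap.restrictScalars_apply, this, hv]
    exact LinearMap.map_smul_of_tower _ _ _
  have hxW : ∀ v ∈ W.restrictScalars F, x v ∈ W.restrictScalars F := by
    intro v hv
    rw [Submodule.restrictScalars_mem, hWmem] at hv ⊢
    rw [← Module.End.mul_apply, ← pow_succ, pow_succ', Module.End.mul_apply, hv, map_smul]
  have hnt : Nontrivial W := by
    rw [Submodule.nontrivial_iff_ne_bot, Submodule.ne_bot_iff]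
    obtain ⟨v, hv, hv'⟩ := exists_apply_eq_of_pow_eq p (f := x ^ q)
      (g := algebraMap F (Module.End F V) b) (Algebra.commutes _ _).symm (by
        rw [← pow_mul, ← hn, hxn, map_pow])
    exact ⟨v, hv', hv⟩
  have hle : Module.finrank L' W ≤ Module.finrank L V := by
    refine finrank_le_of_semilinear_fixed (G := Unit) (τ := fun _ => (τ : L →+* L))
      (fun l hl => hτ.mem_range_of_fixed (hl ()))
      (T := fun _ => (b⁻¹ • (x ^ q)).toAddMonoidHom) (fun _ l v => ?_) (fun _ w hw => ?_)
    · change b⁻¹ • (x ^ q) (l • v) = τ l • b⁻¹ • (x ^ q) v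
      rw [hτx, smul_comm]
    · change b⁻¹ • (x ^ q) w = w
      rw [(hWmem w).1 hw, inv_smul_smul₀ hb]
  let ρ' : A →ₐ[F] Module.End L' V :=
    { toFun := fun c => (ρ c).restrictScalars L'
      map_one' := by rw [map_one]; rfl
      map_mul' := fun c d => by rw [map_mul]; rfl
      map_zero' := by rw [map_zero]; rfl
      map_add' := fun c d => by rw [map_add]; rfl
      commutes' := fun c => by
        rw [AlgHom.commutes]
        ext v
        simp [Module.algebraMap_end_apply] }
  let xW : Module.End F W := x.restrict hxW
  have hxWpow : ∀ (k : ℕ) (v : W), ((xW ^ k) v : V) = (x ^ k) v := by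
    intro k v
    induction k with
    | zero => rfl
    | succ k ih =>
      rw [pow_succ', pow_succ', Module.End.mul_apply, Module.End.mul_apply, ← ih]
      rfl
  refine ⟨W, inferInstance, inferInstance, inferInstance, inferInstance, inferInstance, hnt,
    restrictAlgHom ρ' W hρW, xW, fun l v => Subtype.ext ?_,
    fun c v => Subtype.ext (hxρ c v), ?_, (Nat.pow_le_pow_left hle 2).trans hV⟩
  · change x (l • (v : V)) = σ' l • x v
    rw [hsm, hx, hcompat, hsm]
  · refine LinearMap.ext fun v => Subtype.ext ?_
    rw [hxWpow]
    exact (hWmem _).1 v.2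

end CSA

end CyclicClasses

/-! ### Artin–Schreier polynomials -/

section ArtinSchreier

open Polynomial

/-- The Artin–Schreier polynomial `X ^ p - X - z`. -/
noncomputable abbrev artinSchreierPoly {K : Type*} [Field K] (p : ℕ) (z : K) : K[X] :=
  X ^ p - X - C z

theorem exists_natCast_of_pow_eq_self {K : Type*} [Field K] (p : ℕ) [Fact p.Prime] [CharP K p]
    {c : K} (h : c ^ p = c) : ∃ n : ℕ, (n : K) = c := by
  have h1 : c ∈ (⊥ : Subfield K) := (Subfield.mem_bot_iff_pow_eq_self K p).2 h
  have h2 : (⊥ : Subfield K) ≤ (ZMod.castHom (dvd_refl p) K).fieldRange := bot_le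
  obtain ⟨n, rfl⟩ := h2 h1
  refine ⟨n.val, ?_⟩
  rw [ZMod.castHom_apply, ZMod.natCast_val]

variable {K : Type*} [Field K] (p : ℕ) [Fact p.Prime]

theorem monic_artinSchreierPoly (z : K) : (artinSchreierPoly p z).Monic := by
  have hp := (Fact.out : p.Prime).one_lt
  rw [artinSchreierPoly, sub_sub]
  apply monic_X_pow_sub
  rw [degree_X_add_C]
  exact_mod_cast hp

theorem natDegree_artinSchreierPoly (z : K) : (artinSchreierPoly p z).natDegree = p := by
  have hp := (Fact.out : p.Prime).one_lt
  rw [artinSchreierPoly, sub_sub, natDegree_sub_eq_left_of_natDegree_lt]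
  · exact natDegree_X_pow p
  · rw [natDegree_X_add_C, natDegree_X_pow]
    exact hp

/-- All roots have the form $\alpha+n$ with $n$ in the prime field. If the minimal polynomial of
$\alpha$ had degree $d<p$, its sum of roots $d\alpha+N$ would lie in $K$, and since $d$ is
invertible $\alpha$ would be a root in $K$. -/
theorem irreducible_artinSchreierPoly [CharP K p] {z : K} (h : ∀ c : K, c ^ p - c ≠ z) :
    Irreducible (artinSchreierPoly p z) := by
  have hp := (Fact.out : p.Prime)
  have hmon := monic_artinSchreierPoly p z
  have hdeg := natDegree_artinSchreierPoly p z
  let Ω := AlgebraicClosure K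
  have : CharP Ω p := charP_of_injective_algebraMap (algebraMap K Ω).injective p
  obtain ⟨α, hα⟩ := IsAlgClosed.exists_aeval_eq_zero Ω (artinSchreierPoly p z) (by
    rw [degree_eq_natDegree hmon.ne_zero, hdeg]
    exact_mod_cast hp.ne_zero)
  have hint : IsIntegral K α := ⟨_, hmon, hα⟩
  have hroot : ∀ β : Ω, aeval β (artinSchreierPoly p z) = 0 → ∃ n : ℕ, β = α + n := by
    intro β hβ
    simp only [map_sub, map_pow, aeval_X, aeval_C] at hα hβ
    obtain ⟨n, hn⟩ := exists_natCast_of_pow_eq_self p (c := β - α) (by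
      rw [sub_pow_char]
      linear_combination hβ - hα)
    exact ⟨n, by rw [hn]; ring⟩
  have hdvd : minpoly K α ∣ artinSchreierPoly p z := minpoly.dvd K α hα
  let m := (minpoly K α).map (algebraMap K Ω)
  have hm : m.Monic := (minpoly.monic hint).map _
  have hsplit : m.Splits := IsAlgClosed.splits m
  have hsum : ∀ s : Multiset Ω, (∀ β ∈ s, ∃ n : ℕ, β = α + n) →
      ∃ N : ℕ, s.sum = s.card • α + N := by
    intro s
    induction s using Multiset.induction_on with
    | empty => exact fun _ => ⟨0, by simp⟩
    | cons β s ih =>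
      intro hs
      obtain ⟨n, hn⟩ := hs β (Multiset.mem_cons_self _ _)
      obtain ⟨N, hN⟩ := ih fun γ hγ => hs γ (Multiset.mem_cons_of_mem hγ)
      refine ⟨n + N, ?_⟩
      rw [Multiset.sum_cons, hN, hn, Multiset.card_cons, succ_nsmul]
      push_cast
      ring
  obtain ⟨N, hN⟩ := hsum m.roots fun β hβ => hroot β <| by
    obtain ⟨g, hg⟩ := hdvd
    have : aeval β (minpoly K α) = 0 := by
      have := (mem_roots'.1 hβ).2
      rwa [IsRoot.def, eval_map_algebraMap] at this
    rw [hg, map_mul, this, zero_mul]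
  have hcard : m.roots.card = (minpoly K α).natDegree := by
    rw [← hsplit.natDegree_eq_card_roots, natDegree_map]
  have hnext : algebraMap K Ω (minpoly K α).nextCoeff = -m.roots.sum := by
    rw [← hsplit.nextCoeff_eq_neg_sum_roots_of_monic hm, nextCoeff_map (algebraMap K Ω).injective]
  have hle : p ≤ (minpoly K α).natDegree := by
    by_contra! hlt
    have hpos : 0 < (minpoly K α).natDegree := minpoly.natDegree_pos hint
    have hne : ((minpoly K α).natDegree : K) ≠ 0 := by
      rw [Ne, CharP.cast_eq_zero_iff K p]
      exact Nat.not_dvd_of_pos_of_lt hpos hlt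
    have hα' : α = algebraMap K Ω
        (((minpoly K α).natDegree : K)⁻¹ * (-(minpoly K α).nextCoeff - N)) := by
      rw [hN, hcard] at hnext
      have hne' : algebraMap K Ω ((minpoly K α).natDegree : K) ≠ 0 := by
        rwa [Ne, map_eq_zero]
      rw [map_mul, map_inv₀, eq_inv_mul_iff_mul_eq₀ hne', map_sub, map_neg, hnext, map_natCast,
        map_natCast, nsmul_eq_mul]
      ring
    rw [hα', aeval_algebraMap_apply, map_eq_zero] at hα
    simp only [map_sub, map_pow, aeval_X, aeval_C, Algebra.algebraMap_self, RingHom.id_apply] at hα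
    exact h _ (sub_eq_zero.1 hα)
  have heq : minpoly K α = artinSchreierPoly p z :=
    (eq_of_monic_of_dvd_of_natDegree_le (minpoly.monic hint) hmon hdvd (by rw [hdeg]; exact hle)).symm
  rw [← heq]
  exact minpoly.irreducible hint

end ArtinSchreier

/-! ### Traces and additive Hilbert 90 for cyclic extensions -/

namespace IsCyclicGenerator

variable {F L : Type u} [Field F] [Field L] [Algebra F L] {σ : L ≃ₐ[F] L}
  (hσ : IsCyclicGenerator σ)
include hσ

theorem trace_eq_sum (l : L) : algebraMap F L (Algebra.trace F L l) =
    ∑ k ∈ Finset.range (Module.finrank F L), (σ ^ k) l := by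
  have := hσ.isGalois
  have := hσ.finiteDimensional
  rw [trace_eq_sum_automorphisms, Finset.sum_range]
  symm
  refine Fintype.sum_bijective (fun k : Fin (Module.finrank F L) => σ ^ (k : ℕ)) ?_ _ _
    fun _ => rfl
  rw [Fintype.bijective_iff_injective_and_card]
  refine ⟨hσ.pow_injective, ?_⟩
  rw [Fintype.card_fin, ← IsGalois.card_aut_eq_finrank F L, Nat.card_eq_fintype_card]

theorem exists_sum_eq_one :
    ∃ d : L, ∑ k ∈ Finset.range (Module.finrank F L), (σ ^ k) d = 1 := by
  have := hσ.isGalois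
  have := hσ.finiteDimensional
  obtain ⟨d, hd⟩ := Algebra.trace_surjective F L 1
  exact ⟨d, by rw [← hσ.trace_eq_sum, hd, map_one]⟩

/-- The additive form of Hilbert's Theorem 90. -/
theorem exists_sub_eq {c : L} (hc : ∑ k ∈ Finset.range (Module.finrank F L), (σ ^ k) c = 0) :
    ∃ z, σ z - z = c := by
  have := hσ.isGalois
  have := hσ.finiteDimensional
  let f : L →ₗ[F] L := σ.toLinearMap - LinearMap.id
  -- A dimension count: the kernel of $\sigma-1$ is at most a line, so its image, which lies in the
  -- kernel of the surjective trace, must fill it.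
  have hker : LinearMap.ker f ≤ LinearMap.range (Algebra.linearMap F L) := by
    intro l hl
    obtain ⟨c, hc⟩ := hσ.mem_range_of_fixed (l := l) (sub_eq_zero.1 hl)
    exact ⟨c, hc⟩
  have hker1 : Module.finrank F (LinearMap.ker f) ≤ 1 := by
    refine (Submodule.finrank_mono hker).trans ?_
    refine (LinearMap.finrank_range_le _).trans ?_
    rw [Module.finrank_self]
  have htr : LinearMap.range (Algebra.trace F L) = ⊤ :=
    LinearMap.range_eq_top.2 (Algebra.trace_surjective F L)
  have h1 := LinearMap.finrank_range_add_finrank_ker f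
  have h2 := LinearMap.finrank_range_add_finrank_ker (Algebra.trace F L)
  rw [htr, finrank_top, Module.finrank_self] at h2
  have hle : LinearMap.range f ≤ LinearMap.ker (Algebra.trace F L) := by
    rintro _ ⟨l, rfl⟩
    rw [LinearMap.mem_ker]
    change Algebra.trace F L (σ l - l) = 0
    rw [map_sub, Algebra.trace_eq_of_algEquiv, sub_self]
  have heq := Submodule.eq_of_le_of_finrank_le hle (by omega)
  have hmem : c ∈ LinearMap.ker (Algebra.trace F L) := by
    rw [LinearMap.mem_ker]
    apply (algebraMap F L).injective
    rw [hσ.trace_eq_sum, hc, map_zero]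
  rw [← heq] at hmem
  exact hmem

/-- The element over which a cyclic extension of degree `p ^ j` has to be extended. -/
theorem exists_artinSchreier (p : ℕ) [Fact p.Prime] [CharP F p] :
    ∃ z d : L, σ z - z = d ^ p - d ∧
      ∑ k ∈ Finset.range (Module.finrank F L), (σ ^ k) d = 1 := by
  have : CharP L p := charP_of_injective_algebraMap (algebraMap F L).injective p
  obtain ⟨d, hd⟩ := hσ.exists_sum_eq_one
  -- Since $d$ has trace $1$, the trace of $d^p-d$ is $1^p-1=0$.
  obtain ⟨z, hz⟩ := hσ.exists_sub_eq (c := d ^ p - d) (by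
    simp only [map_sub, map_pow, Finset.sum_sub_distrib]
    rw [← sum_pow_char, hd, one_pow, sub_self])
  exact ⟨z, d, hz, hd⟩

/-- If $z=c^p-c$, then $\sigma c-c-d$ is fixed by Frobenius and hence lies in the prime field.
Taking traces gives $\mathrm{tr}\,d=0$, because $p$ divides the degree, against $\mathrm{tr}\,d=1$.
-/
theorem pow_sub_ne (p : ℕ) [Fact p.Prime] [CharP F p] (hp : p ∣ Module.finrank F L) {z d : L}
    (hz : σ z - z = d ^ p - d)
    (hd : ∑ k ∈ Finset.range (Module.finrank F L), (σ ^ k) d = 1) (c : L) : c ^ p - c ≠ z := by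
  have : CharP L p := charP_of_injective_algebraMap (algebraMap F L).injective p
  rintro rfl
  obtain ⟨n, hn⟩ := exists_natCast_of_pow_eq_self p (c := σ c - c - d) (by
    rw [sub_pow_char, sub_pow_char]
    simp only [map_sub, map_pow] at hz
    linear_combination hz)
  have h1 : ∑ k ∈ Finset.range (Module.finrank F L), (σ ^ k) (n : L) = 0 := by
    simp only [map_natCast, Finset.sum_const, Finset.card_range, nsmul_eq_mul]
    rw [(CharP.cast_eq_zero_iff L p _).2 hp, zero_mul]
  have h2 : ∑ k ∈ Finset.range (Module.finrank F L), (σ ^ k) (σ c - c) = 0 := by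
    have : ∀ k, (σ ^ k) (σ c - c) = (σ ^ (k + 1)) c - (σ ^ k) c := fun k => by
      rw [map_sub, pow_succ, AlgEquiv.mul_apply]
    simp only [this]
    rw [Finset.sum_range_sub (fun k => (σ ^ k) c), hσ.pow_finrank]
    simp
  have h3 : d = σ c - c - n := by rw [hn]; ring
  rw [h3] at hd
  simp only [map_sub _ _ (n : L), Finset.sum_sub_distrib] at hd
  rw [h2, h1, sub_self] at hd
  exact zero_ne_one hd

end IsCyclicGenerator

/-! ### Enlarging a cyclic extension by an Artin–Schreier step -/

section ArtinSchreierExtension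

variable {F L' : Type u} [Field F] [Field L'] [Algebra F L'] (p : ℕ) [Fact p.Prime]

/-- The extension of `L'` by a root of `X ^ p - X - z`. -/
abbrev ArtinSchreierExt (z : L') : Type u := AdjoinRoot (artinSchreierPoly p z)

theorem finrank_artinSchreierExt (z : L') : Module.finrank L' (ArtinSchreierExt p z) = p := by
  rw [(AdjoinRoot.powerBasis (monic_artinSchreierPoly p z).ne_zero).finrank,
    AdjoinRoot.powerBasis_dim, natDegree_artinSchreierPoly]

omit [Fact p.Prime] in
theorem root_pow_sub_root (z : L') :
    (AdjoinRoot.root (artinSchreierPoly p z)) ^ p - AdjoinRoot.root (artinSchreierPoly p z) =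
      algebraMap L' (ArtinSchreierExt p z) z := by
  have := AdjoinRoot.eval₂_root (artinSchreierPoly p z)
  simp only [Polynomial.eval₂_sub, Polynomial.eval₂_pow, Polynomial.eval₂_X,
    Polynomial.eval₂_C] at this
  exact sub_eq_zero.1 this

/-- `(L, σ)` is the cyclic extension of `(L', σ')` generated by `u`, with `u ^ p - u = z` and
`σ u = u + d`. -/
structure IsArtinSchreierLift {L : Type u} [Field L] [Algebra F L] [Algebra L' L]
    (σ' : L' ≃ₐ[F] L') (z d : L') (σ : L ≃ₐ[F] L) (u : L) : Prop where
  isCyclicGenerator : IsCyclicGenerator σ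
  finrank_eq : Module.finrank L' L = p
  compat : ∀ l, σ (algebraMap L' L l) = algebraMap L' L (σ' l)
  pow_sub : u ^ p - u = algebraMap L' L z
  map_gen : σ u = u + algebraMap L' L d

namespace IsArtinSchreierLift

variable {p} {L : Type u} [Field L] [Algebra F L] [Algebra L' L] {σ' : L' ≃ₐ[F] L'} {z d : L'}
    {σ : L ≃ₐ[F] L} {u : L} (h : IsArtinSchreierLift p σ' z d σ u)
include h

omit [Fact p.Prime] in
theorem pow_algebraMap (k : ℕ) (l : L') :
    (σ ^ k) (algebraMap L' L l) = algebraMap L' L ((σ' ^ k) l) := by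
  induction k with
  | zero => rfl
  | succ k ih => rw [pow_succ', AlgEquiv.mul_apply, ih, h.compat, pow_succ', AlgEquiv.mul_apply]

omit [Fact p.Prime] in
theorem pow_gen (k : ℕ) :
    (σ ^ k) u = u + algebraMap L' L (∑ i ∈ Finset.range k, (σ' ^ i) d) := by
  induction k with
  | zero => simp
  | succ k ih =>
    rw [pow_succ, AlgEquiv.mul_apply, h.map_gen, map_add, ih, h.pow_algebraMap,
      Finset.sum_range_succ, map_add, add_assoc]

end IsArtinSchreierLift

/-- Extend $\sigma'$ by $u\mapsto u+d$; this respects $u^p-u=z$ because $\sigma'z-z=d^p-d$. As $d$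
has trace $1$, the $[L':F]$-th power of the extension sends $u$ to $u+1$, so the order is $p[L':F]$.
-/
theorem exists_isArtinSchreierLift [CharP F p] {σ' : L' ≃ₐ[F] L'} (hσ' : IsCyclicGenerator σ')
    {z d : L'} (hz : σ' z - z = d ^ p - d)
    (hd : ∑ k ∈ Finset.range (Module.finrank F L'), (σ' ^ k) d = 1)
    [Fact (Irreducible (artinSchreierPoly p z))] :
    ∃ σ : ArtinSchreierExt p z ≃ₐ[F] ArtinSchreierExt p z,
      IsArtinSchreierLift p σ' z d σ (AdjoinRoot.root _) := by
  have := hσ'.finiteDimensional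
  have : CharP (ArtinSchreierExt p z) p :=
    charP_of_injective_algebraMap (algebraMap F (ArtinSchreierExt p z)).injective p
  have hfin := finrank_artinSchreierExt p z
  have : FiniteDimensional L' (ArtinSchreierExt p z) :=
    Module.finite_of_finrank_pos (by rw [hfin]; exact (Fact.out : p.Prime).pos)
  have : FiniteDimensional F (ArtinSchreierExt p z) := FiniteDimensional.trans F L' _
  let r : ArtinSchreierExt p z := AdjoinRoot.root _
  let of' : L' →ₐ[F] ArtinSchreierExt p z := IsScalarTower.toAlgHom F L' _
  let f : ArtinSchreierExt p z →ₐ[F] ArtinSchreierExt p z :=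
    AdjoinRoot.liftAlgHom _ (of'.comp σ'.toAlgHom) (r + of' d) (by
      simp only [Polynomial.eval₂_sub, Polynomial.eval₂_pow, Polynomial.eval₂_X,
        Polynomial.eval₂_C]
      change (r + of' d) ^ p - (r + of' d) - of' (σ' z) = 0
      have h1 : r ^ p - r = of' z := root_pow_sub_root p z
      have h2 := congrArg of' hz
      simp only [map_sub, map_pow] at h2
      rw [add_pow_char]
      linear_combination h1 - h2)
  have hfof : ∀ l, f (of' l) = of' (σ' l) := fun l => AdjoinRoot.liftAlgHom_of _ _ _ _ l
  have hfr : f r = r + of' d := AdjoinRoot.liftAlgHom_root _ _ _ _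
  have hbij : Function.Bijective f := by
    have hinj : Function.Injective f := f.toRingHom.injective
    exact ⟨hinj, (LinearMap.injective_iff_surjective (f := f.toLinearMap)).1 hinj⟩
  let σ := AlgEquiv.ofBijective f hbij
  refine ⟨σ, ?_, hfin, hfof, root_pow_sub_root p z, hfr⟩
  have hpow : ∀ (k : ℕ) l, (σ ^ k) (of' l) = of' ((σ' ^ k) l) := by
    intro k l
    induction k with
    | zero => rfl
    | succ k ih =>
      rw [pow_succ', AlgEquiv.mul_apply, ih, pow_succ', AlgEquiv.mul_apply]
      exact hfof _
  have hgen : ∀ k : ℕ, (σ ^ k) r = r + of' (∑ i ∈ Finset.range k, (σ' ^ i) d) := by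
    intro k
    induction k with
    | zero => simp
    | succ k ih =>
      rw [pow_succ, AlgEquiv.mul_apply, show σ r = r + of' d from hfr, map_add, ih, hpow,
        Finset.sum_range_succ, map_add, add_assoc]
  have hgen' : ∀ k : ℕ, (σ ^ (Module.finrank F L' * k)) r = r + k := by
    intro k
    induction k with
    | zero => simp
    | succ k ih =>
      rw [mul_add, mul_one, pow_add, AlgEquiv.mul_apply, hgen, hd, map_one, map_add, ih, map_one]
      push_cast
      ring
  apply IsCyclicGenerator.of_orderOf_eq
  rw [← Module.finrank_mul_finrank F L' (ArtinSchreierExt p z), hfin]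
  refine Nat.dvd_antisymm (orderOf_dvd_of_pow_eq_one ?_) ?_
  · have hext : ∀ g g' : ArtinSchreierExt p z →ₐ[F] ArtinSchreierExt p z,
        (∀ l, g (of' l) = g' (of' l)) → g r = g' r → g = g' := by
      intro g g' h1 h2
      refine AlgHom.ext fun x => ?_
      induction x using AdjoinRoot.induction_on with
      | ih q =>
        induction q using Polynomial.induction_on' with
        | add q q' hq hq' => rw [map_add, map_add, map_add, hq, hq']
        | monomial n c =>
          rw [← Polynomial.C_mul_X_pow_eq_monomial, map_mul, map_pow, AdjoinRoot.mk_C,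
            AdjoinRoot.mk_X, map_mul, map_mul, map_pow, map_pow]
          exact congrArg₂ _ (h1 c) (congrArg (· ^ n) h2)
    have h1 : ((σ ^ (Module.finrank F L' * p) : _ ≃ₐ[F] _) : ArtinSchreierExt p z →ₐ[F] _) =
        AlgHom.id F _ := by
      refine hext _ _ (fun l => ?_) ?_
      · change (σ ^ _) (of' l) = of' l
        rw [hpow, pow_mul, hσ'.pow_finrank, one_pow]
        rfl
      · change (σ ^ _) r = r
        rw [hgen', CharP.cast_eq_zero, add_zero]
    ext x
    exact DFunLike.congr_fun h1 x
  · have h1 : σ' ^ orderOf σ = 1 := by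
      ext l
      apply of'.toRingHom.injective
      change of' ((σ' ^ orderOf σ) l) = of' l
      rw [← hpow, pow_orderOf_eq_one]
      rfl
    have h2 := orderOf_dvd_of_pow_eq_one h1
    rw [hσ'.orderOf_eq] at h2
    obtain ⟨k, hk⟩ := h2
    rw [hk]
    apply Nat.mul_dvd_mul_left
    have h3 := hgen' k
    rw [← hk, pow_orderOf_eq_one, AlgEquiv.one_apply, left_eq_add] at h3
    exact (CharP.cast_eq_zero_iff _ p k).1 h3

end ArtinSchreierExtension

/-! ### Operators on a tensor product -/

section TensorOperators

variable {F V W : Type*} [Field F] [AddCommGroup V] [Module F V] [AddCommGroup W] [Module F W]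

/-- `f ↦ f ⊗ 1`. -/
noncomputable def leftOp (F V W : Type*) [Field F] [AddCommGroup V] [Module F V] [AddCommGroup W]
    [Module F W] : Module.End F V →ₐ[F] Module.End F (V ⊗[F] W) :=
  Module.End.rTensorAlgHom F V W

/-- `g ↦ 1 ⊗ g`. -/
noncomputable def rightOp (F V W : Type*) [Field F] [AddCommGroup V] [Module F V] [AddCommGroup W]
    [Module F W] : Module.End F W →ₐ[F] Module.End F (V ⊗[F] W) :=
  Module.End.lTensorAlgHom F W V

theorem leftOp_tmul (f : Module.End F V) (v : V) (w : W) :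
    leftOp F V W f (v ⊗ₜ w) = f v ⊗ₜ w := rfl

theorem rightOp_tmul (g : Module.End F W) (v : V) (w : W) :
    rightOp F V W g (v ⊗ₜ w) = v ⊗ₜ g w := rfl

theorem commute_leftOp_rightOp (f : Module.End F V) (g : Module.End F W) :
    Commute (leftOp F V W f) (rightOp F V W g) :=
  TensorProduct.ext' fun v w => by
    rw [Module.End.mul_apply, Module.End.mul_apply, leftOp_tmul, rightOp_tmul, rightOp_tmul,
      leftOp_tmul]

end TensorOperators

/-! ### Absorbing a symbol into the last Artin–Schreier step -/

section ArtinSchreierSum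

variable {F L' L M : Type u} [Field F] [Field L'] [Algebra F L'] [Field L] [Algebra F L]
  [Algebra L' L] [IsScalarTower F L' L] [Field M] [Algebra F M] {p : ℕ} [Fact p.Prime] [CharP F p]

/-- Adding a constant to the Artin–Schreier parameter of the last step of a cyclic extension. -/
theorem HasSemilinearRep.artinSchreier {σ' : L' ≃ₐ[F] L'} (hσ' : IsCyclicGenerator σ') {z d : L'}
    (hd : ∑ k ∈ Finset.range (Module.finrank F L'), (σ' ^ k) d = 1)
    {σ : L ≃ₐ[F] L} {u : L} (hσ : IsArtinSchreierLift p σ' z d σ u)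
    {f : F} {σM : M ≃ₐ[F] M} {v : M}
    (hσM : IsArtinSchreierLift p (AlgEquiv.refl : F ≃ₐ[F] F) f 1 σM v)
    [Fact (Irreducible (artinSchreierPoly p (z + algebraMap F L' f)))]
    {σ₃ : ArtinSchreierExt p (z + algebraMap F L' f) ≃ₐ[F]
      ArtinSchreierExt p (z + algebraMap F L' f)}
    (hσ₃ : IsArtinSchreierLift p σ' (z + algebraMap F L' f) d σ₃ (AdjoinRoot.root _))
    {a : F} (ha : a ≠ 0) {A B : Type u} [Ring A] [Algebra F A] [Ring B] [Algebra F B]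
    (hA : HasSemilinearRep σ a A) (hB : HasSemilinearRep σM a B) :
    HasSemilinearRep σ₃ a (A ⊗[F] B) := by
  obtain ⟨V, _, _, _, _, _, _, ρ, x, hx, hxρ, hxn, hV⟩ := hA
  obtain ⟨W, _, _, _, _, _, _, θ, y, hy, hyθ, hyn, hW⟩ := hB
  have hp := (Fact.out : p.Prime)
  have := hσ.isCyclicGenerator.finiteDimensional
  have := hσM.isCyclicGenerator.finiteDimensional
  have := hσ'.finiteDimensional
  have := hσ₃.isCyclicGenerator.finiteDimensional
  have : FiniteDimensional L' L := Module.Finite.of_restrictScalars_finite F L' L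
  have : FiniteDimensional F V := FiniteDimensional.trans F L V
  have : FiniteDimensional F W := FiniteDimensional.trans F M W
  let U := V ⊗[F] W
  have : FiniteDimensional L U := Module.Finite.of_restrictScalars_finite F L U
  have : CharP (Module.End F U) p := charP_of_injective_algebraMap
    (FaithfulSMul.algebraMap_injective F (Module.End F U)) p
  let q := Module.finrank F L'
  obtain ⟨τ, hτpow, hτ⟩ := hσ.isCyclicGenerator.exists_pow_tower hσ' hσ.compat hσ.finrank_eq
  have hn : Module.finrank F L = q * p := by
    rw [← hσ.finrank_eq, Module.finrank_mul_finrank]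
  have hnM : Module.finrank F M = p := hσM.finrank_eq
  have hn₃ : Module.finrank F (ArtinSchreierExt p (z + algebraMap F L' f)) = q * p := by
    have h := Module.finrank_mul_finrank F L' (ArtinSchreierExt p (z + algebraMap F L' f))
    rw [hσ₃.finrank_eq] at h
    exact h.symm
  have hτu : τ u = u + 1 := by
    rw [hτpow, hσ.pow_gen, hd, map_one]
  -- the operators on `V`
  let lL : L →ₐ[F] Module.End F V := Algebra.lsmul F F V
  let lM : M →ₐ[F] Module.End F W := Algebra.lsmul F F W
  have hxl : ∀ l, x * lL l = lL (σ l) * x := fun l => LinearMap.ext fun v => hx l v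
  have hxpow : ∀ (k : ℕ) l, x ^ k * lL l = lL ((σ ^ k) l) * x ^ k := by
    intro k l
    induction k with
    | zero => simp
    | succ k ih =>
      rw [pow_succ', mul_assoc, ih, ← mul_assoc, hxl, mul_assoc, pow_succ', AlgEquiv.mul_apply]
  have hyl : ∀ l, y * lM l = lM (σM l) * y := fun l => LinearMap.ext fun v => hy l v
  let ι₁ := leftOp F V W
  let ι₂ := rightOp F V W
  have hι : ∀ f g, ι₁ f * ι₂ g = ι₂ g * ι₁ f := fun f g => commute_leftOp_rightOp f g
  let w := x ^ q
  have hwl : ∀ l, w * lL l = lL (τ l) * w := fun l => by rw [hxpow, hτpow]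
  -- Both $w=x^q$ and $y$ have $p$-th power $a$ and shift their Artin–Schreier generator by $1$. On
  -- the kernel of their difference they agree, so there the two generators are shifted together.
  let D : Module.End F U := ι₁ w - ι₂ y
  let jL : L' →ₐ[F] Module.End F U := ι₁.comp (lL.comp (IsScalarTower.toAlgHom F L' L))
  -- The sum of the two generators is the generator of the new extension: $t^p-t=z+f$ by additivity
  -- of Frobenius. From $Dt=(t+1)D$ it preserves $\ker D$.
  let t : Module.End F U := ι₁ (lL u) + ι₂ (lM v)
  let X : Module.End F U := ι₁ x
  have hDj : ∀ l, D * jL l = jL l * D := by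
    intro l
    change (ι₁ w - ι₂ y) * ι₁ (lL (algebraMap L' L l)) = ι₁ (lL (algebraMap L' L l)) * (ι₁ w - ι₂ y)
    rw [sub_mul, mul_sub, ← map_mul, ← map_mul, hwl, AlgEquiv.commutes, hι]
  have hDt : D * t = t * D + D := by
    have h1 : w * lL u = lL u * w + w := by
      rw [hwl, hτu, map_add, map_one, add_mul, one_mul]
    have h2 : y * lM v = lM v * y + y := by
      rw [hyl, hσM.map_gen, map_one, map_add, map_one, add_mul, one_mul]
    change (ι₁ w - ι₂ y) * (ι₁ (lL u) + ι₂ (lM v)) =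
      (ι₁ (lL u) + ι₂ (lM v)) * (ι₁ w - ι₂ y) + (ι₁ w - ι₂ y)
    rw [sub_mul, mul_add, mul_add, ← map_mul, ← map_mul, h1, h2, map_add, map_add, map_mul, map_mul,
      add_mul, mul_sub, mul_sub, hι w, hι (lL u) y]
    abel
  have hDX : D * X = X * D := by
    change (ι₁ w - ι₂ y) * ι₁ x = ι₁ x * (ι₁ w - ι₂ y)
    rw [sub_mul, mul_sub, ← map_mul, ← map_mul, hι, (Commute.pow_self x q).eq]
  have htj : ∀ l, t * jL l = jL l * t := by
    intro l
    change (ι₁ (lL u) + ι₂ (lM v)) * ι₁ (lL (algebraMap L' L l)) =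
      ι₁ (lL (algebraMap L' L l)) * (ι₁ (lL u) + ι₂ (lM v))
    rw [add_mul, mul_add, ← map_mul, ← map_mul, ← map_mul, ← map_mul, mul_comm, hι]
  have htpow : t ^ p - t = jL (z + algebraMap F L' f) := by
    change (ι₁ (lL u) + ι₂ (lM v)) ^ p - (ι₁ (lL u) + ι₂ (lM v)) = _
    rw [add_pow_char_of_commute (p := p) (commute_leftOp_rightOp _ _), ← map_pow, ← map_pow,
      ← map_pow, ← map_pow, add_sub_add_comm, ← map_sub, ← map_sub, ← map_sub, ← map_sub,
      hσ.pow_sub, hσM.pow_sub, map_add, AlgHom.commutes jL, AlgHom.commutes lM, AlgHom.commutes ι₂]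
    rfl
  have hXj : ∀ l, X * jL l = jL (σ' l) * X := by
    intro l
    change ι₁ x * ι₁ (lL (algebraMap L' L l)) = ι₁ (lL (algebraMap L' L (σ' l))) * ι₁ x
    rw [← map_mul, hxl, hσ.compat, map_mul]
  have hXt : X * t = (t + jL d) * X := by
    change ι₁ x * (ι₁ (lL u) + ι₂ (lM v)) =
      (ι₁ (lL u) + ι₂ (lM v) + ι₁ (lL (algebraMap L' L d))) * ι₁ x
    rw [mul_add, ← map_mul, hxl, hσ.map_gen, hι, map_add, map_mul, map_add, add_mul, add_mul,
      add_mul]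
    abel
  have hXpow : X ^ (q * p) = algebraMap F _ a := by
    change (ι₁ x) ^ (q * p) = _
    rw [← map_pow, ← hn, hxn, AlgHom.commutes]
  -- the action of `A ⊗ B`
  let ρ' : A →ₐ[F] Module.End F U := ι₁.comp ((restrictScalarsEnd F L V).comp ρ)
  let θ' : B →ₐ[F] Module.End F U := ι₂.comp ((restrictScalarsEnd F M W).comp θ)
  let φ : A ⊗[F] B →ₐ[F] Module.End F U :=
    Algebra.TensorProduct.lift ρ' θ' fun b c => commute_leftOp_rightOp _ _
  have hxρ' : ∀ b, Commute x (restrictScalarsEnd F L V (ρ b)) := fun b =>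
    LinearMap.ext fun v => hxρ b v
  have hyθ' : ∀ b, Commute y (restrictScalarsEnd F M W (θ b)) := fun b =>
    LinearMap.ext fun v => hyθ b v
  have hLρ : ∀ l b, Commute (lL l) (restrictScalarsEnd F L V (ρ b)) := fun l b =>
    LinearMap.ext fun v => ((ρ b).map_smul l v).symm
  have hMθ : ∀ l b, Commute (lM l) (restrictScalarsEnd F M W (θ b)) := fun l b =>
    LinearMap.ext fun v => ((θ b).map_smul l v).symm
  have hφcomm : ∀ T : Module.End F U, (∀ b, Commute T (ρ' b)) → (∀ c, Commute T (θ' c)) →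
      ∀ s, Commute T (φ s) := by
    intro T h1 h2 s
    induction s using TensorProduct.induction_on with
    | zero => rw [map_zero]; exact Commute.zero_right T
    | add s s' hs hs' => rw [map_add]; exact hs.add_right hs'
    | tmul b c =>
      have : φ (b ⊗ₜ c) = ρ' b * θ' c := Algebra.TensorProduct.lift_tmul _ _ _ _ _
      rw [this]
      exact (h1 b).mul_right (h2 c)
  have hφD : ∀ s, Commute D (φ s) := hφcomm D
    (fun b => (((hxρ' b).pow_left q).map ι₁).sub_left (commute_leftOp_rightOp _ _).symm)
    (fun c => (commute_leftOp_rightOp _ _).sub_left ((hyθ' c).map ι₂))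
  have hφj : ∀ l s, Commute (jL l) (φ s) := fun l => hφcomm _
    (fun b => (hLρ _ b).map ι₁) (fun c => commute_leftOp_rightOp _ _)
  have hφt : ∀ s, Commute t (φ s) := hφcomm _
    (fun b => ((hLρ _ b).map ι₁).add_left (commute_leftOp_rightOp _ _).symm)
    (fun c => (commute_leftOp_rightOp _ _).add_left ((hMθ _ c).map ι₂))
  have hφX : ∀ s, Commute X (φ s) := hφcomm _
    (fun b => (hxρ' b).map ι₁) (fun c => commute_leftOp_rightOp _ _)
  -- the space
  let _ : Module L' U := Module.compHom U (jL : L' →+* Module.End F U)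
  have hsm : ∀ (l : L') (v : U), l • v = jL l v := fun _ _ => rfl
  have hL : ∀ (l : L) (v : U), ι₁ (lL l) v = l • v := by
    intro l v
    induction v using TensorProduct.induction_on with
    | zero => simp
    | add v w hv hw => rw [map_add, hv, hw, smul_add]
    | tmul v w => rfl
  have : IsScalarTower L' L U := ⟨fun l k v => by
    rw [hsm, Algebra.smul_def, mul_smul, ← hL]
    rfl⟩
  have : IsScalarTower F L' U := ⟨fun c l v => by
    rw [hsm, hsm, map_smul, LinearMap.smul_apply]⟩
  have : FiniteDimensional L' U := FiniteDimensional.trans L' L U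
  let S : Submodule L' U :=
    { carrier := {v | D v = 0}
      add_mem' := fun {v w} (hv : D v = 0) (hw : D w = 0) => by
        change D (v + w) = 0
        rw [map_add, hv, hw, add_zero]
      zero_mem' := map_zero D
      smul_mem' := fun l v (hv : D v = 0) => by
        change D (l • v) = 0
        rw [hsm, ← Module.End.mul_apply, hDj, Module.End.mul_apply, hv, map_zero] }
  have hSmem : ∀ v, v ∈ S ↔ D v = 0 := fun _ => Iff.rfl
  have hSnt : Nontrivial S := by
    rw [Submodule.nontrivial_iff_ne_bot, Submodule.ne_bot_iff]
    obtain ⟨v, hv, hv'⟩ := exists_apply_eq_of_pow_eq p (f := ι₁ w) (g := ι₂ y)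
      (commute_leftOp_rightOp _ _) (by
        have h1 : w ^ p = algebraMap F _ a := by rw [← pow_mul, ← hn, hxn]
        have h2 : y ^ p = algebraMap F _ a := by rw [← hnM, hyn]
        rw [← map_pow, ← map_pow, h1, h2, AlgHom.commutes, AlgHom.commutes])
    exact ⟨v, sub_eq_zero.2 hv', hv⟩
  have hle : Module.finrank L' S ≤ Module.finrank L U := by
    -- On $\ker D$ one has $w=y$, so $a^{-1}y^{p-1}w$ acts there as $a^{-1}y^p=1$; it is
    -- $\tau$-semilinear over $L$ because $w$ is. This bounds $\dim_{L'}\ker D$ by $\dim_L U$.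
    let T : Module.End F U := a⁻¹ • (ι₂ (y ^ (p - 1)) * ι₁ w)
    refine finrank_le_of_semilinear_fixed (G := Unit) (τ := fun _ => (τ : L →+* L))
      (fun l hl => hτ.mem_range_of_fixed (hl ())) (T := fun _ => T.toAddMonoidHom)
      (fun _ l v => ?_) (fun _ v hv => ?_)
    · change T (l • v) = τ l • T v
      rw [← hL, ← hL, ← Module.End.mul_apply, ← Module.End.mul_apply]
      congr 1
      simp only [T, smul_mul_assoc, mul_smul_comm]
      rw [mul_assoc, ← map_mul, hwl, map_mul, ← mul_assoc, ← mul_assoc, hι]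
    · change T v = v
      have h1 : ι₁ w v = ι₂ y v := sub_eq_zero.1 hv
      simp only [T, LinearMap.smul_apply, Module.End.mul_apply]
      rw [h1, ← Module.End.mul_apply, ← map_mul, ← pow_succ, Nat.sub_add_cancel hp.one_le, ← hnM,
        hyn, AlgHom.commutes, Module.algebraMap_end_apply, inv_smul_smul₀ ha]
  -- the action of the new extension
  have htS : ∀ v ∈ S, t v ∈ S := by
    intro v hv
    rw [hSmem] at hv ⊢
    rw [← Module.End.mul_apply, hDt, LinearMap.add_apply, Module.End.mul_apply, hv, map_zero,
      add_zero]
  let tS : Module.End L' S :=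
    { toFun := fun v => ⟨t v, htS v v.2⟩
      map_add' := fun v w => Subtype.ext (map_add t _ _)
      map_smul' := fun l v => Subtype.ext (LinearMap.congr_fun (htj l) v) }
  have htSpow : ∀ (k : ℕ) (v : S), ((tS ^ k) v : U) = (t ^ k) v := by
    intro k v
    induction k with
    | zero => rfl
    | succ k ih => rw [pow_succ', pow_succ', Module.End.mul_apply, Module.End.mul_apply, ← ih]; rfl
  let P := artinSchreierPoly p (z + algebraMap F L' f)
  let L₃ := ArtinSchreierExt p (z + algebraMap F L' f)
  let Φ : L₃ →+* Module.End L' S :=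
    Ideal.Quotient.lift (Ideal.span {P}) (Polynomial.aeval tS).toRingHom (by
      intro g hg
      obtain ⟨g', rfl⟩ := Ideal.mem_span_singleton'.1 hg
      have h1 : Polynomial.aeval tS P = 0 := by
        simp only [P, map_sub, map_pow, Polynomial.aeval_X, Polynomial.aeval_C]
        refine LinearMap.ext fun v => Subtype.ext ?_
        have h2 := LinearMap.congr_fun htpow (v : U)
        rw [LinearMap.sub_apply] at h2
        rw [LinearMap.sub_apply, LinearMap.sub_apply, Module.algebraMap_end_apply]
        change ((tS ^ p) v : U) - t v - jL (z + algebraMap F L' f) v = 0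
        rw [htSpow, h2, sub_self]
      change Polynomial.aeval tS (g' * P) = 0
      rw [map_mul, h1, mul_zero])
  have hΦr : Φ (AdjoinRoot.root P) = tS := by
    refine (Ideal.Quotient.lift_mk _ _ _).trans ?_
    exact Polynomial.aeval_X tS
  have hΦC : ∀ l : L', Φ (algebraMap L' L₃ l) = algebraMap L' _ l := by
    intro l
    refine (Ideal.Quotient.lift_mk _ _ _).trans ?_
    exact Polynomial.aeval_C tS l
  have hind : ∀ Q : L₃ → Prop, (∀ l, Q (algebraMap L' L₃ l)) → Q (AdjoinRoot.root P) →
      (∀ l l', Q l → Q l' → Q (l + l')) → (∀ l l', Q l → Q l' → Q (l * l')) → ∀ l, Q l := by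
    intro Q h1 h2 h3 h4 l
    have hl : l ∈ Algebra.adjoin L' {AdjoinRoot.root P} := by
      rw [AdjoinRoot.adjoinRoot_eq_top]; trivial
    induction hl using Algebra.adjoin_induction with
    | mem l hl => rw [Set.mem_singleton_iff.1 hl]; exact h2
    | algebraMap l => exact h1 l
    | add l l' _ _ hl hl' => exact h3 _ _ hl hl'
    | mul l l' _ _ hl hl' => exact h4 _ _ hl hl'
  let _ : Module L₃ S := Module.compHom S Φ
  have hsm₃ : ∀ (l : L₃) (v : S), l • v = Φ l v := fun _ _ => rfl
  have : IsScalarTower L' L₃ S := ⟨fun l k v => by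
    rw [hsm₃, hsm₃, Algebra.smul_def, map_mul, hΦC]
    rfl⟩
  have : IsScalarTower F L₃ S := ⟨fun c k v => by
    rw [← algebraMap_smul L' c k, smul_assoc, algebraMap_smul]⟩
  have : FiniteDimensional L₃ S := Module.Finite.of_restrictScalars_finite L' L₃ S
  have hXS : ∀ v ∈ S.restrictScalars F, X v ∈ S.restrictScalars F := by
    intro v hv
    rw [Submodule.restrictScalars_mem, hSmem] at hv ⊢
    rw [← Module.End.mul_apply, hDX, Module.End.mul_apply, hv, map_zero]
  let XS : Module.End F S := X.restrict hXS
  have hXSpow : ∀ (k : ℕ) (v : S), ((XS ^ k) v : U) = (X ^ k) v := by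
    intro k v
    induction k with
    | zero => rfl
    | succ k ih => rw [pow_succ', pow_succ', Module.End.mul_apply, Module.End.mul_apply, ← ih]; rfl
  have hφS : ∀ s, ∀ v ∈ S, φ s v ∈ S := by
    intro s v hv
    rw [hSmem] at hv ⊢
    rw [← Module.End.mul_apply, (hφD s).eq, Module.End.mul_apply, hv, map_zero]
  let φS : A ⊗[F] B →ₐ[F] Module.End L₃ S :=
    { toFun := fun s =>
        { toFun := fun v => ⟨φ s v, hφS s v v.2⟩
          map_add' := fun v w => Subtype.ext (map_add _ _ _)
          map_smul' := fun l => by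
            revert l
            refine hind _ (fun l v => ?_) (fun v => ?_) (fun l l' hl hl' v => ?_)
              (fun l l' hl hl' v => ?_)
            · rw [RingHom.id_apply, algebraMap_smul, algebraMap_smul]
              exact Subtype.ext (LinearMap.congr_fun (hφj l s) v).symm
            · rw [RingHom.id_apply, hsm₃, hsm₃, hΦr]
              exact Subtype.ext (LinearMap.congr_fun (hφt s) v).symm
            · rw [RingHom.id_apply] at hl hl' ⊢
              rw [add_smul, add_smul, ← hl, ← hl']
              exact Subtype.ext (map_add (φ s) _ _)
            · rw [RingHom.id_apply] at hl hl' ⊢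
              rw [mul_smul, mul_smul, ← hl', ← hl] }
      map_one' := by
        refine LinearMap.ext fun v => Subtype.ext ?_
        change φ 1 v = v
        rw [map_one, Module.End.one_apply]
      map_mul' := fun s s' => by
        refine LinearMap.ext fun v => Subtype.ext ?_
        change φ (s * s') v = φ s (φ s' v)
        rw [map_mul, Module.End.mul_apply]
      map_zero' := by
        refine LinearMap.ext fun v => Subtype.ext ?_
        change φ 0 v = 0
        rw [map_zero, LinearMap.zero_apply]
      map_add' := fun s s' => by
        refine LinearMap.ext fun v => Subtype.ext ?_
        change φ (s + s') v = φ s v + φ s' v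
        rw [map_add, LinearMap.add_apply]
      commutes' := fun c => by
        refine LinearMap.ext fun v => Subtype.ext ?_
        change φ (algebraMap F _ c) v = c • (v : U)
        rw [AlgHom.commutes, Module.algebraMap_end_apply] }
  refine ⟨S, inferInstance, inferInstance, inferInstance, inferInstance, inferInstance, hSnt,
    φS, XS, ?_, fun s v => Subtype.ext (LinearMap.congr_fun (hφX s) v), ?_, ?_⟩
  · refine hind _ (fun l v => ?_) (fun v => ?_) (fun l l' hl hl' v => ?_)
      (fun l l' hl hl' v => ?_)
    · rw [hσ₃.compat, algebraMap_smul, algebraMap_smul]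
      exact Subtype.ext (LinearMap.congr_fun (hXj l) v)
    · rw [hσ₃.map_gen, add_smul, algebraMap_smul, hsm₃, hsm₃, hΦr]
      refine Subtype.ext ((LinearMap.congr_fun hXt v).trans ?_)
      rw [add_mul]
      rfl
    · rw [add_smul, map_add, map_add, add_smul, hl, hl']
    · rw [mul_smul, map_mul, mul_smul, hl, hl']
  · rw [hn₃]
    refine LinearMap.ext fun v => Subtype.ext ?_
    rw [hXSpow, hXpow]
    rfl
  · have h1 : Module.finrank L U = Module.finrank L V * Module.finrank F W :=
      Module.finrank_tensorProduct
    have h2 : Module.finrank F W = p * Module.finrank M W := by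
      rw [← hnM, Module.finrank_mul_finrank]
    have h3 : Module.finrank L' S = p * Module.finrank L₃ S := by
      have h := Module.finrank_mul_finrank L' L₃ S
      rw [hσ₃.finrank_eq] at h
      exact h.symm
    -- $\dim_L U$ contains the factor $\dim_F W=p\dim_M W$; passing from $L'$ to the new extension
    -- divides by the same $p$.
    have h4 : Module.finrank L₃ S ≤ Module.finrank L V * Module.finrank M W := by
      refine Nat.le_of_mul_le_mul_left ?_ hp.pos
      rw [← h3]
      refine hle.trans_eq ?_
      rw [h1, h2]
      ring
    calc Module.finrank L₃ S ^ 2 ≤ (Module.finrank L V * Module.finrank M W) ^ 2 :=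
          Nat.pow_le_pow_left h4 2
      _ = Module.finrank L V ^ 2 * Module.finrank M W ^ 2 := mul_pow _ _ _
      _ ≤ Module.finrank F A * Module.finrank F B := Nat.mul_le_mul hV hW
      _ = Module.finrank F (A ⊗[F] B) := Module.finrank_tensorProduct.symm

theorem CSA.brauerClass_cyclic_mul_artinSchreier {σ' : L' ≃ₐ[F] L'} (hσ' : IsCyclicGenerator σ')
    {z d : L'} (hd : ∑ k ∈ Finset.range (Module.finrank F L'), (σ' ^ k) d = 1)
    {σ : L ≃ₐ[F] L} {u : L} (hσ : IsArtinSchreierLift p σ' z d σ u)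
    {f : F} {σM : M ≃ₐ[F] M} {v : M}
    (hσM : IsArtinSchreierLift p (AlgEquiv.refl : F ≃ₐ[F] F) f 1 σM v)
    [Fact (Irreducible (artinSchreierPoly p (z + algebraMap F L' f)))]
    {σ₃ : ArtinSchreierExt p (z + algebraMap F L' f) ≃ₐ[F]
      ArtinSchreierExt p (z + algebraMap F L' f)}
    (hσ₃ : IsArtinSchreierLift p σ' (z + algebraMap F L' f) d σ₃ (AdjoinRoot.root _))
    {a : F} (ha : a ≠ 0) :
    (cyclic hσ.isCyclicGenerator ha).brauerClass * (cyclic hσM.isCyclicGenerator ha).brauerClass =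
      (cyclic hσ₃.isCyclicGenerator ha).brauerClass := by
  have h1 : (cyclic hσ.isCyclicGenerator ha).op.brauerClass *
      (cyclic hσ.isCyclicGenerator ha).brauerClass = 1 := by
    rw [mul_comm, brauerClass_mul_op]
  have h2 : (cyclic hσM.isCyclicGenerator ha).op.brauerClass *
      (cyclic hσM.isCyclicGenerator ha).brauerClass = 1 := by
    rw [mul_comm, brauerClass_mul_op]
  refine mul_eq_of_mul_eq_one h1 h2 ?_
  rw [← brauerClass_tensor, ← hasSemilinearRep_iff]
  exact HasSemilinearRep.artinSchreier hσ' hd hσ hσM hσ₃ ha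
    ((hasSemilinearRep_iff _ ha).2 h1) ((hasSemilinearRep_iff _ ha).2 h2)

end ArtinSchreierSum

/-! ### Finite Galois splitting fields -/

section GaloisSplitting

/-- A central simple algebra over a field is split by a finite Galois extension. -/
theorem exists_isGalois_isSplitOver (F A : Type u) [Field F] [Ring A] [Algebra F A]
    [Algebra.IsCentral F A] [IsSimpleRing A] [FiniteDimensional F A] :
    ∃ (L : Type u) (_ : Field L) (_ : Algebra F L), IsGalois F L ∧ FiniteDimensional F L ∧
      IsSplitOver F L A := by
  classical
  let Ω := SeparableClosure F
  let S := Ω ⊗[F] A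
  have hs : IsSimpleRing S := by
    have h1 : IsSimpleRing (A ⊗[F] Ω) := isSimpleRing_tensorProduct
    exact IsSimpleRing.of_ringEquiv (Algebra.TensorProduct.comm F A Ω).toRingEquiv h1
  have hc : Algebra.IsCentral Ω S := by
    refine ⟨fun x hx => ?_⟩
    rw [Subalgebra.mem_center_iff] at hx
    let e := Algebra.TensorProduct.comm F A Ω
    obtain ⟨k, hk⟩ := exists_eq_one_tmul_of_commute (e.symm x) fun a => by
      apply e.injective
      rw [map_mul, map_mul, e.apply_symm_apply, hx]
    refine Algebra.mem_bot.2 ⟨k, ?_⟩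
    rw [← e.apply_symm_apply x, hk]
    rfl
  have : IsArtinianRing S := IsArtinianRing.of_finite Ω S
  obtain ⟨n, hn, D, hD, hD', hfin, ⟨e⟩⟩ :=
    IsSimpleRing.exists_algEquiv_matrix_divisionRing_finite Ω S
  have h1 : Algebra.IsCentral Ω (D ⊗[Ω] Matrix (Fin n) (Fin n) Ω) :=
    Algebra.IsCentral.of_algEquiv Ω _ _ (e.trans (matrixEquivTensor (Fin n) Ω D))
  have h2 : Algebra.IsCentral Ω D :=
    Algebra.IsCentral.left_of_tensor_of_field Ω D (Matrix (Fin n) (Fin n) Ω)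
  -- By Jacobson–Noether a larger division algebra would contain a noncentral separable element,
  -- whose minimal polynomial is linear over a separably closed field.
  have hbot : (⊥ : Subalgebra Ω D) = ⊤ := by
    by_contra hne
    obtain ⟨x, hx, hsep⟩ := JacobsonNoether.exists_separable_and_not_isCentral' hne
    refine hx ?_
    have h3 := IsSepClosed.degree_eq_one_of_irreducible Ω
      (minpoly.irreducible (Algebra.IsIntegral.isIntegral (R := Ω) x)) hsep
    obtain ⟨k, hk⟩ := minpoly.degree_eq_one_iff.1 h3
    exact Algebra.mem_bot.2 ⟨k, hk⟩
  let eD : D ≃ₐ[Ω] Ω :=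
    (Subalgebra.topEquiv.symm.trans (Subalgebra.equivOfEq _ _ hbot.symm)).trans
      (Algebra.botEquiv Ω D)
  let E : S ≃ₐ[Ω] Matrix (Fin n) (Fin n) Ω := e.trans eD.mapMatrix
  have hdim : n ^ 2 = Module.finrank F A := by
    have h3 := E.toLinearEquiv.finrank_eq
    rw [Module.finrank_baseChange, Module.finrank_matrix] at h3
    rw [h3]
    simp [sq]
  let ρ : A →ₐ[F] Matrix (Fin n) (Fin n) Ω :=
    (E.toAlgHom.restrictScalars F).comp Algebra.TensorProduct.includeRight
  let b := Module.finBasis F A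
  -- The splitting is determined by the finitely many matrix entries of a basis; they generate a
  -- finite extension, and its normal closure inside the separable closure is Galois.
  let T : Set Ω := Set.range fun x : Fin (Module.finrank F A) × Fin n × Fin n =>
    ρ (b x.1) x.2.1 x.2.2
  let L₀ := IntermediateField.adjoin F T
  have hL₀ : FiniteDimensional F L₀ := by
    have : Finite T := Set.finite_range _
    exact IntermediateField.finiteDimensional_adjoin fun x _ => Algebra.IsIntegral.isIntegral x
  let L := IntermediateField.normalClosure F L₀ Ω
  have hmem : ∀ a i j, ρ a i j ∈ L := by
    intro a i j
    refine IntermediateField.le_normalClosure L₀ ?_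
    rw [← b.sum_repr a, map_sum, Matrix.sum_apply]
    refine sum_mem fun k _ => ?_
    rw [map_smul, Matrix.smul_apply]
    exact L₀.smul_mem (IntermediateField.subset_adjoin F T ⟨(k, i, j), rfl⟩)
  refine ⟨L, inferInstance, inferInstance, inferInstance, inferInstance, n, NeZero.ne n, hdim,
    ⟨{ toFun := fun a => Matrix.of fun i j => ⟨ρ a i j, hmem a i j⟩
       map_one' := ?_
       map_mul' := fun a a' => ?_
       map_zero' := ?_
       map_add' := fun a a' => ?_
       commutes' := fun c => ?_ }⟩⟩
  · ext i j
    simp [Matrix.one_apply, apply_ite]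
  · ext i j
    simp [Matrix.mul_apply]
  · ext i j
    simp
  · ext i j
    simp
  · ext i j
    by_cases hij : i = j
    · simp [Matrix.algebraMap_matrix_apply, hij]
    · simp [Matrix.algebraMap_matrix_apply, hij]

end GaloisSplitting

/-! ### Factor systems of Galois splittings -/

section SplittingCocycle

variable {F L : Type u} [Field F] [Field L] [Algebra F L] {A : Type u} [Ring A] [Algebra F A]
  {ι : Type} [Fintype ι] [DecidableEq ι]

/-- The isomorphism `L ⊗ A ≅ M_n(L)` attached to a splitting. -/
theorem bijective_liftEquiv_of_card [Nonempty ι] [Algebra.IsCentral F A] [IsSimpleRing A]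
    [FiniteDimensional F A] (ρ : A →ₐ[F] Matrix ι ι L)
    (h : Fintype.card ι ^ 2 = Module.finrank F A) :
    Function.Bijective (AlgHom.liftEquiv F L A (Matrix ι ι L) ρ) := by
  have hs : IsSimpleRing (L ⊗[F] A) := by
    have h1 : IsSimpleRing (A ⊗[F] L) := isSimpleRing_tensorProduct
    exact IsSimpleRing.of_ringEquiv (Algebra.TensorProduct.comm F A L).toRingEquiv h1
  have hi : Function.Injective (AlgHom.liftEquiv F L A (Matrix ι ι L) ρ) :=
    (AlgHom.liftEquiv F L A (Matrix ι ι L) ρ).toRingHom.injective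
  refine ⟨hi, (LinearMap.injective_iff_surjective_of_finrank_eq_finrank
    (f := (AlgHom.liftEquiv F L A (Matrix ι ι L) ρ).toLinearMap) ?_).1 hi⟩
  rw [Module.finrank_baseChange, ← h, Module.finrank_matrix]
  simp [sq]

/-- The image of $A$ spans the whole matrix algebra over $L$, so a matrix commuting with it is
central. -/
theorem exists_eq_smul_one_of_commute [Nonempty ι] [Algebra.IsCentral F A] [IsSimpleRing A]
    [FiniteDimensional F A] (ρ : A →ₐ[F] Matrix ι ι L)
    (h : Fintype.card ι ^ 2 = Module.finrank F A) {M : Matrix ι ι L}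
    (hM : ∀ a, M * ρ a = ρ a * M) : ∃ l : L, M = l • (1 : Matrix ι ι L) := by
  have h1 : M ∈ Subalgebra.center L (Matrix ι ι L) := by
    rw [Subalgebra.mem_center_iff]
    intro N
    obtain ⟨x, rfl⟩ := (bijective_liftEquiv_of_card ρ h).2 N
    induction x using TensorProduct.induction_on with
    | zero => simp
    | tmul l a => rw [AlgHom.liftEquiv_tmul, smul_mul_assoc, mul_smul_comm, hM]
    | add x y hx hy => rw [map_add, add_mul, mul_add, hx, hy]
  obtain ⟨l, hl⟩ := Algebra.mem_bot.1 (Algebra.IsCentral.out h1)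
  exact ⟨l, by rw [← hl, Algebra.algebraMap_eq_smul_one]⟩

/-- Two splittings of the same degree are conjugate. -/
theorem exists_intertwiner [Nonempty ι] [Algebra.IsCentral F A] [IsSimpleRing A]
    [FiniteDimensional F A] (ρ θ : A →ₐ[F] Matrix ι ι L)
    (h : Fintype.card ι ^ 2 = Module.finrank F A) :
    ∃ P Q : Matrix ι ι L, P * Q = 1 ∧ ∀ a, P * θ a = ρ a * P := by
  let e₁ := AlgEquiv.ofBijective _ (bijective_liftEquiv_of_card ρ h)
  let e₂ := AlgEquiv.ofBijective _ (bijective_liftEquiv_of_card θ h)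
  -- Skolem–Noether for matrix algebras: the automorphism comparing the two splittings is a
  -- conjugation.
  obtain ⟨T, hT⟩ := ((Matrix.toLinAlgEquiv' (R := L) (n := ι)).symm.trans
    ((e₂.symm.trans e₁).trans Matrix.toLinAlgEquiv')).eq_linearEquivConjAlgEquiv
  refine ⟨LinearMap.toMatrix' (T : (ι → L) →ₗ[L] (ι → L)),
    LinearMap.toMatrix' (T.symm : (ι → L) →ₗ[L] (ι → L)), ?_, fun a => ?_⟩
  · rw [← LinearMap.toMatrix'_comp]
    simp
  · have h1 := AlgEquiv.congr_fun hT (Matrix.toLinAlgEquiv' (θ a))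
    have h2 : (e₂.symm.trans e₁) (θ a) = ρ a := by
      have h3 : e₂ (1 ⊗ₜ a) = θ a := by
        change (1 : L) • θ a = θ a
        rw [one_smul]
      have h4 : e₁ (1 ⊗ₜ a) = ρ a := by
        change (1 : L) • ρ a = ρ a
        rw [one_smul]
      rw [← h3, AlgEquiv.trans_apply, e₂.symm_apply_apply, h4]
    have h5 : Matrix.toLin' (ρ a) = (T : (ι → L) →ₗ[L] (ι → L)) ∘ₗ Matrix.toLin' (θ a) ∘ₗ
        (T.symm : (ι → L) →ₗ[L] (ι → L)) := by
      rw [← h2]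
      rw [AlgEquiv.trans_apply, AlgEquiv.symm_apply_apply] at h1
      exact h1
    apply (Matrix.toLin' (R := L) (n := ι) (m := ι)).injective
    rw [Matrix.toLin'_mul, Matrix.toLin'_mul, h5, Matrix.toLin'_toMatrix']
    ext v
    simp

/-- `c` is the factor system of a splitting of `A` by the Galois extension `L`. -/
def HasSplittingCocycle (c : (L ≃ₐ[F] L) → (L ≃ₐ[F] L) → L) (A : Type u) [Ring A] [Algebra F A] :
    Prop :=
  ∃ (ι : Type) (_ : Fintype ι) (_ : DecidableEq ι) (_ : Nonempty ι) (ρ : A →ₐ[F] Matrix ι ι L)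
    (P Q : (L ≃ₐ[F] L) → Matrix ι ι L), Fintype.card ι ^ 2 = Module.finrank F A ∧
    (∀ s, P s * Q s = 1) ∧ (∀ s a, P s * s.mapMatrix (ρ a) = ρ a * P s) ∧
    ∀ s t, P s * s.mapMatrix (P t) = c s t • P (s * t)

/-- Conjugating a splitting by $s$ gives another one, intertwined with it by $P_s$. The matrices
$P_s\,s(P_t)$ and $P_{st}$ intertwine the same two splittings and so differ by a scalar. The cocycle
identity itself is never needed. -/
theorem IsSplitOver.exists_hasSplittingCocycle [Algebra.IsCentral F A] [IsSimpleRing A]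
    [FiniteDimensional F A] (h : IsSplitOver F L A) :
    ∃ c : (L ≃ₐ[F] L) → (L ≃ₐ[F] L) → L, HasSplittingCocycle c A := by
  obtain ⟨n, hn, hd, ⟨ρ⟩⟩ := h
  have : Nonempty (Fin n) := ⟨⟨0, Nat.pos_of_ne_zero hn⟩⟩
  have hd' : Fintype.card (Fin n) ^ 2 = Module.finrank F A := by rw [Fintype.card_fin, hd]
  choose P Q hPQ hP using fun s : L ≃ₐ[F] L =>
    exists_intertwiner ρ (s.mapMatrix.toAlgHom.comp ρ) hd'
  have hP' : ∀ (s : L ≃ₐ[F] L) a, P s * s.mapMatrix (ρ a) = ρ a * P s := hP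
  have hQP : ∀ s, Q s * P s = 1 := fun s => mul_eq_one_comm.1 (hPQ s)
  have hQ : ∀ s a, Q s * ρ a = s.mapMatrix (ρ a) * Q s := by
    intro s a
    calc Q s * ρ a = Q s * (ρ a * P s) * Q s := by rw [mul_assoc, mul_assoc, hPQ, mul_one]
      _ = s.mapMatrix (ρ a) * Q s := by rw [← hP', ← mul_assoc, hQP, one_mul]
  have key : ∀ s t, ∃ c : L, P s * s.mapMatrix (P t) * Q (s * t) = c • 1 := by
    intro s t
    refine exists_eq_smul_one_of_commute ρ hd' fun a => ?_
    calc P s * s.mapMatrix (P t) * Q (s * t) * ρ a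
        = P s * s.mapMatrix (P t) * (s.mapMatrix (t.mapMatrix (ρ a)) * Q (s * t)) := by
          rw [mul_assoc _ (Q (s * t)), hQ]; rfl
      _ = P s * (s.mapMatrix (P t) * s.mapMatrix (t.mapMatrix (ρ a))) * Q (s * t) := by
          simp only [mul_assoc]
      _ = P s * s.mapMatrix (ρ a) * s.mapMatrix (P t) * Q (s * t) := by
          rw [← map_mul, hP', map_mul]
          simp only [mul_assoc]
      _ = ρ a * (P s * s.mapMatrix (P t) * Q (s * t)) := by
          rw [hP']
          simp only [mul_assoc]
  choose c hc using key
  refine ⟨c, Fin n, inferInstance, inferInstance, this, ρ, P, Q, hd', hPQ, hP', fun s t => ?_⟩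
  have h1 := congrArg (· * P (s * t)) (hc s t)
  simpa only [mul_assoc, hQP, mul_one, smul_mul_assoc, one_mul] using h1

open Kronecker in
theorem HasSplittingCocycle.tensor {B : Type u} [Ring B] [Algebra F B]
    {c d : (L ≃ₐ[F] L) → (L ≃ₐ[F] L) → L} (hA : HasSplittingCocycle c A)
    (hB : HasSplittingCocycle d B) :
    HasSplittingCocycle (fun s t => c s t * d s t) (A ⊗[F] B) := by
  obtain ⟨ι, _, _, _, ρ, P, Q, hd, hPQ, hP, hPP⟩ := hA
  obtain ⟨κ, _, _, _, θ, R, S, he, hRS, hR, hRR⟩ := hB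
  let f : A →ₐ[F] Matrix (ι × κ) (ι × κ) L :=
    (((Matrix.kroneckerAlgEquiv ι κ L).toAlgHom.comp
      Algebra.TensorProduct.includeLeft).restrictScalars F).comp ρ
  let g : B →ₐ[F] Matrix (ι × κ) (ι × κ) L :=
    (((Matrix.kroneckerAlgEquiv ι κ L).toAlgHom.comp
      Algebra.TensorProduct.includeRight).restrictScalars F).comp θ
  have hf : ∀ a, f a = ρ a ⊗ₖ (1 : Matrix κ κ L) := fun a => rfl
  have hg : ∀ b, g b = (1 : Matrix ι ι L) ⊗ₖ θ b := fun b => rfl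
  have hmap : ∀ (s : L ≃ₐ[F] L) (M : Matrix ι ι L) (N : Matrix κ κ L),
      s.mapMatrix (M ⊗ₖ N) = s.mapMatrix M ⊗ₖ s.mapMatrix N := by
    intro s M N
    ext i j
    simp
  let φ : A ⊗[F] B →ₐ[F] Matrix (ι × κ) (ι × κ) L := Algebra.TensorProduct.lift f g fun a b => by
    rw [Commute, SemiconjBy, hf, hg, ← Matrix.mul_kronecker_mul, ← Matrix.mul_kronecker_mul]
    simp only [one_mul, mul_one]
  have hφ : ∀ a b, φ (a ⊗ₜ b) = ρ a ⊗ₖ θ b := by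
    intro a b
    rw [Algebra.TensorProduct.lift_tmul, hf, hg, ← Matrix.mul_kronecker_mul, mul_one, one_mul]
  refine ⟨ι × κ, inferInstance, inferInstance, inferInstance, φ, fun s => P s ⊗ₖ R s,
    fun s => Q s ⊗ₖ S s, ?_, fun s => ?_, fun s x => ?_, fun s t => ?_⟩
  · rw [Fintype.card_prod, mul_pow, hd, he, Module.finrank_tensorProduct]
  · rw [← Matrix.mul_kronecker_mul, hPQ, hRS, Matrix.one_kronecker_one]
  · induction x using TensorProduct.induction_on with
    | zero => simp
    | tmul a b =>
      rw [hφ, hmap, ← Matrix.mul_kronecker_mul, ← Matrix.mul_kronecker_mul, hP, hR]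
    | add x y hx hy => rw [map_add, map_add, mul_add, add_mul, hx, hy]
  · rw [hmap, ← Matrix.mul_kronecker_mul, hPP, hRR, Matrix.smul_kronecker, Matrix.kronecker_smul,
      smul_smul]

/-- A splitting over $F$ is Galois invariant. Let $Q$ intertwine it with the given one: then
$Q^{-1}P_s\,s(Q)$ commutes with the invariant splitting, and is the required scalar $b_s$. -/
theorem HasSplittingCocycle.exists_coboundary [Algebra.IsCentral F A] [IsSimpleRing A]
    [FiniteDimensional F A] {c : (L ≃ₐ[F] L) → (L ≃ₐ[F] L) → L} (hA : HasSplittingCocycle c A)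
    (h : IsSplitOver F F A) :
    ∃ b : (L ≃ₐ[F] L) → L, (∀ s, b s ≠ 0) ∧ ∀ s t, b s * s (b t) = c s t * b (s * t) := by
  obtain ⟨ι, _, _, _, ρ, P, P', hd, hPP', hP, hPP⟩ := hA
  obtain ⟨n, hn, hd', ⟨θ₀⟩⟩ := h
  have hcard : Fintype.card ι = n := by
    rw [← hd] at hd'
    exact (Nat.pow_left_injective two_ne_zero hd').symm
  let e : Fin n ≃ ι := (Fintype.equivFinOfCardEq hcard).symm
  let θ : A →ₐ[F] Matrix ι ι L := ((Algebra.ofId F L).mapMatrix.comp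
    (Matrix.reindexAlgEquiv F F e).toAlgHom).comp θ₀
  have hθ : ∀ (s : L ≃ₐ[F] L) a, s.mapMatrix (θ a) = θ a := by
    intro s a
    ext i j
    exact s.commutes _
  obtain ⟨Q, R, hQR, hQ⟩ := exists_intertwiner ρ θ hd
  have hRQ : R * Q = 1 := mul_eq_one_comm.1 hQR
  have hR : ∀ a, R * ρ a = θ a * R := by
    intro a
    calc R * ρ a = R * (ρ a * Q) * R := by rw [mul_assoc, mul_assoc, hQR, mul_one]
      _ = θ a * R := by rw [← hQ, ← mul_assoc, hRQ, one_mul]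
  have key : ∀ s : L ≃ₐ[F] L, ∃ b : L, R * P s * s.mapMatrix Q = b • 1 := by
    intro s
    refine exists_eq_smul_one_of_commute θ hd fun a => ?_
    calc R * P s * s.mapMatrix Q * θ a = R * P s * s.mapMatrix (ρ a * Q) := by
          rw [← hQ, map_mul, hθ, mul_assoc]
      _ = R * (P s * s.mapMatrix (ρ a)) * s.mapMatrix Q := by
          rw [map_mul]
          simp only [mul_assoc]
      _ = R * ρ a * P s * s.mapMatrix Q := by
          rw [hP]
          simp only [mul_assoc]
      _ = θ a * (R * P s * s.mapMatrix Q) := by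
          rw [hR]
          simp only [mul_assoc]
  choose b hb using key
  have hmapsmul : ∀ (s : L ≃ₐ[F] L) (l : L), s.mapMatrix (l • (1 : Matrix ι ι L)) = s l • 1 := by
    intro s l
    ext i j
    by_cases hij : i = j
    · simp [hij]
    · simp [hij]
  have hinj : Function.Injective fun l : L => l • (1 : Matrix ι ι L) := fun l l' hl => by
    have i : ι := Classical.arbitrary ι
    simpa using congrFun (congrFun hl i) i
  refine ⟨b, fun s h0 => ?_, fun s t => hinj ?_⟩
  · have h1 := hb s
    rw [h0, zero_smul] at h1
    have h2 : R * P s * s.mapMatrix Q * (s.mapMatrix R * P' s * Q) = 1 := by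
      calc R * P s * s.mapMatrix Q * (s.mapMatrix R * P' s * Q)
          = R * P s * (s.mapMatrix Q * s.mapMatrix R) * P' s * Q := by simp only [mul_assoc]
        _ = 1 := by
          rw [← map_mul, hQR, map_one, mul_one, mul_assoc R, hPP', mul_one, hRQ]
    rw [h1, zero_mul] at h2
    exact zero_ne_one h2
  · change (b s * s (b t)) • (1 : Matrix ι ι L) = (c s t * b (s * t)) • 1
    calc (b s * s (b t)) • (1 : Matrix ι ι L) = (b s • 1) * s.mapMatrix (b t • 1) := by
          rw [hmapsmul, smul_mul_smul_comm, one_mul]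
      _ = R * P s * (s.mapMatrix Q * s.mapMatrix R) * s.mapMatrix (P t) *
          s.mapMatrix (t.mapMatrix Q) := by
          rw [← hb, ← hb, map_mul, map_mul]
          simp only [mul_assoc]
      _ = R * (P s * s.mapMatrix (P t)) * (s * t).mapMatrix Q := by
          rw [← map_mul, hQR, map_one, mul_one]
          simp only [mul_assoc]
          rfl
      _ = (c s t * b (s * t)) • 1 := by
          rw [hPP, mul_smul_comm, smul_mul_assoc, hb, smul_smul]

end SplittingCocycle

/-! ### Algebras of exponent $p$ are split by $F^{1/p}$ -/

section FrobeniusSplitting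

/-- `F`, regarded as an extension of `F` through the Frobenius map; in other words `F^{1/p}`. -/
def FrobeniusRoot (F : Type u) (_p : ℕ) : Type u := F

variable {F : Type u} [Field F] (p : ℕ)

instance : Field (FrobeniusRoot F p) := inferInstanceAs (Field F)

noncomputable instance [ExpChar F p] : Algebra F (FrobeniusRoot F p) := (frobenius F p).toAlgebra

/-- The identification of `F^{1/p}` with `F`. -/
def FrobeniusRoot.toBase : FrobeniusRoot F p ≃+* F := RingEquiv.refl F

theorem FrobeniusRoot.pow_eq [ExpChar F p] (x : FrobeniusRoot F p) :
    x ^ p = algebraMap F (FrobeniusRoot F p) (FrobeniusRoot.toBase p x) := rfl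

/-- If the `p`-th power of the factor system of a splitting of `A` is a coboundary, then `A` is
split by `F^{1/p}`. -/
theorem HasSplittingCocycle.isSplitOver_frobeniusRoot [hp : Fact p.Prime] [CharP F p]
    [FiniteDimensional F (FrobeniusRoot F p)] {L : Type u} [Field L] [Algebra F L] [IsGalois F L]
    [FiniteDimensional F L] {A : Type u} [Ring A] [Algebra F A] [Algebra.IsCentral F A]
    [IsSimpleRing A] [FiniteDimensional F A] {c : (L ≃ₐ[F] L) → (L ≃ₐ[F] L) → L}
    (hA : HasSplittingCocycle c A) {b : (L ≃ₐ[F] L) → L} (hb : ∀ s, b s ≠ 0)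
    (hbc : ∀ s t, b s * s (b t) = c s t ^ p * b (s * t)) :
    IsSplitOver F (FrobeniusRoot F p) A := by
  classical
  obtain ⟨ι, _, _, _, ρ, P, Q, hd, hPQ, hP, hPP⟩ := hA
  have : CharP L p := charP_of_injective_algebraMap (algebraMap F L).injective p
  let Φ : Matrix ι ι L →+* Matrix ι ι L := (frobenius L p).mapMatrix
  have hΦ : ∀ (s : L ≃ₐ[F] L) M, s.mapMatrix (Φ M) = Φ (s.mapMatrix M) := by
    intro s M
    ext i j
    simp [Φ, frobenius_def]
  have hΦs : ∀ (l : L) M, Φ (l • M) = l ^ p • Φ M := by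
    intro l M
    ext i j
    simp [Φ, frobenius_def, mul_pow]
  -- Frobenius turns the factor system of the $P_s$ into its $p$-th power, the coboundary of $b$;
  -- dividing by $b_s$ gives a genuine semilinear action of the Galois group.
  let X : (L ≃ₐ[F] L) → (ι → L) →+ (ι → L) := fun s =>
    { toFun := fun v => (b s)⁻¹ • (Φ (P s)).mulVec (s ∘ v)
      map_zero' := by
        have h : s ∘ (0 : ι → L) = 0 := by ext i; simp
        rw [h, Matrix.mulVec_zero, smul_zero]
      map_add' := fun v w => by
        have h : s ∘ (v + w) = s ∘ v + s ∘ w := by ext i; simp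
        rw [h, Matrix.mulVec_add, smul_add] }
  have hXdef : ∀ s v, X s v = (b s)⁻¹ • (Φ (P s)).mulVec (s ∘ v) := fun _ _ => rfl
  have hsmul : ∀ (s : L ≃ₐ[F] L) (l : L) (v : ι → L), s ∘ (l • v) = s l • (s ∘ v) := by
    intro s l v
    ext i
    simp
  have hmulVec : ∀ (s : L ≃ₐ[F] L) (M : Matrix ι ι L) (v : ι → L),
      s ∘ (M.mulVec v) = (s.mapMatrix M).mulVec (s ∘ v) := by
    intro s M v
    ext i
    simp [Matrix.mulVec, dotProduct]
  have hXs : ∀ s (l : L) v, X s (l • v) = s l • X s v := by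
    intro s l v
    rw [hXdef, hXdef, hsmul, Matrix.mulVec_smul, smul_comm]
  have hXX : ∀ s t v, X s (X t v) = X (s * t) v := by
    intro s t v
    rw [hXdef, hXdef, hXdef, hsmul, hmulVec, Matrix.mulVec_smul, Matrix.mulVec_mulVec, smul_smul,
      hΦ, ← map_mul, hPP, hΦs, Matrix.smul_mulVec, smul_smul]
    have h1 : c s t ^ p ≠ 0 := by
      intro h0
      have h2 := hbc s t
      rw [h0, zero_mul] at h2
      exact mul_ne_zero (hb s) ((map_ne_zero s).2 (hb t)) h2
    have h2 : (b s)⁻¹ * s (b t)⁻¹ * c s t ^ p = (b (s * t))⁻¹ := by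
      rw [map_inv₀, ← mul_inv, hbc, mul_inv, mul_right_comm, inv_mul_cancel₀ h1, one_mul]
    rw [h2]
    rfl
  let W : Submodule F (ι → L) :=
    { carrier := {v | ∀ s, X s v = v}
      zero_mem' := fun s => map_zero _
      add_mem' := fun {v w} hv hw s => by rw [map_add, hv s, hw s]
      smul_mem' := fun r v hv s => by
        rw [← algebraMap_smul L r v, hXs, AlgEquiv.commutes, hv s] }
  have hle : Module.finrank F W ≤ Fintype.card ι := by
    rw [← Module.finrank_fintype_fun_eq_card L]
    refine finrank_le_of_semilinear_fixed (τ := fun s : L ≃ₐ[F] L => (s : L →+* L))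
      (fun l hl => ?_) (T := X) hXs (fun s w hw => hw s)
    exact IntermediateField.mem_bot.1 ((IsGalois.mem_bot_iff_fixed l).2 hl)
  have hnt : Nontrivial W := by
    rw [Submodule.nontrivial_iff_ne_bot, Submodule.ne_bot_iff]
    have i : ι := Classical.arbitrary ι
    let v := (Φ (Q 1)).mulVec (Pi.single i 1)
    have hv : X 1 v i ≠ 0 := by
      have h1 : X 1 v = (b 1)⁻¹ • Pi.single i 1 := by
        rw [hXdef]
        change (b 1)⁻¹ • (Φ (P 1)).mulVec v = _
        rw [Matrix.mulVec_mulVec, ← map_mul, hPQ, map_one, Matrix.one_mulVec]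
      rw [h1]
      simpa using hb 1
    -- Averaging over the group produces fixed vectors. The average of $l\cdot v$ is nonzero for
    -- some $l$ by independence of characters, as the term of the identity has a nonzero coordinate.
    obtain ⟨l, hl⟩ : ∃ l : L, ∑ s : L ≃ₐ[F] L, X s (l • v) ≠ 0 := by
      by_contra! h
      have hinj : Function.Injective fun s : L ≃ₐ[F] L => ((s : L →+* L) : L →* L) := by
        intro s t hst
        ext l
        exact DFunLike.congr_fun hst l
      have h1 := Fintype.linearIndependent_iff.1 ((linearIndependent_monoidHom L L).comp _ hinj)
        (fun s => X s v i) (by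
          ext l
          have h2 := congrFun (h l) i
          rw [Finset.sum_apply] at h2 ⊢
          refine Eq.trans (Finset.sum_congr rfl fun s _ => ?_) h2
          rw [hXs]
          exact mul_comm _ _) 1
      exact hv h1
    refine ⟨_, fun s => ?_, hl⟩
    rw [map_sum]
    simp only [hXX]
    exact Fintype.sum_equiv (Equiv.mulLeft s) _ _ fun t => rfl
  have hAW : ∀ a, ∀ v ∈ W, (Φ (ρ a)).mulVec v ∈ W := by
    intro a v hv s
    rw [hXdef, hmulVec, Matrix.mulVec_mulVec, hΦ, ← map_mul, hP, map_mul, ← Matrix.mulVec_mulVec,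
      ← Matrix.mulVec_smul, ← hXdef, hv s]
  let θ : A →+* Module.End F W :=
    { toFun := fun a => (((Φ (ρ a)).mulVecLin).restrictScalars F).restrict (hAW a)
      map_one' := by
        refine LinearMap.ext fun v => Subtype.ext ?_
        change (Φ (ρ 1)).mulVec v = v
        rw [map_one, map_one, Matrix.one_mulVec]
      map_mul' := fun a a' => by
        refine LinearMap.ext fun v => Subtype.ext ?_
        change (Φ (ρ (a * a'))).mulVec v = (Φ (ρ a)).mulVec ((Φ (ρ a')).mulVec v)
        rw [map_mul, map_mul, Matrix.mulVec_mulVec]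
      map_zero' := by
        refine LinearMap.ext fun v => Subtype.ext ?_
        change (Φ (ρ 0)).mulVec v = 0
        rw [map_zero, map_zero, Matrix.zero_mulVec]
      map_add' := fun a a' => by
        refine LinearMap.ext fun v => Subtype.ext ?_
        change (Φ (ρ (a + a'))).mulVec v = (Φ (ρ a)).mulVec v + (Φ (ρ a')).mulVec v
        rw [map_add, map_add, Matrix.add_mulVec] }
  -- The action on the fixed space is $F$-linear only along Frobenius: $r$ acts as $r^p$. Reading
  -- the matrices over $F^{1/p}$ makes it an honest homomorphism of $F$-algebras.
  have hθ : ∀ r : F, θ (algebraMap F A r) = algebraMap F (Module.End F W) (r ^ p) := by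
    intro r
    refine LinearMap.ext fun v => Subtype.ext ?_
    change (Φ (ρ (algebraMap F A r))).mulVec v = r ^ p • (v : ι → L)
    rw [AlgHom.commutes, IsScalarTower.algebraMap_apply F L, Algebra.algebraMap_eq_smul_one, hΦs,
      map_one, Matrix.smul_mulVec, Matrix.one_mulVec, ← map_pow, algebraMap_smul]
  have : Module.Finite F W := inferInstance
  let d := Module.finrank F W
  let K := FrobeniusRoot F p
  let β : A →+* Matrix (Fin d) (Fin d) K :=
    (LinearMap.toMatrixAlgEquiv (Module.finBasis F W)).toRingEquiv.toRingHom.comp θ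
  let γ : A →ₐ[F] Matrix (Fin d) (Fin d) K :=
    { β with
      commutes' := fun r => by
        change LinearMap.toMatrixAlgEquiv (Module.finBasis F W) (θ (algebraMap F A r)) = _
        rw [hθ, AlgEquiv.commutes]
        rfl }
  have hdpos : 0 < d := Module.finrank_pos
  have : Nonempty (Fin d) := ⟨⟨0, hdpos⟩⟩
  refine isSplitOver_of_algHom_end (V := Fin d → K)
    ((Matrix.toLinAlgEquiv' (R := K) (n := Fin d)).toAlgHom.restrictScalars F |>.comp γ) ?_
  rw [Module.finrank_fintype_fun_eq_card, Fintype.card_fin, ← hd]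
  exact Nat.pow_le_pow_left hle 2

theorem CSA.exists_brauerClass_pow_hasSplittingCocycle {L : Type u} [Field L] [Algebra F L]
    {A : CSA.{u, u} F} {c : (L ≃ₐ[F] L) → (L ≃ₐ[F] L) → L} (hA : HasSplittingCocycle c A) (k : ℕ) :
    ∃ B : CSA.{u, u} F, B.brauerClass = A.brauerClass ^ (k + 1) ∧
      HasSplittingCocycle (fun s t => c s t ^ (k + 1)) B := by
  induction k with
  | zero => exact ⟨A, by simp, by simpa using hA⟩
  | succ k ih =>
    obtain ⟨B, hB, hc⟩ := ih
    exact ⟨B.tensor A, by rw [brauerClass_tensor, hB, ← pow_succ], by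
      have h := hc.tensor hA
      simp only [← pow_succ] at h
      exact h⟩

/-- A central simple algebra of exponent dividing `p` is split by `F^{1/p}`. -/
theorem CSA.isSplitOver_frobeniusRoot [hp : Fact p.Prime] [CharP F p]
    [FiniteDimensional F (FrobeniusRoot F p)] (A : CSA.{u, u} F) (h : A.brauerClass ^ p = 1) :
    IsSplitOver F (FrobeniusRoot F p) A := by
  obtain ⟨L, _, _, _, _, hL⟩ := exists_isGalois_isSplitOver F A
  obtain ⟨c, hc⟩ := hL.exists_hasSplittingCocycle
  obtain ⟨B, hB, hcB⟩ := exists_brauerClass_pow_hasSplittingCocycle hc (p - 1)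
  rw [Nat.sub_add_cancel hp.out.one_le] at hB hcB
  obtain ⟨b, hb, hbc⟩ := hcB.exists_coboundary (brauerClass_eq_one_iff.1 (hB.trans h))
  exact hc.isSplitOver_frobeniusRoot p hb hbc

end FrobeniusSplitting

/-! ### Eigenvalues in the prime field -/

section AdditiveOperators

/-- An operator with `w ^ p = w` has an eigenvector with eigenvalue in the prime field. -/
theorem exists_natCast_eigenvector {E V : Type*} [Field E] [AddCommGroup V] [Module E V]
    [FiniteDimensional E V] [Nontrivial V] (p : ℕ) [Fact p.Prime] [CharP E p] {w : Module.End E V}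
    (hw : w ^ p = w) : ∃ (n : ℕ) (v : V), v ≠ 0 ∧ w v = (n : E) • v := by
  have h1 : ((Polynomial.X ^ p - Polynomial.X : Polynomial (⊥ : Subfield E)).map
      (algebraMap _ E)).Splits := (Subfield.splits_bot E p).map _
  have h2 : minpoly E w ∣ (Polynomial.X ^ p - Polynomial.X : Polynomial (⊥ : Subfield E)).map
      (algebraMap _ E) := by
    refine minpoly.dvd E w ?_
    simp [hw]
  have hp := (Fact.out : p.Prime)
  have h0 : (Polynomial.X ^ p - Polynomial.X : Polynomial (⊥ : Subfield E)).map
      (algebraMap _ E) ≠ 0 := by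
    rw [Polynomial.map_ne_zero_iff (algebraMap (⊥ : Subfield E) E).injective]
    exact FiniteField.X_pow_card_sub_X_ne_zero _ hp.one_lt
  have hint : IsIntegral E w := Algebra.IsIntegral.isIntegral w
  obtain ⟨r, hr⟩ := (h1.of_dvd h0 h2).exists_eval_eq_zero (minpoly.degree_pos hint).ne'
  obtain ⟨v, hv⟩ := (Module.End.hasEigenvalue_of_isRoot hr).exists_hasEigenvector
  have h3 : r ^ p = r := by
    have h4 : (Polynomial.X ^ p - Polynomial.X : Polynomial E).eval r = 0 := by
      have h5 : (Polynomial.X ^ p - Polynomial.X : Polynomial (⊥ : Subfield E)).map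
        (algebraMap _ E) = Polynomial.X ^ p - Polynomial.X := by simp
      rw [h5] at h2
      exact Polynomial.eval_eq_zero_of_dvd_of_eval_eq_zero h2 hr
    simpa [sub_eq_zero] using h4
  obtain ⟨n, hn⟩ := exists_natCast_of_pow_eq_self p h3
  exact ⟨n, v, hv.2, by rw [hn]; exact hv.apply_eq_smul⟩

end AdditiveOperators

/-! ### Lifting derivations to representation spaces -/

section Connection

variable {F E K : Type u} [Field F] [Field E] [Field K] [Algebra F E] [Algebra E K] [Algebra F K]
  [IsScalarTower F E K] {A : Type u} [Ring A] [Algebra F A] [Algebra.IsCentral F A]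
  [IsSimpleRing A] [FiniteDimensional F A] {ι : Type} [Fintype ι] [DecidableEq ι] [Nonempty ι]

/-- A derivation of a splitting field lifts to the representation space. -/
theorem exists_connection (ρ : A →ₐ[F] Matrix ι ι K)
    (hd : Fintype.card ι ^ 2 = Module.finrank F A) (δ : Derivation E K K) :
    ∃ D : Module.End E (ι → K), (∀ (k : K) v, D (k • v) = δ k • v + k • D v) ∧
      ∀ a v, D ((ρ a).mulVec v) = (ρ a).mulVec (D v) := by
  let Φ : K ⊗[F] A ≃ₐ[K] Matrix ι ι K := AlgEquiv.ofBijective _ (bijective_liftEquiv_of_card ρ hd)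
  have hΦ : ∀ a, Φ (1 ⊗ₜ a) = ρ a := fun a => one_smul K (ρ a)
  -- The derivation is applied to the first factor of $K\otimes A\cong M_n(K)$, where it commutes
  -- with multiplication by $A$.
  let δ' : K ⊗[F] A →ₗ[E] K ⊗[F] A :=
    TensorProduct.AlgebraTensorModule.map (δ : K →ₗ[E] K) LinearMap.id
  have hδ'k : ∀ (k : K) s, δ' (k • s) = δ k • s + k • δ' s := by
    intro k s
    induction s using TensorProduct.induction_on with
    | zero => simp
    | tmul l a =>
      change δ (k * l) ⊗ₜ[F] a = (δ k * l) ⊗ₜ[F] a + (k * δ l) ⊗ₜ[F] a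
      rw [← TensorProduct.add_tmul, Derivation.leibniz, add_comm, smul_eq_mul, smul_eq_mul,
        mul_comm l]
    | add s t hs ht => rw [smul_add, map_add, hs, ht, map_add, smul_add, smul_add]; abel
  have hδ'a : ∀ a s, δ' ((1 ⊗ₜ a) * s) = (1 ⊗ₜ a) * δ' s := by
    intro a s
    induction s using TensorProduct.induction_on with
    | zero => simp
    | tmul l b =>
      rw [Algebra.TensorProduct.tmul_mul_tmul]
      change δ (1 * l) ⊗ₜ[F] (a * b) = (1 ⊗ₜ a) * (δ l ⊗ₜ b)
      rw [Algebra.TensorProduct.tmul_mul_tmul, one_mul, one_mul]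
    | add s t hs ht => rw [mul_add, map_add, hs, ht, map_add, mul_add]
  have i₀ : ι := Classical.arbitrary ι
  let e₀ : ι → K := Pi.single i₀ 1
  -- Vectors are viewed as matrices supported on one column, a copy of $K^n$ as a left module; the
  -- connection is read off from that column after differentiating.
  let N : (ι → K) → Matrix ι ι K := fun v => Matrix.vecMulVec v e₀
  have hNcol : ∀ v, (N v).mulVec e₀ = v := by
    intro v
    ext i
    simp [N, e₀, Matrix.vecMulVec_apply]
  have hNsmul : ∀ (k : K) v, N (k • v) = k • N v := fun k v => Matrix.smul_vecMulVec k v _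
  have hNmul : ∀ M v, N (M.mulVec v) = M * N v := fun M v => (Matrix.mul_vecMulVec M v _).symm
  have hNadd : ∀ v w, N (v + w) = N v + N w := fun v w => Matrix.add_vecMulVec v w _
  let T : (ι → K) → ι → K := fun v => (Φ (δ' (Φ.symm (N v)))).mulVec e₀
  have hT : ∀ (k : K) v, T (k • v) = δ k • v + k • T v := by
    intro k v
    simp only [T]
    rw [hNsmul, map_smul, hδ'k, map_add, map_smul, map_smul, Matrix.add_mulVec, Matrix.smul_mulVec,
      Matrix.smul_mulVec, Φ.apply_symm_apply, hNcol]
  refine ⟨{ toFun := T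
            map_add' := fun v w => by
              simp only [T]
              rw [hNadd, map_add, map_add, map_add, Matrix.add_mulVec]
            map_smul' := fun r v => by
              rw [← algebraMap_smul K r v, hT, Derivation.map_algebraMap, zero_smul, zero_add,
                algebraMap_smul, RingHom.id_apply] }, hT, fun a v => ?_⟩
  change T _ = (ρ a).mulVec (T v)
  simp only [T]
  have h1 : Φ.symm (N ((ρ a).mulVec v)) = (1 ⊗ₜ a) * Φ.symm (N v) := by
    apply Φ.injective
    rw [Φ.apply_symm_apply, map_mul, hΦ, Φ.apply_symm_apply, hNmul]
  rw [h1, hδ'a, map_mul, hΦ, Matrix.mulVec_mulVec]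

end Connection

/-- The class `c` is trivial or the class of `[f, a)` for an irreducible Artin–Schreier polynomial
`X ^ p - X - f`. -/
def IsArtinSchreierClass {F : Type u} [Field F] (p : ℕ) (a : F) (c : BrauerGroup.{u, u} F) :
    Prop :=
  c = 1 ∨ ∃ (f : F) (_ : Fact (Irreducible (artinSchreierPoly p f)))
    (σ : ArtinSchreierExt p f ≃ₐ[F] ArtinSchreierExt p f)
    (hσ : IsArtinSchreierLift p (AlgEquiv.refl : F ≃ₐ[F] F) f 1 σ (AdjoinRoot.root _))
    (ha : a ≠ 0), c = (CSA.cyclic hσ.isCyclicGenerator ha).brauerClass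

theorem isCyclicGenerator_refl {F : Type u} [Field F] :
    IsCyclicGenerator (AlgEquiv.refl : F ≃ₐ[F] F) :=
  ⟨inferInstance, inferInstance, fun τ => by
    rw [Subsingleton.elim τ AlgEquiv.refl]; exact Subgroup.mem_zpowers _⟩

/-! ### Removing one generator of the splitting field -/

section DerivationStep

variable {F E K : Type u} [Field F] [Field E] [Field K] [Algebra F E] [Algebra E K] [Algebra F K]
  [IsScalarTower F E K] (p : ℕ) [Fact p.Prime] [CharP F p]

/-- The operators of `[f, a)` on a representation space over `K`. -/
theorem exists_artinSchreier_operator {A : Type u} [Ring A] [Algebra F A] [Algebra.IsCentral F A]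
    [IsSimpleRing A] [FiniteDimensional F A] {ι : Type} [Fintype ι] [DecidableEq ι] [Nonempty ι]
    (ρ : A →ₐ[F] Matrix ι ι K) (hd : Fintype.card ι ^ 2 = Module.finrank F A)
    (δ : Derivation E K K) (hδp : ∀ k, δ^[p] k = δ k)
    (hker : ∀ k, δ k = 0 → ∃ e, algebraMap E K e = k) (hKp : ∀ k : K, ∃ f, algebraMap F K f = k ^ p) :
    ∃ (f : F) (w : Module.End E (ι → K)), w ^ p - w = algebraMap F _ f ∧
      (∀ (k : K) v, w (k • v) = k • w v - δ k • v) ∧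
      ∀ a v, w ((ρ a).mulVec v) = (ρ a).mulVec (w v) := by
  obtain ⟨D, hDk, hDa⟩ := exists_connection ρ hd δ
  have : CharP E p := charP_of_injective_algebraMap (algebraMap F E).injective p
  have : CharP (Module.End E (ι → K)) p :=
    charP_of_injective_algebraMap (algebraMap E _).injective p
  have : CharP (Module.End E (Module.End E (ι → K))) p :=
    charP_of_injective_algebraMap (algebraMap E _).injective p
  let m : K → Module.End E (ι → K) := fun k => Algebra.lsmul E E (ι → K) k
  have hm : ∀ k v, m k v = k • v := fun _ _ => rfl
  have hbr : ∀ k, (LinearMap.mulLeft E D - LinearMap.mulRight E D) (m k) = m (δ k) := by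
    intro k
    refine LinearMap.ext fun v => ?_
    change D (k • v) - k • D v = δ k • v
    rw [hDk, add_sub_cancel_right]
  have hbrn : ∀ (n : ℕ) k, ((LinearMap.mulLeft E D - LinearMap.mulRight E D) ^ n) (m k) =
      m (δ^[n] k) := by
    intro n
    induction n with
    | zero => intro k; rfl
    | succ n ih => intro k; rw [pow_succ, Module.End.mul_apply, hbr, ih]; rfl
  -- In characteristic $p$ the $p$-th power of $\mathrm{ad}\,D$ is $\mathrm{ad}\,D^p$, so $D^p$ is a
  -- connection for $\delta^p=\delta$ as well.
  have hDpk : ∀ (k : K) v, (D ^ p) (k • v) = k • (D ^ p) v + δ k • v := by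
    intro k v
    have h1 := hbrn p k
    have h0 : (LinearMap.mulLeft E D - LinearMap.mulRight E D) ^ p =
        LinearMap.mulLeft E D ^ p - LinearMap.mulRight E D ^ p :=
      sub_pow_char_of_commute (R := Module.End E (Module.End E (ι → K))) (p := p)
        (LinearMap.commute_mulLeft_right D D)
    rw [h0, LinearMap.pow_mulLeft, LinearMap.pow_mulRight, hδp] at h1
    have h2 : (D ^ p) (k • v) - k • (D ^ p) v = δ k • v := LinearMap.congr_fun h1 v
    rw [← h2]
    abel
  have hDna : ∀ (n : ℕ) a v, (D ^ n) ((ρ a).mulVec v) = (ρ a).mulVec ((D ^ n) v) := by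
    intro n
    induction n with
    | zero => intro a v; rfl
    | succ n ih =>
      intro a v
      rw [pow_succ, Module.End.mul_apply, Module.End.mul_apply, hDa, ih]
  -- The difference of two connections for the same derivation is $K$-linear; as it commutes with
  -- $A$, it is a scalar $h$.
  let H : (ι → K) →ₗ[K] (ι → K) :=
    { toFun := fun v => (D ^ p) v - D v
      map_add' := fun v w => by rw [map_add, map_add]; abel
      map_smul' := fun k v => by rw [hDpk, hDk, RingHom.id_apply, smul_sub]; abel }
  obtain ⟨h, hh⟩ : ∃ h : K, LinearMap.toMatrix' H = h • (1 : Matrix ι ι K) := by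
    refine exists_eq_smul_one_of_commute ρ hd fun a => ?_
    apply (Matrix.toLin' (R := K) (n := ι) (m := ι)).injective
    refine LinearMap.ext fun v => ?_
    rw [Matrix.toLin'_mul, Matrix.toLin'_mul, Matrix.toLin'_toMatrix']
    change (D ^ p) ((ρ a).mulVec v) - D ((ρ a).mulVec v) = (ρ a).mulVec ((D ^ p) v - D v)
    rw [hDna, hDa, Matrix.mulVec_sub]
  have hH : ∀ v, (D ^ p) v - D v = h • v := by
    intro v
    have h1 := congrArg (fun M => Matrix.toLin' M v) hh
    simp only [Matrix.toLin'_toMatrix'] at h1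
    refine Eq.trans h1 ?_
    rw [map_smul, Matrix.toLin'_one]
    rfl
  -- $D$ commutes with $D^p-D=h$, which forces $\delta h=0$.
  obtain ⟨e, he⟩ := hker h (by
    have i : ι := Classical.arbitrary ι
    have h1 : D (h • Pi.single i 1) = h • D (Pi.single i 1) := by
      rw [← hH, ← hH, map_sub, ← Module.End.mul_apply, ← pow_succ', pow_succ, Module.End.mul_apply]
    rw [hDk, add_eq_right] at h1
    simpa using congrFun h1 i)
  obtain ⟨f, hf⟩ := hKp h
  have hHe : D ^ p - D = algebraMap E _ e := by
    refine LinearMap.ext fun v => ?_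
    rw [LinearMap.sub_apply, hH, Module.algebraMap_end_apply, ← he, algebraMap_smul]
  have hef : e ^ p = algebraMap F E f := by
    apply (algebraMap E K).injective
    rw [map_pow, he, ← hf, ← IsScalarTower.algebraMap_apply]
  -- $D$ only solves an Artin–Schreier equation with parameter $e\in E$. Passing to $D^p$ replaces
  -- it by $e^p\in F$, while the commutation rule survives; the sign yields $xw=(w+1)x$ when $\delta
  -- x=x$.
  refine ⟨-f, -D ^ p, ?_, fun k v => ?_, fun a v => ?_⟩
  · have h1 : (-D ^ p) ^ p = -(D ^ p) ^ p := by
      have h2 := sub_pow_char_of_commute (p := p) (Commute.zero_left (D ^ p))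
      rwa [zero_sub, zero_pow (Fact.out : p.Prime).ne_zero, zero_sub] at h2
    rw [h1, map_neg, IsScalarTower.algebraMap_apply F E, ← hef, map_pow, ← hHe,
      sub_pow_char_of_commute (p := p) (Commute.pow_self D p)]
    abel
  · rw [LinearMap.neg_apply, LinearMap.neg_apply, hDpk, smul_neg]
    abel
  · rw [LinearMap.neg_apply, LinearMap.neg_apply, hDna, Matrix.mulVec_neg]

/-- If $X^p-X-f$ is irreducible, $w$ and multiplication by $x$ generate $[f,a)$ on $K^n$, and the
$E$-dimension $pn$ is exactly the degree of $A\otimes[f,a)$. If $f=c^p-c$, there is no such field,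
but the kernel of $w-c$ is an $A$-stable space showing that $E$ splits $A$ itself. -/
theorem CSA.exists_artinSchreierClass_isSplitOver (A : CSA.{u, u} F) (h : IsSplitOver F K A)
    (δ : Derivation E K K) (hδp : ∀ k, δ^[p] k = δ k)
    (hker : ∀ k, δ k = 0 → ∃ e, algebraMap E K e = k) (hKp : ∀ k : K, ∃ f, algebraMap F K f = k ^ p)
    [FiniteDimensional F E] (hEK : Module.finrank E K = p) {x : K} (hx : δ x = x) {a : F}
    (ha : a ≠ 0) (hxa : x ^ p = algebraMap F K a) :
    ∃ (B : CSA.{u, u} F) (c : BrauerGroup.{u, u} F), IsArtinSchreierClass p a c ∧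
      B.brauerClass = A.brauerClass * c ∧ IsSplitOver F E B := by
  have hp := (Fact.out : p.Prime)
  obtain ⟨n, hn, hd, ⟨ρ⟩⟩ := h
  have : Nonempty (Fin n) := ⟨⟨0, Nat.pos_of_ne_zero hn⟩⟩
  have : CharP E p := charP_of_injective_algebraMap (algebraMap F E).injective p
  have : FiniteDimensional E K := Module.finite_of_finrank_pos (by rw [hEK]; exact hp.pos)
  let V := Fin n → K
  obtain ⟨f, w, hwf, hwk, hwa⟩ := exists_artinSchreier_operator p ρ (by rw [Fintype.card_fin, hd])
    δ hδp hker hKp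
  have : CharP (Module.End E V) p := charP_of_injective_algebraMap (algebraMap E _).injective p
  let θ : A →ₐ[F] Module.End E V := ((restrictScalarsEnd E K V).restrictScalars F).comp
    (((Matrix.toLinAlgEquiv' (R := K) (n := Fin n)).toAlgHom.restrictScalars F).comp ρ)
  have hθ : ∀ a v, θ a v = (ρ a).mulVec v := fun _ _ => rfl
  have hKV : Module.finrank K V = n := by rw [Module.finrank_fintype_fun_eq_card, Fintype.card_fin]
  by_cases hf : ∃ c : F, c ^ p - c = f
  · obtain ⟨c, hc⟩ := hf
    refine ⟨A, 1, Or.inl rfl, (mul_one _).symm, ?_⟩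
    let w' : Module.End E V := w - algebraMap F _ c
    have hw' : w' ^ p = w' := by
      have h1 : w' ^ p - w' = 0 := by
        simp only [w']
        rw [sub_pow_char_of_commute (p := p) (Algebra.commutes c w).symm, sub_sub_sub_comm, hwf,
          ← hc, map_sub, map_pow, sub_self]
      exact sub_eq_zero.1 h1
    have hw'v : ∀ v, w' v = w v - c • v := fun v => rfl
    have hw'k : ∀ (k : K) v, w' (k • v) = k • w' v - δ k • v := by
      intro k v
      rw [hw'v, hwk, hw'v, smul_sub, smul_comm c k v]
      abel
    have hx0 : x ≠ 0 := by
      rintro rfl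
      rw [zero_pow hp.ne_zero] at hxa
      exact ha ((map_eq_zero _).1 hxa.symm)
    obtain ⟨N, v, hv, hNv⟩ := exists_natCast_eigenvector p hw'
    -- Multiplication by $x$ lowers the eigenvalue by one, so from the eigenvalue $N$ in the prime
    -- field one reaches the kernel after $N$ steps.
    have hshift : ∀ i : ℕ, w' (x ^ i • v) = ((N : E) - i) • x ^ i • v := by
      intro i
      induction i with
      | zero => simpa using hNv
      | succ i ih =>
        rw [pow_succ', mul_smul, hw'k, ih, hx, smul_comm x, ← mul_smul x, Nat.cast_succ, ← sub_sub, sub_smul _ (1 : E),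
          one_smul]
    let W : Submodule E V := LinearMap.ker w'
    have hW : ∀ v, v ∈ W ↔ w' v = 0 := fun _ => LinearMap.mem_ker
    have hnt : Nontrivial W := by
      rw [Submodule.nontrivial_iff_ne_bot, Submodule.ne_bot_iff]
      refine ⟨x ^ N • v, ?_, smul_ne_zero (pow_ne_zero _ hx0) hv⟩
      rw [hW, hshift, sub_self, zero_smul]
    have hle : Module.finrank E W ≤ n := by
      refine le_trans ?_ hKV.le
      -- Applying $w'$ to a relation between kernel vectors differentiates its coefficients. The map
      -- $k\mapsto k+\delta k$ therefore preserves relations, and its fixed elements are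
      -- $\ker\delta=E$.
      refine finrank_le_of_forall_relation (G := Unit) (τ := fun _ k => k + δ k) (fun _ => by simp)
        (fun k hk => hker k (by simpa using hk ())) fun y _ s g hg => ?_
      have h1 := congrArg w' hg
      simp only [map_sum, hw'k, (hW _).1 (Subtype.property _), smul_zero, zero_sub, map_zero,
        Finset.sum_neg_distrib, neg_eq_zero] at h1
      simp only [add_smul, Finset.sum_add_distrib, hg, h1, add_zero]
    refine isSplitOver_of_algHom_end (restrictAlgHom θ W fun b v hv => ?_) ?_
    · rw [hW] at hv ⊢
      rw [hw'v, sub_eq_zero] at hv ⊢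
      rw [hθ, hwa, hv, Matrix.mulVec_smul]
    · rw [← hd]
      exact Nat.pow_le_pow_left hle 2
  · push Not at hf
    have hirr : Fact (Irreducible (artinSchreierPoly p f)) := ⟨irreducible_artinSchreierPoly p hf⟩
    let L := ArtinSchreierExt p f
    let P := artinSchreierPoly p f
    obtain ⟨σ, hσ⟩ := exists_isArtinSchreierLift p (σ' := (AlgEquiv.refl : F ≃ₐ[F] F)) (z := f)
      (d := 1) isCyclicGenerator_refl (by simp) (by simp)
    let j : L →ₐ[F] Module.End E V := Ideal.Quotient.liftₐ (Ideal.span {P}) (Polynomial.aeval w) (by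
      intro g hg
      obtain ⟨g', rfl⟩ := Ideal.mem_span_singleton'.1 hg
      have h1 : Polynomial.aeval w P = 0 := by
        simp only [P, map_sub, map_pow, Polynomial.aeval_X, Polynomial.aeval_C]
        rw [hwf, sub_self]
      rw [map_mul, h1, mul_zero])
    have hj : j (AdjoinRoot.root P) = w := (Ideal.Quotient.lift_mk _ _ _).trans (Polynomial.aeval_X w)
    have hind : ∀ Q : L → Prop, (∀ l, Q (algebraMap F L l)) → Q (AdjoinRoot.root P) →
        (∀ l l', Q l → Q l' → Q (l + l')) → (∀ l l', Q l → Q l' → Q (l * l')) → ∀ l, Q l := by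
      intro Q h1 h2 h3 h4 l
      have hl : l ∈ Algebra.adjoin F {AdjoinRoot.root P} := by
        rw [AdjoinRoot.adjoinRoot_eq_top]; trivial
      induction hl using Algebra.adjoin_induction with
      | mem l hl => rw [Set.mem_singleton_iff.1 hl]; exact h2
      | algebraMap l => exact h1 l
      | add l l' _ _ hl hl' => exact h3 _ _ hl hl'
      | mul l l' _ _ hl hl' => exact h4 _ _ hl hl'
    let y : Module.End E V := Algebra.lsmul E E V x
    have hyw : y * w = (w + 1) * y := by
      refine LinearMap.ext fun v => ?_
      change x • w v = w (x • v) + x • v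
      rw [hwk, hx, sub_add_cancel]
    have hpair : IsCyclicPair σ a j y := by
      refine ⟨?_, ?_⟩
      · rw [finrank_artinSchreierExt, ← map_pow, hxa]
        refine LinearMap.ext fun v => ?_
        change algebraMap F K a • v = a • v
        rw [algebraMap_smul]
      · refine hind _ (fun l => ?_) ?_ (fun l l' hl hl' => ?_) (fun l l' hl hl' => ?_)
        · rw [AlgEquiv.commutes, AlgHom.commutes, Algebra.commutes]
        · rw [hσ.map_gen, map_one, map_add, map_one, hj, hyw]
        · rw [map_add, map_add, map_add, mul_add, add_mul, hl, hl']
        · rw [map_mul, map_mul, map_mul, ← mul_assoc, hl, mul_assoc, hl', mul_assoc]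
    obtain ⟨φ⟩ := CSA.exists_tensor_cyclic_algHom hσ.isCyclicGenerator ha hpair θ
      (fun b => hind _ (fun l => by rw [AlgHom.commutes]; exact (Algebra.commutes _ _).symm) (by
          rw [hj]
          exact LinearMap.ext fun v => (hwa b v).symm) (fun l l' hl hl' => by
          rw [map_add]; exact hl.add_right hl') (fun l l' hl hl' => by
          rw [map_mul]; exact hl.mul_right hl'))
      (fun b => LinearMap.ext fun v => Matrix.mulVec_smul (ρ b) x v)
    refine ⟨A.tensor (CSA.cyclic hσ.isCyclicGenerator ha), _, Or.inr ⟨f, hirr, σ, hσ, ha, rfl⟩,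
      CSA.brauerClass_tensor _ _, isSplitOver_of_algHom_end φ ?_⟩
    rw [CSA.finrank_tensor, CSA.finrank_cyclic, finrank_artinSchreierExt, ← hd,
      ← Module.finrank_mul_finrank E K V, hEK, hKV, mul_pow, mul_comm]

end DerivationStep

/-! ### Purely inseparable extensions of degree $p$ -/

section PurelyInseparable

/-- Frobenius is injective on $K$, so $e$ is not a $p$-th power in $E$, and $X^p-e$ is irreducible.
-/
theorem minpoly_eq_X_pow_sub_C {E K : Type*} [Field E] [Field K] [Algebra E K] (p : ℕ)
    [Fact p.Prime] [CharP E p] {x : K} {e : E} (hx : x ^ p = algebraMap E K e)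
    (hxE : ∀ e', algebraMap E K e' ≠ x) : minpoly E x = Polynomial.X ^ p - Polynomial.C e := by
  have hp := (Fact.out : p.Prime)
  have : CharP K p := charP_of_injective_algebraMap (algebraMap E K).injective p
  refine (minpoly.eq_of_irreducible_of_monic ?_ (by simp [hx])
    (Polynomial.monic_X_pow_sub_C e hp.ne_zero)).symm
  refine X_pow_sub_C_irreducible_of_prime hp fun b hb => hxE b ?_
  apply frobenius_inj K p
  rw [frobenius_def, frobenius_def, ← map_pow, hb, hx]

/-- The derivation `x d/dx` of a purely inseparable extension `E(x)` of degree `p`. -/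
theorem exists_derivation_of_pow_eq {E K : Type u} [Field E] [Field K] [Algebra E K] (p : ℕ)
    [Fact p.Prime] [CharP E p] {x : K} {e : E} (hx : x ^ p = algebraMap E K e)
    (hxE : ∀ e', algebraMap E K e' ≠ x) (htop : Algebra.adjoin E {x} = ⊤) :
    ∃ δ : Derivation E K K, δ x = x ∧ (∀ k, δ^[p] k = δ k) ∧
      (∀ k, δ k = 0 → ∃ e, algebraMap E K e = k) ∧ Module.finrank E K = p := by
  have hp := (Fact.out : p.Prime)
  have : CharP K p := charP_of_injective_algebraMap (algebraMap E K).injective p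
  have hmin := minpoly_eq_X_pow_sub_C p hx hxE
  have hint : IsIntegral E x := ⟨_, Polynomial.monic_X_pow_sub_C e hp.ne_zero, by simp [hx]⟩
  let pb := PowerBasis.ofAdjoinEqTop hint htop
  have hgen : pb.gen = x := PowerBasis.ofAdjoinEqTop_gen hint htop
  have hdim : pb.dim = p := by
    rw [← pb.natDegree_minpoly, hgen, hmin, Polynomial.natDegree_X_pow_sub_C]
  -- The derivation is the dual-number part of the homomorphism $x\mapsto x+\varepsilon x$, which
  -- exists because $(x+\varepsilon x)^p=x^p$ in characteristic $p$.
  let X : TrivSqZeroExt K K := TrivSqZeroExt.inl x + TrivSqZeroExt.inr x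
  let φ : K →ₐ[E] TrivSqZeroExt K K := pb.lift X (by
    rw [hgen, hmin]
    simp only [map_sub, map_pow, Polynomial.aeval_X, Polynomial.aeval_C]
    ext
    · simp [X, hx, TrivSqZeroExt.algebraMap_eq_inl']
    · simp [X, TrivSqZeroExt.snd_pow, TrivSqZeroExt.algebraMap_eq_inl'])
  have hφx : φ x = X := by
    rw [← hgen]
    exact pb.lift_gen _ _
  have hfst : ∀ k, (φ k).fst = k := by
    have h1 : (TrivSqZeroExt.fstHom E K K).comp φ = AlgHom.id E K := by
      refine pb.algHom_ext ?_
      rw [hgen, AlgHom.comp_apply, hφx]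
      simp [X]
    exact fun k => AlgHom.congr_fun h1 k
  let δ : Derivation E K K := Derivation.mk' ((TrivSqZeroExt.sndHom K K).restrictScalars E ∘ₗ φ.toLinearMap)
    (fun a b => by
      change (φ (a * b)).snd = a • (φ b).snd + b • (φ a).snd
      rw [map_mul, TrivSqZeroExt.snd_mul, hfst, hfst]
      simp [mul_comm])
  have hδ : ∀ k, δ k = (φ k).snd := fun _ => rfl
  have hδx : δ x = x := by
    rw [hδ, hφx]
    simp [X]
  -- So $\delta$ is diagonal in the basis $x^i$, $0\le i<p$, with eigenvalues $i$: $\delta^p=\delta$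
  -- follows from $i^p=i$, and the kernel is spanned by $x^0$.
  have hδpow : ∀ i : ℕ, δ (x ^ i) = (i : K) * x ^ i := by
    intro i
    induction i with
    | zero => simp
    | succ i ih =>
      rw [pow_succ, Derivation.leibniz, ih, hδx, Nat.cast_succ, smul_eq_mul, smul_eq_mul]
      ring
  have hb : ∀ i, pb.basis i = x ^ (i : ℕ) := fun i => by rw [pb.basis_eq_pow, hgen]
  refine ⟨δ, hδx, ?_, fun k hk => ?_, ?_⟩
  · have h1 : ((δ : K →ₗ[E] K) ^ p : Module.End E K) = (δ : K →ₗ[E] K) := by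
      refine pb.basis.ext fun i => ?_
      have h2 : ∀ n : ℕ, ((δ : K →ₗ[E] K) ^ n : Module.End E K) (pb.basis i) =
          ((i : ℕ) : E) ^ n • pb.basis i := by
        intro n
        induction n with
        | zero => simp
        | succ n ih =>
          rw [pow_succ', Module.End.mul_apply, ih, map_smul, hb]
          change _ • δ (x ^ (i : ℕ)) = _
          rw [hδpow, pow_succ, mul_smul, Algebra.smul_def ((i : ℕ) : E), map_natCast]
      have h3 : ((i : ℕ) : E) ^ p = (i : ℕ) := by
        rw [← frobenius_def, map_natCast]
      rw [h2, h3, ← pow_one ((i : ℕ) : E), ← h2, pow_one]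
    intro k
    have h2 := LinearMap.congr_fun h1 k
    rw [Module.End.pow_apply] at h2
    exact h2
  · have h0 : 0 < pb.dim := by rw [hdim]; exact hp.pos
    have h1 : ∑ i, (pb.basis.repr k i * ((i : ℕ) : E)) • pb.basis i = 0 := by
      refine Eq.trans ?_ hk
      conv_rhs => rw [← pb.basis.sum_repr k, map_sum]
      refine Finset.sum_congr rfl fun i _ => ?_
      rw [Derivation.map_smul, hb, hδpow, mul_smul, Algebra.smul_def ((i : ℕ) : E), map_natCast]
    have h2 := Fintype.linearIndependent_iff.1 pb.basis.linearIndependent _ h1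
    refine ⟨pb.basis.repr k ⟨0, h0⟩, ?_⟩
    conv_rhs => rw [← pb.basis.sum_repr k]
    rw [Finset.sum_eq_single ⟨0, h0⟩, hb, pow_zero, Algebra.algebraMap_eq_smul_one]
    · intro i _ hi
      have h3 : ((i : ℕ) : E) ≠ 0 := by
        rw [Ne, CharP.cast_eq_zero_iff E p]
        intro hdvd
        refine hi (Fin.ext (Nat.eq_zero_of_dvd_of_lt hdvd ?_))
        exact i.2.trans_eq hdim
      rw [(mul_eq_zero.1 (h2 i)).resolve_right h3, zero_smul]
    · simp
  · rw [pb.finrank, hdim]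

end PurelyInseparable

/-! ### From splitting by $F(x_1,\dots,x_r)$ to products of symbols -/

section SplittingInduction

theorem IsSplitOver.of_algHom {F K K' A : Type*} [Field F] [Field K] [Field K'] [Algebra F K]
    [Algebra F K'] [Ring A] [Algebra F A] (h : IsSplitOver F K A) (g : K →ₐ[F] K') :
    IsSplitOver F K' A := by
  obtain ⟨n, hn, hd, ⟨ρ⟩⟩ := h
  exact ⟨n, hn, hd, ⟨g.mapMatrix.comp ρ⟩⟩

/-- An algebra split by `F(x₁, …, x_r)`, `x_i ^ p = a_i`, is similar to the inverse of a product of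
Artin–Schreier symbols with second entries `a_i`. -/
theorem CSA.exists_artinSchreierClass_of_isSplitOver {F : Type u} [Field F] (p : ℕ) [Fact p.Prime]
    [CharP F p] (r : ℕ) : ∀ (K : Type u) [Field K] [Algebra F K] [FiniteDimensional F K]
    (x : Fin r → K) (a : Fin r → F), (∀ i, a i ≠ 0) → (∀ i, x i ^ p = algebraMap F K (a i)) →
    (∀ k : K, ∃ f, algebraMap F K f = k ^ p) → IntermediateField.adjoin F (Set.range x) = ⊤ →
    ∀ A : CSA.{u, u} F, IsSplitOver F K A → ∃ c : Fin r → BrauerGroup.{u, u} F,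
      (∀ i, IsArtinSchreierClass p (a i) (c i)) ∧ A.brauerClass * ∏ i, c i = 1 := by
  induction r with
  | zero =>
    intro K _ _ _ x a ha hx hKp htop A hA
    refine ⟨fun i => i.elim0, fun i => i.elim0, ?_⟩
    rw [Finset.univ_eq_empty, Finset.prod_empty, mul_one, brauerClass_eq_one_iff]
    rw [Set.range_eq_empty, IntermediateField.adjoin_empty] at htop
    exact hA.of_algHom ((IntermediateField.botEquiv F K).toAlgHom.comp
      ((IntermediateField.equivOfEq htop.symm).toAlgHom.comp
        IntermediateField.topEquiv.symm.toAlgHom))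
  | succ r ih =>
    intro K _ _ _ x a ha hx hKp htop A hA
    let S : Set K := Set.range (x ∘ Fin.castSucc)
    let E := IntermediateField.adjoin F S
    let x' : Fin r → E := fun i => ⟨x i.castSucc, IntermediateField.subset_adjoin F S ⟨i, rfl⟩⟩
    let y := x (Fin.last r)
    have hrange : Set.range x = S ∪ {y} := by
      ext k
      constructor
      · rintro ⟨i, rfl⟩
        refine Fin.lastCases (Or.inr rfl) (fun i => Or.inl ⟨i, rfl⟩) i
      · rintro (⟨i, rfl⟩ | hk)
        · exact ⟨_, rfl⟩
        · exact ⟨_, hk.symm⟩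
    have hx' : ∀ i, x' i ^ p = algebraMap F E (a i.castSucc) := fun i => Subtype.ext (hx _)
    have hEp : ∀ k : E, ∃ f, algebraMap F E f = k ^ p := by
      intro k
      obtain ⟨f, hf⟩ := hKp k
      exact ⟨f, Subtype.ext hf⟩
    have hEtop : IntermediateField.adjoin F (Set.range x') = ⊤ := by
      apply IntermediateField.map_injective E.val
      rw [IntermediateField.adjoin_map, ← Set.range_comp]
      exact (AlgHom.fieldRange_eq_map E.val).symm ▸ (IntermediateField.fieldRange_val E).symm
    -- The generators may be redundant: if the last one already lies in $E$, the trivial class is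
    -- contributed and nothing changes.
    have key : ∃ (B : CSA.{u, u} F) (c : BrauerGroup.{u, u} F),
        IsArtinSchreierClass p (a (Fin.last r)) c ∧ B.brauerClass = A.brauerClass * c ∧
          IsSplitOver F E B := by
      by_cases hy : y ∈ E
      · refine ⟨A, 1, Or.inl rfl, (mul_one _).symm, ?_⟩
        have hE : E = ⊤ := by
          rw [eq_top_iff, ← htop, hrange, IntermediateField.adjoin_le_iff]
          exact Set.union_subset (IntermediateField.subset_adjoin F S)
            (Set.singleton_subset_iff.2 hy)
        exact hA.of_algHom ((IntermediateField.equivOfEq hE.symm).toAlgHom.comp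
          IntermediateField.topEquiv.symm.toAlgHom)
      · have : CharP E p := charP_of_injective_algebraMap (algebraMap F E).injective p
        have hint : IsIntegral E y := Algebra.IsIntegral.isIntegral y
        have hytop : Algebra.adjoin E {y} = ⊤ := by
          rw [← IntermediateField.adjoin_simple_toSubalgebra_of_isAlgebraic hint.isAlgebraic]
          have h1 : (IntermediateField.adjoin E {y}).restrictScalars F = ⊤ := by
            rw [IntermediateField.adjoin_adjoin_left, ← hrange, htop]
          rw [IntermediateField.restrictScalars_eq_top_iff] at h1
          rw [h1, IntermediateField.top_toSubalgebra]
        obtain ⟨δ, hδy, hδp, hker, hdeg⟩ := exists_derivation_of_pow_eq p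
          (e := algebraMap F E (a (Fin.last r))) (hx _) (fun e' he => hy (show x (Fin.last r) ∈ E from he ▸ e'.2)) hytop
        exact A.exists_artinSchreierClass_isSplitOver p hA δ hδp hker hKp hdeg hδy (ha _) (hx _)
    obtain ⟨B, c₀, hc₀, hB, hsplit⟩ := key
    obtain ⟨c, hc, hBc⟩ := ih E x' (fun i => a i.castSucc) (fun i => ha _) hx' hEp hEtop B hsplit
    refine ⟨Fin.snoc (α := fun _ => BrauerGroup.{u, u} F) c c₀, fun i => ?_, ?_⟩
    · refine Fin.lastCases ?_ (fun i => ?_) i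
      · rwa [Fin.snoc_last]
      · rw [Fin.snoc_castSucc]
        exact hc i
    · rw [Fin.prod_univ_castSucc]
      simp only [Fin.snoc_castSucc, Fin.snoc_last]
      rw [mul_comm (∏ i, c i), ← mul_assoc, ← hB, hBc]

end SplittingInduction

/-! ### The $p$-torsion over a $C_m$ field -/

section CmFields

variable {F : Type u} [Field F] (p : ℕ) [Fact p.Prime] [CharP F p]

/-- A `C_m` field of characteristic `p` satisfies `[F : F ^ p] ≤ p ^ m`. -/
theorem IsCmField.rank_frobeniusRoot_le {m : ℕ} (hF : IsCmField m F) :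
    Module.rank F (FrobeniusRoot F p) ≤ (p ^ m : ℕ) := by
  have hp := (Fact.out : p.Prime)
  refine rank_le fun s hs => ?_
  by_contra! hcard
  -- The coefficients of the form are the $p$-th powers of the independent elements of $F^{1/p}$;
  -- taking $p$-th roots of $\sum y_iX_i^p=0$ gives a linear relation between those elements.
  let y : Fin s.card → F := fun i => FrobeniusRoot.toBase p (s.equivFin.symm i : FrobeniusRoot F p)
  obtain ⟨x, hx, hx0⟩ := hF p s.card hp.one_le hcard
    (∑ i, MvPolynomial.C (y i) * MvPolynomial.X i ^ p) (by
      refine MvPolynomial.IsHomogeneous.sum _ _ _ fun i _ => ?_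
      have h1 := (MvPolynomial.isHomogeneous_C (Fin s.card) (y i)).mul
        ((MvPolynomial.isHomogeneous_X F i).pow p)
      rwa [zero_add, one_mul] at h1)
  have h1 := Fintype.linearIndependent_iff.1 (hs.comp _ s.equivFin.symm.injective) x (by
    apply (FrobeniusRoot.toBase (F := F) p).injective
    rw [map_zero, ← hx0, map_sum, map_sum]
    refine Finset.sum_congr rfl fun i _ => ?_
    rw [Algebra.smul_def, map_mul, map_mul, map_pow, MvPolynomial.eval_C, MvPolynomial.eval_X,
      mul_comm]
    rfl)
  exact hx (funext h1)

theorem IsCmField.finiteDimensional_frobeniusRoot {m : ℕ} (hF : IsCmField m F) :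
    FiniteDimensional F (FrobeniusRoot F p) :=
  Module.rank_lt_aleph0_iff.1 ((hF.rank_frobeniusRoot_le p).trans_lt (Cardinal.natCast_lt_aleph0))

/-- A purely inseparable extension of height one and degree at most `p ^ m` is generated by `m`
elements. -/
theorem exists_adjoin_range_eq_top {K : Type*} [Field K] [Algebra F K] [FiniteDimensional F K]
    (hKp : ∀ k : K, ∃ f, algebraMap F K f = k ^ p) {m : ℕ} (hm : Module.finrank F K ≤ p ^ m) :
    ∃ x : Fin m → K, (∀ i, x i ≠ 0) ∧ IntermediateField.adjoin F (Set.range x) = ⊤ := by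
  have hp := (Fact.out : p.Prime)
  -- Each new element outside the field generated so far multiplies the degree by $p$; once
  -- everything is generated, the list is padded with $1$, so exactly $m$ nonzero elements result.
  have key : ∀ k : ℕ, ∃ x : Fin k → K, (∀ i, x i ≠ 0) ∧
      (IntermediateField.adjoin F (Set.range x) = ⊤ ∨
        p ^ k ≤ Module.finrank F (IntermediateField.adjoin F (Set.range x))) := by
    intro k
    induction k with
    | zero => exact ⟨fun i => i.elim0, fun i => i.elim0, Or.inr Module.finrank_pos⟩
    | succ k ih =>
      obtain ⟨x, hx, h⟩ := ih
      let E := IntermediateField.adjoin F (Set.range x)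
      have hsnoc : ∀ y : K, IntermediateField.adjoin F (Set.range (Fin.snoc (α := fun _ => K) x y)) =
          (IntermediateField.adjoin E {y}).restrictScalars F := by
        intro y
        rw [IntermediateField.adjoin_adjoin_left]
        congr 1
        ext z
        constructor
        · rintro ⟨i, rfl⟩
          refine Fin.lastCases (Or.inr ?_) (fun i => Or.inl ⟨i, ?_⟩) i
          · rw [Fin.snoc_last]; rfl
          · rw [Fin.snoc_castSucc]
        · rintro (⟨i, rfl⟩ | hk)
          · exact ⟨i.castSucc, Fin.snoc_castSucc (α := fun _ => K) _ _ _⟩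
          · exact ⟨Fin.last _, (Fin.snoc_last (α := fun _ => K) _ _).trans hk.symm⟩
      have hne : ∀ y : K, y ≠ 0 → ∀ i, Fin.snoc (α := fun _ => K) x y i ≠ 0 := by
        intro y hy i
        refine Fin.lastCases ?_ (fun i => ?_) i
        · rwa [Fin.snoc_last]
        · rw [Fin.snoc_castSucc]
          exact hx i
      by_cases hE : E = ⊤
      · refine ⟨Fin.snoc (α := fun _ => K) x 1, hne 1 one_ne_zero, Or.inl ?_⟩
        rw [hsnoc, eq_top_iff, ← hE]
        intro z hz
        exact (IntermediateField.adjoin E {(1 : K)}).algebraMap_mem ⟨z, hz⟩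
      · obtain ⟨y, hy⟩ : ∃ y, y ∉ E := by
          by_contra! h'
          exact hE (eq_top_iff.2 fun z _ => h' z)
        have hy0 : y ≠ 0 := fun h' => hy (h' ▸ zero_mem E)
        refine ⟨Fin.snoc (α := fun _ => K) x y, hne y hy0, Or.inr ?_⟩
        have : CharP E p := charP_of_injective_algebraMap (algebraMap F E).injective p
        obtain ⟨f, hf⟩ := hKp y
        have hmin := minpoly_eq_X_pow_sub_C p (E := E) (x := y) (e := algebraMap F E f) hf.symm
          (fun e' he => hy (he ▸ e'.2))
        have hdeg : Module.finrank E (IntermediateField.adjoin E {y}) = p := by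
          rw [IntermediateField.adjoin.finrank (Algebra.IsIntegral.isIntegral y), hmin,
            Polynomial.natDegree_X_pow_sub_C]
        rw [hsnoc, pow_succ]
        refine (Nat.mul_le_mul_right p (h.resolve_left hE)).trans_eq ?_
        have h1 := Module.finrank_mul_finrank F E (IntermediateField.adjoin E {y})
        rw [hdeg] at h1
        exact h1
  obtain ⟨x, hx, h⟩ := key m
  refine ⟨x, hx, h.elim id fun h => ?_⟩
  exact IntermediateField.toSubalgebra_injective (Subalgebra.toSubmodule_injective
    (Submodule.eq_top_of_finrank_eq ((Submodule.finrank_le _).antisymm (hm.trans h))))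

/-- Over a `C_m` field of characteristic `p`, the `p`-torsion of the Brauer group consists of sums
of `m` Artin–Schreier symbols with fixed second entries. -/
theorem IsCmField.exists_artinSchreierClass {m : ℕ} (hF : IsCmField m F) :
    ∃ a : Fin m → F, (∀ i, a i ≠ 0) ∧ ∀ A : CSA.{u, u} F, A.brauerClass ^ p = 1 →
      ∃ c : Fin m → BrauerGroup.{u, u} F, (∀ i, IsArtinSchreierClass p (a i) (c i)) ∧
        A.brauerClass = ∏ i, c i := by
  have := hF.finiteDimensional_frobeniusRoot p
  have hle : Module.finrank F (FrobeniusRoot F p) ≤ p ^ m := by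
    have h1 := hF.rank_frobeniusRoot_le p
    rw [← Module.finrank_eq_rank] at h1
    exact_mod_cast h1
  have hKp : ∀ k : FrobeniusRoot F p, ∃ f, algebraMap F _ f = k ^ p :=
    fun k => ⟨FrobeniusRoot.toBase p k, (FrobeniusRoot.pow_eq p k).symm⟩
  obtain ⟨x, hx, htop⟩ := exists_adjoin_range_eq_top p hKp hle
  refine ⟨fun i => FrobeniusRoot.toBase p (x i), fun i => ?_, fun A hA => ?_⟩
  · rw [Ne, map_eq_zero_iff _ (RingEquiv.injective _)]
    exact hx i
  -- The splitting induction expresses the inverse of a class as a product of symbols, so it is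
  -- applied to the opposite algebra.
  · have h1 := A.brauerClass_mul_op
    have h2 : A.op.brauerClass ^ p = 1 := by
      rw [← one_mul (A.op.brauerClass ^ p), ← hA, ← mul_pow, h1, one_pow, hA]
    obtain ⟨c, hc, hprod⟩ := CSA.exists_artinSchreierClass_of_isSplitOver p m (FrobeniusRoot F p) x
      (fun i => FrobeniusRoot.toBase p (x i))
      (fun i => by
        rw [Ne, map_eq_zero_iff _ (RingEquiv.injective _)]
        exact hx i) (fun i => FrobeniusRoot.pow_eq p _) hKp htop A.op
      (A.op.isSplitOver_frobeniusRoot p h2)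
    exact ⟨c, hc, by rw [← mul_one A.brauerClass, ← hprod, ← mul_assoc, h1, one_mul]⟩

end CmFields

/-! ### Induction on the exponent with fixed second entries -/

section CyclicClasses

variable {F : Type u} [Field F] (p : ℕ)

/-- `c` is the class of a cyclic algebra `(L/F, σ, a)` of degree `p ^ i`. -/
def IsCyclicClass (i : ℕ) (a : F) (c : BrauerGroup.{u, u} F) : Prop :=
  ∃ (L : Type u) (_ : Field L) (_ : Algebra F L) (σ : L ≃ₐ[F] L) (hσ : IsCyclicGenerator σ)
    (ha : a ≠ 0), Module.finrank F L = p ^ i ∧ c = (CSA.cyclic hσ ha).brauerClass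

variable {p} in
theorem IsCyclicClass.exists_isCyclicAlgebra {i : ℕ} {a : F} {c : BrauerGroup.{u, u} F}
    (h : IsCyclicClass p i a c) :
    ∃ C : CSA.{u, u} F, C.IsCyclicAlgebra (p ^ i) ∧ C.brauerClass = c := by
  obtain ⟨L, _, _, σ, hσ, ha, hL, rfl⟩ := h
  exact ⟨CSA.cyclic hσ ha, hL ▸ CSA.isCyclicAlgebra_cyclic hσ ha, rfl⟩

variable [Fact p.Prime] [CharP F p]

omit [CharP F p] in
variable {p} in
theorem IsArtinSchreierClass.eq_one_or_isCyclicClass {a : F} {c : BrauerGroup.{u, u} F}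
    (h : IsArtinSchreierClass p a c) : c = 1 ∨ IsCyclicClass p 1 a c := by
  refine h.imp id ?_
  rintro ⟨f, _, σ, hσ, ha, rfl⟩
  exact ⟨_, _, _, σ, hσ.isCyclicGenerator, ha, by rw [finrank_artinSchreierExt, pow_one], rfl⟩

variable {p} in
/-- Embedding the cyclic extension of a cyclic algebra in a cyclic extension of the next degree. -/
theorem IsCyclicClass.exists_lift {i : ℕ} (hi : i ≠ 0) {a : F} {c : BrauerGroup.{u, u} F}
    (h : IsCyclicClass p i a c) : IsCyclicClass p (i + 1) (a ^ p) c ∧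
      ∃ c', c' ^ p = c ∧ IsCyclicClass p (i + 1) a c' ∧
        ∀ s, IsArtinSchreierClass p a s → IsCyclicClass p (i + 1) a (c' * s) := by
  have hp := (Fact.out : p.Prime)
  obtain ⟨L', _, _, σ', hσ', ha, hL', rfl⟩ := h
  have hdvd : p ∣ Module.finrank F L' := hL' ▸ dvd_pow_self p hi
  have := hσ'.finiteDimensional
  have : CharP L' p := charP_of_injective_algebraMap (algebraMap F L').injective p
  obtain ⟨z, d, hz, hd⟩ := hσ'.exists_artinSchreier p
  have hdeg : ∀ z : L', ∀ [Fact (Irreducible (artinSchreierPoly p z))],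
      Module.finrank F (ArtinSchreierExt p z) = p ^ (i + 1) := by
    intro z _
    have h1 := Module.finrank_mul_finrank F L' (ArtinSchreierExt p z)
    rw [finrank_artinSchreierExt, hL', ← pow_succ] at h1
    exact h1.symm
  have hirr : Fact (Irreducible (artinSchreierPoly p z)) :=
    ⟨irreducible_artinSchreierPoly p (hσ'.pow_sub_ne p hdvd hz hd)⟩
  obtain ⟨σ, hσ⟩ := exists_isArtinSchreierLift p hσ' hz hd
  have htower := CSA.brauerClass_cyclic_tower p hσ.isCyclicGenerator hσ' hσ.compat hσ.finrank_eq ha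
  have hc' : IsCyclicClass p (i + 1) a (CSA.cyclic hσ.isCyclicGenerator ha).brauerClass :=
    ⟨_, _, _, σ, hσ.isCyclicGenerator, ha, hdeg z, rfl⟩
  refine ⟨⟨_, _, _, σ, hσ.isCyclicGenerator, pow_ne_zero p ha, hdeg z, htower.symm⟩, _, ?_, hc',
    ?_⟩
  -- $c'^p=(L/F,\sigma,a^p)$, which is the class over $L'$ with second entry $a$ by the tower
  -- formula.
  · rw [← CSA.brauerClass_cyclic_pow _ _ hp.ne_zero, htower]
  · rintro s (rfl | ⟨f, _, σM, hσM, ha', rfl⟩)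
    · rwa [mul_one]
    -- Adding $f\in F$ to $z$ leaves $\sigma'z-z$ unchanged, so the same $d$ defines the new cyclic
    -- extension.
    · have hz' : σ' (z + algebraMap F L' f) - (z + algebraMap F L' f) = d ^ p - d := by
        rw [map_add, AlgEquiv.commutes, add_sub_add_right_eq_sub, hz]
      have hirr' : Fact (Irreducible (artinSchreierPoly p (z + algebraMap F L' f))) :=
        ⟨irreducible_artinSchreierPoly p (hσ'.pow_sub_ne p hdvd hz' hd)⟩
      obtain ⟨σ₃, hσ₃⟩ := exists_isArtinSchreierLift p hσ' hz' hd
      exact ⟨_, _, _, σ₃, hσ₃.isCyclicGenerator, ha, hdeg _,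
        CSA.brauerClass_cyclic_mul_artinSchreier hσ' hd hσ hσM hσ₃ ha⟩

variable {p} in
-- Each step up the tower keeps the class but replaces the second entry by its $p$-th power, so this
-- is done only after the induction that needs fixed entries. The case $i=0$ is excluded, since a
-- lift of the trivial extension need not exist.
theorem IsCyclicClass.exists_of_le {i e : ℕ} (hi : i ≠ 0) (hie : i ≤ e) {a : F}
    {c : BrauerGroup.{u, u} F} (h : IsCyclicClass p i a c) : ∃ b : F, IsCyclicClass p e b c := by
  induction e, hie using Nat.le_induction with
  | base => exact ⟨a, h⟩
  | succ e hie ih =>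
    obtain ⟨b, hb⟩ := ih
    exact ⟨_, (hb.exists_lift (by omega)).1⟩

/-- `c` is trivial or the class of a cyclic algebra `(L/F, σ, a)` of degree `p ^ i`, `i ≤ j`. -/
def IsCyclicClassLE (j : ℕ) (a : F) (c : BrauerGroup.{u, u} F) : Prop :=
  c = 1 ∨ ∃ i ≠ 0, i ≤ j ∧ IsCyclicClass p i a c

variable {p} in
-- For a trivial class the root $1$ is chosen, and the product is then the symbol itself; this is
-- why degrees below $p^j$ must be allowed.
theorem IsCyclicClassLE.exists_lift {j : ℕ} {a : F} {c : BrauerGroup.{u, u} F}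
    (h : IsCyclicClassLE p j a c) : ∃ c', c' ^ p = c ∧
      ∀ s, IsArtinSchreierClass p a s → IsCyclicClassLE p (j + 1) a (c' * s) := by
  obtain rfl | ⟨i, hi, hij, h⟩ := h
  · refine ⟨1, one_pow p, fun s hs => ?_⟩
    rw [one_mul]
    exact hs.eq_one_or_isCyclicClass.imp id fun h => ⟨1, one_ne_zero, by omega, h⟩
  · obtain ⟨-, c', hc', -, hs⟩ := h.exists_lift hi
    exact ⟨c', hc', fun s hs' => Or.inr ⟨i + 1, by omega, by omega, hs s hs'⟩⟩

/-- If the `p`-torsion of the Brauer group consists of products of Artin–Schreier symbols with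
second entries `a i`, then the `p ^ j`-torsion consists of products of cyclic classes with the same
second entries. -/
theorem exists_isCyclicClassLE {m : ℕ} {a : Fin m → F}
    (h : ∀ A : CSA.{u, u} F, A.brauerClass ^ p = 1 → ∃ c : Fin m → BrauerGroup.{u, u} F,
      (∀ i, IsArtinSchreierClass p (a i) (c i)) ∧ A.brauerClass = ∏ i, c i) (j : ℕ) :
    ∀ x : BrauerGroup.{u, u} F, x ^ p ^ j = 1 → ∃ c : Fin m → BrauerGroup.{u, u} F,
      (∀ i, IsCyclicClassLE p j (a i) (c i)) ∧ x = ∏ i, c i := by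
  induction j with
  | zero =>
    intro x hx
    exact ⟨fun _ => 1, fun _ => Or.inl rfl, by simpa using hx⟩
  | succ j ih =>
    intro x hx
    obtain ⟨c, hc, hxc⟩ := ih (x ^ p) (by rw [← pow_mul, ← pow_succ', hx])
    choose c' hc' hs using fun i => (hc i).exists_lift
    -- `y` is the inverse of the product of the chosen $p$-th roots. Then $xy$ is $p$-torsion, and
    -- its symbols are absorbed factor by factor because the second entries agree.
    obtain ⟨y, hy⟩ := (CSA.isUnit_brauerClass (∏ i, c' i)).exists_right_inv
    obtain ⟨A, hA⟩ := CSA.exists_brauerClass (x * y)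
    obtain ⟨s, hsA, hAs⟩ := h A (by
      rw [hA, mul_pow, hxc, ← Finset.prod_congr rfl fun i _ => hc' i, Finset.prod_pow, ← mul_pow,
        hy, one_pow])
    refine ⟨fun i => c' i * s i, fun i => hs i _ (hsA i), ?_⟩
    rw [Finset.prod_mul_distrib, ← hAs, hA, mul_left_comm, hy, mul_one]

end CyclicClasses

/-! ### Symbol length and Brauer dimension -/

section MainTheorem

variable {F : Type u} [Field F]

theorem CSA.exists_brauerClass_eq_prod {n r : ℕ} (C : Fin r → CSA.{u, u} F)
    (hC : ∀ i, Module.finrank F (C i) = n ^ 2) :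
    ∃ B : CSA.{u, u} F, B.brauerClass = ∏ i, (C i).brauerClass ∧
      Module.finrank F B = (n ^ r) ^ 2 := by
  induction r with
  | zero => exact ⟨CSA.base F, by simpa using brauerClass_base,
      (Module.finrank_self F).trans (by simp)⟩
  | succ r ih =>
    obtain ⟨B, hB, hd⟩ := ih (fun i => C i.castSucc) fun i => hC _
    refine ⟨B.tensor (C (Fin.last r)), ?_, ?_⟩
    · rw [brauerClass_tensor, hB, Fin.prod_univ_castSucc]
    · rw [finrank_tensor, hd, hC, ← mul_pow, ← pow_succ]

theorem CSA.IsSimilarToProductOfCyclic.index_dvd {A : CSA.{u, u} F} {n r : ℕ}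
    (h : A.IsSimilarToProductOfCyclic n r) : A.index ∣ n ^ r := by
  obtain ⟨C, hC, hA⟩ := h
  obtain ⟨B, hB, hd⟩ := exists_brauerClass_eq_prod C fun i => (hC i).1
  exact index_dvd_of_brauerClass_eq (hA.trans hB.symm) hd

theorem IsCmField.exists_isSimilarToProductOfCyclic {p m : ℕ} [Fact p.Prime] [CharP F p]
    (hF : IsCmField m F) {e : ℕ} {A : CSA.{u, u} F} (hA : A.exponent = p ^ e) :
    ∃ r : ℕ, r ≤ m ∧ A.IsSimilarToProductOfCyclic (p ^ e) r := by
  classical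
  obtain ⟨a, -, ha⟩ := hF.exists_artinSchreierClass p
  obtain ⟨c, hc, hAc⟩ := exists_isCyclicClassLE p ha e A.brauerClass
    (by rw [← hA]; exact pow_orderOf_eq_one _)
  -- Only nontrivial factors are kept: they have degree $p^i$ with $1\le i\le e$ and can be lifted
  -- to degree exactly $p^e$. For $e=0$ none remains.
  let S : Finset (Fin m) := Finset.univ.filter fun i => c i ≠ 1
  have h1 : ∀ i : S, ∃ C : CSA.{u, u} F, C.IsCyclicAlgebra (p ^ e) ∧ C.brauerClass = c i := by
    intro i
    obtain ⟨k, hk, hke, h⟩ := (hc i).resolve_left (Finset.mem_filter.1 i.2).2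
    obtain ⟨b, hb⟩ := h.exists_of_le hk hke
    exact hb.exists_isCyclicAlgebra
  choose C hC hCc using h1
  refine ⟨S.card, (Finset.card_le_univ S).trans_eq (Fintype.card_fin m),
    fun i => C (S.equivFin.symm i), fun i => hC _, ?_⟩
  rw [hAc]
  simp only [hCc]
  rw [Equiv.prod_comp S.equivFin.symm fun i : S => c i, Finset.prod_coe_sort S c,
    Finset.prod_filter_ne_one]

end MainTheorem

theorem mainTheorem8 (F : Type u) [Field F] (p m : ℕ) (hp : p.Prime) [CharP F p]
    (hF : IsCmField m F) :
    (∀ (e : ℕ) (A : CSA.{u, u} F), A.exponent = p ^ e →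
      ∃ r : ℕ, r ≤ m ∧ A.IsSimilarToProductOfCyclic (p ^ e) r) ∧
    (∀ e : ℕ, symbolLengthField (p ^ e) F ≤ m) ∧
    brauerDimAt p F ≤ m := by
  have : Fact p.Prime := ⟨hp⟩
  refine ⟨fun e A hA => hF.exists_isSimilarToProductOfCyclic hA, fun e => ?_, ?_⟩
  · refine iSup₂_le fun A hA => ?_
    obtain ⟨r, hr, h⟩ := hF.exists_isSimilarToProductOfCyclic hA
    exact (show A.symbolLength (p ^ e) ≤ r from sInf_le ⟨r, rfl, h⟩).trans (Nat.cast_le.2 hr)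
  · refine sInf_le ⟨m, rfl, fun n A hA => ?_⟩
    -- A class killed by $p^n$ has exponent $p^e$ for some $e$, so the first assertion applies and
    -- bounds the index by $(p^e)^r$ with $r\le m$.
    obtain ⟨e, -, he⟩ := (Nat.dvd_prime_pow hp).1 (orderOf_dvd_of_pow_eq_one hA)
    obtain ⟨r, hr, h⟩ := hF.exists_isSimilarToProductOfCyclic (A := A) (e := e) he
    refine h.index_dvd.trans ?_
    change (p ^ e) ^ r ∣ orderOf A.brauerClass ^ m
    rw [he]
    exact pow_dvd_pow _ hr
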